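/- **Setting.** Let $\Lambda$ be a finite or countable set and $\boldsymbol u=(\boldsymbol r_\ell,v_\ell,Z_\ell)_{\ell\in\Lambda}$ a configuration (positions $\boldsymbol r_\ell\in\mathbb R^d$ with $\inf_{\ell\ne k}|\boldsymbol r_\ell-\boldsymbol r_k|>0$, bounded effective potentials $v_\ell$, species $Z_\ell$); write $\boldsymbol r_{\ell k}=\boldsymbol r_k-\boldsymbol r_\ell$, $\boldsymbol u_{\ell k}=(\boldsymbol r_{\ell k},Z_\ell,Z_k)$. Let $\mathcal H=\mathcal H(\boldsymbol u)$ be the tight binding Hamiltonian with $N_{\rm b}\ge1$ orbitals per atom, i.e. the bounded self-adjoint operator on $\ell^2(\Lambda\times\{1,\dots,N_{\rm b}\})$ with blocks $$\mathcal H_{\ell k}=h(\boldsymbol u_{\ell k})+\sum_{m\notin\{\ell,k\}}t(\boldsymbol u_{\ell m},\boldsymbol u_{km})+\delta_{\ell k}v_\ell\,\mathrm{Id}\in\mathbb R^{N_{\rm b}\times N_{\rm b}},$$ where $h,t$ are $C^1$ in the positions, $|h(\boldsymbol u_{\ell k})|+|\nabla h(\boldsymbol u_{\ell k})|\le h_0e^{-\gamma_0|\boldsymbol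 r_{\ell k}|}$ and $|t(\boldsymbol u_{\ell m},\boldsymbol u_{km})|+|\nabla t(\boldsymbol u_{\ell m},\boldsymbol u_{km})|\le h_0e^{-\gamma_0(|\boldsymbol r_{\ell m}|+|\boldsymbol r_{km}|)}$ for some $h_0,\gamma_0>0$, $h(\boldsymbol u_{\ell k})=h(\boldsymbol u_{k\ell})^{\rm T}$, $t(\boldsymbol u_{\ell m},\boldsymbol u_{km})=t(\boldsymbol u_{km},\boldsymbol u_{\ell m})^{\rm T}$, and for every orthogonal $Q$ there are orthogonal $D^\ell(Q)$ with $\mathcal H(Q\boldsymbol u)_{\ell k}=D^\ell(Q)\mathcal H(\boldsymbol u)_{\ell k}D^k(Q)^{\rm T}$. Let $I_\pm$ be nonempty compact intervals and $\{\lambda_j\}$ a finite set of reals with $$\sigma(\mathcal H)\subset I_-\cup\{\lambda_j\}\cup I_+,\qquad \max I_-\le\mu\le\min I_+,$$ and put $\mathsf g=\min I_+-\max I_-$ and $\mathsf g^{\rm def}=\min(I_+\cup\{\lambda_j:\lambda_j\ge\mu\})-\max(I_-\cup\{\lambda_j:\lambda_j\le\mu\})$. Fix $0<\beta\le\infty$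 and suppose that, if $\beta=\infty$, then $\max I_-<\mu<\min I_+$ (so $\mathsf g>0$) and $\mathsf g^{\rm def}>0$. Let $O^\beta=F^\beta$ or $G^\beta$, where for $\beta<\infty$, $F^\beta(z)=(1+e^{\beta(z-\mu)})^{-1}$ and $G^\beta(z)=\frac2\beta\log(1-F^\beta(z))$, while $F^\infty=\chi_{(-\infty,\mu)}+\frac12\chi_{\{\mu\}}$ and $G^\infty(z)=2(z-\mu)\chi_{(-\infty,\mu)}(z)$. Put $O^\beta_\ell(\boldsymbol u)=\mathrm{tr}\,[O^\beta(\mathcal H)_{\ell\ell}]$ and $m_j=N_{\rm b}^{-1}\mathrm{tr}\,[\mathcal H^j]_{\ell\ell}$ (so $m_j=[\mathcal H^j]_{\ell\ell}$ if $N_{\rm b}=1$). **The nonlinear map.** Let $N=2n+1$ be odd. For $x=(x_1,\dots,x_N)\in\mathbb R^N$ let $\mathcal L$ be the linear functional on polynomials of degree at most $N$ with $\mathcal L(1)=1$, $\mathcal L(X^j)=x_j$. Put $p_{-1}=0$, $p_0=1$, $b_0=0$, $a_k=\mathcal L(Xp_k^2)$ and $b_{k+1}p_{k+1}=(X-a_k)p_k-b_kp_{k-1}$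 with $b_{k+1}\geq0$ chosen such that $\mathcal L(p_{k+1}^2)=1$. Let $T_n=T_{(N-1)/2}$ be the $(n+1)\times(n+1)$ Jacobi matrix with diagonal $a_0,\dots,a_n$ and off-diagonal $b_1,\dots,b_n$, and $$\Theta(x_1,\dots,x_N)=O^\beta\big(T_{(N-1)/2}\big)_{00}.$$ The recursion is regular up to step $n$ if $b_1,\dots,b_n$ can be chosen positive; if it terminates ($b_{k}=0$ for moments $x=(m_1,\dots,m_N)$), then $T_n$ is completed by zeros. **Theorem.** 1. For every odd $N$ there are an open set $U\subset\mathbb C^N$ and an analytic function $U\to\mathbb C$, depending only on $N$, $\beta$, $\mu$ and the choice of $F^\beta$ or $G^\beta$, such that $U$ contains every $x\in\mathbb R^N$ for which the recursion is regular up to step $\frac{N-1}2$ and, if $\beta=\infty$, $\mu\notin\sigma(T_{(N-1)/2})$; at each such $x$ the analytic function equals $\Theta(x)$. 2. There are rates $\gamma_N\in\mathbb R$ with limit $\gamma=\lim_{N\to\infty}\gamma_N>0$, depending only on $I_-,I_+,\mu,\beta$ (hence not on the defect eigenvalues $\lambda_j$, nor otherwise on $\boldsymbol u$), such that, with a constant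 $C$ independent of $N$ and $\ell$, $$\Big|O^\beta_\ell(\boldsymbol u)-N_{\rm b}\,\Theta(m_1,\dots,m_N)\Big|\le C\,e^{-\gamma_NN}\qquad\text{for all odd }N\text{ and all }\ell\in\Lambda .$$ 3. $\gamma\sim\mathsf g+\beta^{-1}$ as $\mathsf g+\beta^{-1}\to0$ symmetrically about $\mu$: for all $a<\mu<b$ there are $c_1,c_2,\varepsilon>0$ such that, for $I_-=[a,\mu-\frac12\mathsf g]$ and $I_+=[\mu+\frac12\mathsf g,b]$, $c_1(\mathsf g+\beta^{-1})\le\gamma\le c_2(\mathsf g+\beta^{-1})$ whenever $0<\mathsf g+\beta^{-1}<\varepsilon$. -/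

import Mathlib

open Filter Topology
open scoped ENNReal

universe uSite uSpecies

/-! ## Configurations and tight binding Hamiltonians -/

/-- A configuration of atoms indexed by `Λ`: positions `r`, effective potentials `v`, and atomic
species `Z`. -/
structure Configuration (d : ℕ) (Λ : Type uSite) (S : Type uSpecies) where
  r : Λ → EuclideanSpace ℝ (Fin d)
  v : Λ → ℝ
  Z : Λ → S

/-- The relative state `(r_k - r_ℓ, Z_ℓ, Z_k)` of a pair of atoms, without the effective potentials
(on which the functions `h` and `t` below do not depend). -/
abbrev RelState (d : ℕ) (S : Type uSpecies) := EuclideanSpace ℝ (Fin d) × S × S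

/-- The relative state `u_{ℓk}`. -/
noncomputable def Configuration.rel {d : ℕ} {Λ : Type uSite} {S : Type uSpecies}
    (u : Configuration d Λ S) (l k : Λ) : RelState d S :=
  (u.r k - u.r l, u.Z l, u.Z k)

/-- The configuration `Q u`, where `Q` acts on the positions. -/
noncomputable def Configuration.rotate {d : ℕ} {Λ : Type uSite} {S : Type uSpecies}
    (Q : EuclideanSpace ℝ (Fin d) ≃ₗᵢ[ℝ] EuclideanSpace ℝ (Fin d))
    (u : Configuration d Λ S) : Configuration d Λ S :=
  ⟨fun l => Q (u.r l), u.v, u.Z⟩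

/-- Standing assumptions on a configuration: the atoms do not come arbitrarily close to each other
and the effective potential is bounded. -/
def Configuration.Admissible {d : ℕ} {Λ : Type uSite} {S : Type uSpecies}
    (u : Configuration d Λ S) : Prop :=
  (∃ ρ > 0, ∀ l k, l ≠ k → ρ ≤ ‖u.r k - u.r l‖) ∧ ∃ V, ∀ l, |u.v l| ≤ V

/-- The two-centre function `h` and the three-centre function `t` of a tight binding model with
`Nb` orbitals per atom. -/
structure TBFunctions (d Nb : ℕ) (S : Type uSpecies) where
  h : RelState d S → Matrix (Fin Nb) (Fin Nb) ℝ
  t : RelState d S → RelState d S → Matrix (Fin Nb) (Fin Nb) ℝ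

open Classical in
/-- The block `H(u)_{ℓk} = h(u_{ℓk}) + ∑_{m ∉ {ℓ,k}} t(u_{ℓm}, u_{km}) + δ_{ℓk} v_ℓ Id`. -/
noncomputable def TBFunctions.block {d Nb : ℕ} {Λ : Type uSite} {S : Type uSpecies}
    (M : TBFunctions d Nb S) (u : Configuration d Λ S) (l k : Λ) :
    Matrix (Fin Nb) (Fin Nb) ℝ :=
  Matrix.of fun a b =>
    M.h (u.rel l k) a b
      + (∑' m : {m : Λ // m ≠ l ∧ m ≠ k}, M.t (u.rel l m) (u.rel k m) a b)
      + (if l = k ∧ a = b then u.v l else 0)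

/-- The Frobenius norm `|A|` of a matrix. -/
noncomputable def frob {Nb : ℕ} (A : Matrix (Fin Nb) (Fin Nb) ℝ) : ℝ :=
  √(∑ a, ∑ b, A a b ^ 2)

/-- `|∇f(x)|`, the Frobenius norm of the gradient of a matrix-valued function: the root of the sum of
the squares of the norms of the gradients of the entries. -/
noncomputable def gradNorm {E : Type*} [NormedAddCommGroup E] [NormedSpace ℝ E] {Nb : ℕ}
    (f : E → Matrix (Fin Nb) (Fin Nb) ℝ) (x : E) : ℝ :=
  frob (Matrix.of fun a b => ‖fderiv ℝ (fun y => f y a b) x‖)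

/-- The tight binding assumption for the configuration `u`: smoothness and exponential decay of `h`
and `t`, and the symmetries of the Hamiltonian. -/
structure IsTightBinding {d Nb : ℕ} {Λ : Type uSite} {S : Type uSpecies}
    (M : TBFunctions d Nb S) (u : Configuration d Λ S) : Prop where
  contDiff_h : ∀ (z w : S) (a b : Fin Nb),
    ContDiff ℝ 1 fun ξ : EuclideanSpace ℝ (Fin d) => M.h (ξ, z, w) a b
  contDiff_t : ∀ (z w z' w' : S) (a b : Fin Nb),
    ContDiff ℝ 1 fun q : EuclideanSpace ℝ (Fin d) × EuclideanSpace ℝ (Fin d) =>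
      M.t (q.1, z, w) (q.2, z', w') a b
  decay : ∃ h₀ > 0, ∃ γ₀ > 0,
    (∀ l k, frob (M.h (u.rel l k))
        + gradNorm (fun ξ => M.h (ξ, u.Z l, u.Z k)) (u.r k - u.r l)
      ≤ h₀ * Real.exp (-γ₀ * ‖u.r k - u.r l‖)) ∧
    (∀ l k m, m ≠ l → m ≠ k → frob (M.t (u.rel l m) (u.rel k m))
        + gradNorm
            (fun q : EuclideanSpace ℝ (Fin d) × EuclideanSpace ℝ (Fin d) =>
              M.t (q.1, u.Z l, u.Z m) (q.2, u.Z k, u.Z m))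
            (u.r m - u.r l, u.r m - u.r k)
      ≤ h₀ * Real.exp (-γ₀ * (‖u.r m - u.r l‖ + ‖u.r m - u.r k‖)))
  symm_h : ∀ l k, M.h (u.rel l k) = (M.h (u.rel k l)).transpose
  symm_t : ∀ l k m, M.t (u.rel l m) (u.rel k m) = (M.t (u.rel k m) (u.rel l m)).transpose
  rotation : ∀ Q : EuclideanSpace ℝ (Fin d) ≃ₗᵢ[ℝ] EuclideanSpace ℝ (Fin d),
    ∃ D : Λ → Matrix (Fin Nb) (Fin Nb) ℝ,
      (∀ l, D l ∈ Matrix.orthogonalGroup (Fin Nb) ℝ) ∧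
      ∀ l k, M.block (u.rotate Q) l k = D l * M.block u l k * (D k).transpose

/-- The Hilbert space `ℓ²(Λ × {1, …, Nb})`. -/
noncomputable abbrev StateSpace (Λ : Type uSite) (Nb : ℕ) := lp (fun _ : Λ × Fin Nb => ℂ) 2

open Classical in
/-- The matrix entry `A_{ij} = ⟨e_i, A e_j⟩` of a bounded operator. -/
noncomputable def opEntry {Λ : Type uSite} {Nb : ℕ}
    (A : StateSpace Λ Nb →L[ℂ] StateSpace Λ Nb) (i j : Λ × Fin Nb) : ℂ :=
  (A (lp.single 2 j (1 : ℂ))) i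

open Classical in
/-- The Hamiltonian: the (unique) bounded operator on `ℓ²(Λ × {1, …, Nb})` with blocks
`H(u)_{ℓk}`.  (It exists for tight binding models, see `opEntry_hamiltonian`.) -/
noncomputable def hamiltonian {d Nb : ℕ} {Λ : Type uSite} {S : Type uSpecies}
    (M : TBFunctions d Nb S) (u : Configuration d Λ S) :
    StateSpace Λ Nb →L[ℂ] StateSpace Λ Nb :=
  if hex : ∃ H : StateSpace Λ Nb →L[ℂ] StateSpace Λ Nb,
      ∀ i j, opEntry H i j = (M.block u i.1 j.1 i.2 j.2 : ℂ)
  then hex.choose else 0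

/-! ### Existence of the Hamiltonian -/

theorem lintegral_exp_neg_norm_lt_top (d : ℕ) (γ : ℝ) (hγ : 0 < γ) :
    ∫⁻ x : EuclideanSpace ℝ (Fin d), ENNReal.ofReal (Real.exp (-γ * ‖x‖)) < ⊤ := by
  have hfin := finite_integral_one_add_norm (E := EuclideanSpace ℝ (Fin d))
    (μ := MeasureTheory.volume) (r := ((d + 1 : ℕ) : ℝ)) (by simp)
  set K : ℝ := (d + 1).factorial * Real.exp γ / γ ^ (d + 1) with hK
  have hK0 : 0 ≤ K := by positivity
  have hb : ∀ x : EuclideanSpace ℝ (Fin d), ENNReal.ofReal (Real.exp (-γ * ‖x‖)) ≤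
      ENNReal.ofReal K * ENNReal.ofReal ((1 + ‖x‖) ^ (-((d + 1 : ℕ) : ℝ))) := by
    intro x
    rw [← ENNReal.ofReal_mul hK0]
    apply ENNReal.ofReal_le_ofReal
    have h1 : (0 : ℝ) < 1 + ‖x‖ := by positivity
    rw [Real.rpow_neg h1.le, Real.rpow_natCast, ← div_eq_mul_inv, le_div_iff₀ (by positivity), hK,
      le_div_iff₀ (by positivity)]
    have h2 := Real.pow_div_factorial_le_exp (x := γ * (1 + ‖x‖)) (by positivity) (d + 1)
    rw [div_le_iff₀ (by positivity), mul_pow] at h2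
    have h3 : Real.exp (γ * (1 + ‖x‖)) * Real.exp (-γ * ‖x‖) = Real.exp γ := by
      rw [← Real.exp_add]; ring_nf
    calc Real.exp (-γ * ‖x‖) * (1 + ‖x‖) ^ (d + 1) * γ ^ (d + 1)
        = (γ ^ (d + 1) * (1 + ‖x‖) ^ (d + 1)) * Real.exp (-γ * ‖x‖) := by ring
      _ ≤ (Real.exp (γ * (1 + ‖x‖)) * (d + 1).factorial) * Real.exp (-γ * ‖x‖) := by gcongr
      _ = (d + 1).factorial * (Real.exp (γ * (1 + ‖x‖)) * Real.exp (-γ * ‖x‖)) := by ring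
      _ = _ := by rw [h3]
  refine lt_of_le_of_lt (MeasureTheory.lintegral_mono hb) ?_
  rw [MeasureTheory.lintegral_const_mul' _ _ ENNReal.ofReal_ne_top]
  exact ENNReal.mul_lt_top ENNReal.ofReal_lt_top hfin

theorem exists_tsum_exp_le {d : ℕ} {Λ : Type*} [Countable Λ]
    (r : Λ → EuclideanSpace ℝ (Fin d)) (ρ γ : ℝ) (hρ : 0 < ρ) (hγ : 0 < γ)
    (hr : ∀ l k, l ≠ k → ρ ≤ ‖r k - r l‖) :
    ∃ s : ℝ≥0∞, s < ⊤ ∧ ∀ l, ∑' k, ENNReal.ofReal (Real.exp (-γ * ‖r k - r l‖)) ≤ s := by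
  set v : ℝ≥0∞ := MeasureTheory.volume (Metric.ball (0 : EuclideanSpace ℝ (Fin d)) (ρ / 2))
  have hv0 : v ≠ 0 := (Metric.measure_ball_pos _ _ (by positivity)).ne'
  have hvt : v ≠ ⊤ := MeasureTheory.measure_ball_lt_top.ne
  set J := ∫⁻ x : EuclideanSpace ℝ (Fin d), ENNReal.ofReal (Real.exp (-γ * ‖x‖))
  have hJ : J < ⊤ := lintegral_exp_neg_norm_lt_top d γ hγ
  set e := ENNReal.ofReal (Real.exp (γ * (ρ / 2)))
  refine ⟨e * J / v, ENNReal.div_lt_top (ENNReal.mul_lt_top ENNReal.ofReal_lt_top hJ).ne hv0, ?_⟩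
  intro l
  rw [ENNReal.le_div_iff_mul_le (Or.inl hv0) (Or.inl hvt), ← ENNReal.tsum_mul_right]
  have hdisj : Pairwise (Function.onFun Disjoint fun k => Metric.ball (r k) (ρ / 2)) := by
    intro k m hkm
    apply Metric.ball_disjoint_ball
    rw [dist_eq_norm]
    linarith [hr m k hkm.symm]
  calc ∑' k, ENNReal.ofReal (Real.exp (-γ * ‖r k - r l‖)) * v
      ≤ ∑' k, ∫⁻ x in Metric.ball (r k) (ρ / 2),
          e * ENNReal.ofReal (Real.exp (-γ * ‖x - r l‖)) := by
        refine ENNReal.tsum_le_tsum fun k => ?_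
        have hvk : v = MeasureTheory.volume (Metric.ball (r k) (ρ / 2)) := by
          simp only [v, MeasureTheory.Measure.addHaar_ball_center]
        rw [hvk, ← MeasureTheory.setLIntegral_const]
        refine MeasureTheory.setLIntegral_mono' measurableSet_ball fun x hx => ?_
        rw [← ENNReal.ofReal_mul (Real.exp_pos _).le, ← Real.exp_add]
        apply ENNReal.ofReal_le_ofReal
        apply Real.exp_le_exp.mpr
        rw [Metric.mem_ball, dist_eq_norm] at hx
        have := norm_sub_le_norm_sub_add_norm_sub x (r k) (r l)
        nlinarith
    _ = ∫⁻ x in ⋃ k, Metric.ball (r k) (ρ / 2),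
          e * ENNReal.ofReal (Real.exp (-γ * ‖x - r l‖)) :=
        (MeasureTheory.lintegral_iUnion (fun k => measurableSet_ball) hdisj _).symm
    _ ≤ ∫⁻ x, e * ENNReal.ofReal (Real.exp (-γ * ‖x - r l‖)) :=
        MeasureTheory.setLIntegral_le_lintegral _ _
    _ = e * J := by
        rw [MeasureTheory.lintegral_const_mul' _ _ ENNReal.ofReal_ne_top,
          MeasureTheory.lintegral_sub_right_eq_self
            (fun x : EuclideanSpace ℝ (Fin d) => ENNReal.ofReal (Real.exp (-γ * ‖x‖))) (r l)]

theorem exists_operator_of_schur {ι : Type*} [DecidableEq ι] (A : ι → ι → ℝ) (K : ℝ) (hA : ∀ i j, |A i j| = |A j i|)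
    (hs : ∀ i, Summable fun j => |A i j|) (hK : ∀ i, ∑' j, |A i j| ≤ K) :
    ∃ H : lp (fun _ : ι => ℂ) 2 →L[ℂ] lp (fun _ : ι => ℂ) 2,
      ∀ i j, (H (lp.single 2 j (1 : ℂ))) i = (A i j : ℂ) := by
  rcases isEmpty_or_nonempty ι with hι | ⟨⟨i₀⟩⟩
  · exact ⟨0, fun i => hι.elim i⟩
  have hK0 : 0 ≤ K := le_trans (tsum_nonneg fun j => abs_nonneg _) (hK i₀)
  have h2 : (0 : ℝ) < (2 : ℝ≥0∞).toReal := by norm_num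
  have hs1 : ∀ (ψ : lp (fun _ : ι => ℂ) 2) i, Summable fun j => |A i j| * ‖ψ j‖ := fun ψ i =>
    Summable.of_nonneg_of_le (fun j => by positivity)
      (fun j => mul_le_mul_of_nonneg_left (lp.norm_apply_le_norm (by norm_num) ψ j) (abs_nonneg _))
      ((hs i).mul_right ‖ψ‖)
  have hs2 : ∀ (ψ : lp (fun _ : ι => ℂ) 2) i, Summable fun j => |A i j| * ‖ψ j‖ ^ 2 := fun ψ i =>
    Summable.of_nonneg_of_le (fun j => by positivity)
      (fun j => mul_le_mul_of_nonneg_left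
        (pow_le_pow_left₀ (norm_nonneg _) (lp.norm_apply_le_norm (by norm_num) ψ j) 2)
        (abs_nonneg _))
      ((hs i).mul_right (‖ψ‖ ^ 2))
  have hs3 : ∀ (ψ : lp (fun _ : ι => ℂ) 2) i, Summable fun j => (A i j : ℂ) * ψ j := fun ψ i =>
    Summable.of_norm (by simpa [norm_mul] using hs1 ψ i)
  have hψ : ∀ ψ : lp (fun _ : ι => ℂ) 2, Summable fun j => ‖ψ j‖ ^ 2 := fun ψ => by
    simpa using (lp.memℓp ψ).summable h2
  have hψn : ∀ ψ : lp (fun _ : ι => ℂ) 2, ∑' j, ‖ψ j‖ ^ 2 = ‖ψ‖ ^ 2 := fun ψ => by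
    simpa using (lp.norm_rpow_eq_tsum h2 ψ).symm
  -- Cauchy-Schwarz
  have hcs : ∀ (ψ : lp (fun _ : ι => ℂ) 2) i,
      ‖∑' j, (A i j : ℂ) * ψ j‖ ^ 2 ≤ K * ∑' j, |A i j| * ‖ψ j‖ ^ 2 := by
    intro ψ i
    have h1 : ‖∑' j, (A i j : ℂ) * ψ j‖ ≤ ∑' j, |A i j| * ‖ψ j‖ := by
      refine (norm_tsum_le_tsum_norm (by simpa [norm_mul] using hs1 ψ i)).trans_eq ?_
      simp
    have h3 : ∑' j, |A i j| * ‖ψ j‖ ≤ √(K * ∑' j, |A i j| * ‖ψ j‖ ^ 2) := by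
      refine (hs1 ψ i).tsum_le_of_sum_le fun s => ?_
      apply Real.le_sqrt_of_sq_le
      have h4 := Finset.sum_mul_sq_le_sq_mul_sq s (fun j => √|A i j|) (fun j => √|A i j| * ‖ψ j‖)
      have h5 : ∀ j, √|A i j| * (√|A i j| * ‖ψ j‖) = |A i j| * ‖ψ j‖ := fun j => by
        rw [← mul_assoc, Real.mul_self_sqrt (abs_nonneg _)]
      simp only [h5, mul_pow, Real.sq_sqrt (abs_nonneg _)] at h4
      refine h4.trans ?_
      gcongr
      · exact ((hs i).sum_le_tsum s fun j _ => abs_nonneg _).trans (hK i)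
      · exact (hs2 ψ i).sum_le_tsum s fun j _ => by positivity
    calc ‖∑' j, (A i j : ℂ) * ψ j‖ ^ 2 ≤ (√(K * ∑' j, |A i j| * ‖ψ j‖ ^ 2)) ^ 2 := by
          gcongr; exact h1.trans h3
      _ = _ := Real.sq_sqrt (mul_nonneg hK0 (tsum_nonneg fun j => by positivity))
  have hsum : ∀ (ψ : lp (fun _ : ι => ℂ) 2) (s : Finset ι),
      ∑ i ∈ s, ‖∑' j, (A i j : ℂ) * ψ j‖ ^ 2 ≤ (K * ‖ψ‖) ^ 2 := by
    intro ψ s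
    calc ∑ i ∈ s, ‖∑' j, (A i j : ℂ) * ψ j‖ ^ 2
        ≤ ∑ i ∈ s, K * ∑' j, |A i j| * ‖ψ j‖ ^ 2 := Finset.sum_le_sum fun i _ => hcs ψ i
      _ = K * ∑' j, ∑ i ∈ s, |A i j| * ‖ψ j‖ ^ 2 := by
          rw [← Finset.mul_sum, Summable.tsum_finsetSum fun i _ => hs2 ψ i]
      _ ≤ K * ∑' j, K * ‖ψ j‖ ^ 2 := by
          refine mul_le_mul_of_nonneg_left ?_ hK0
          refine Summable.tsum_le_tsum (fun j => ?_) (summable_sum fun i _ => hs2 ψ i)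
            ((hψ ψ).mul_left K)
          rw [← Finset.sum_mul]
          gcongr
          simp only [hA _ j]
          exact ((hs j).sum_le_tsum s fun i _ => abs_nonneg _).trans (hK j)
      _ = (K * ‖ψ‖) ^ 2 := by rw [tsum_mul_left, hψn]; ring
  refine ⟨LinearMap.mkContinuous
    { toFun := fun ψ => ⟨fun i => ∑' j, (A i j : ℂ) * ψ j,
        memℓp_gen' (C := (K * ‖ψ‖) ^ 2) (by simpa using hsum ψ)⟩
      map_add' := fun ψ φ => by
        ext i
        change ∑' j, (A i j : ℂ) * (ψ j + φ j) = ∑' j, (A i j : ℂ) * ψ j + ∑' j, (A i j : ℂ) * φ j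
        simp only [mul_add]
        exact (hs3 ψ i).tsum_add (hs3 φ i)
      map_smul' := fun c ψ => by
        ext i
        change ∑' j, (A i j : ℂ) * (c * ψ j) = c * ∑' j, (A i j : ℂ) * ψ j
        rw [← tsum_mul_left]
        exact tsum_congr fun j => by ring } K
    (fun ψ => lp.norm_le_of_forall_sum_le h2 (by positivity) (by simpa using hsum ψ)), ?_⟩
  intro i j
  change ∑' m, (A i m : ℂ) * (lp.single 2 j (1 : ℂ) : lp (fun _ : ι => ℂ) 2) m = (A i j : ℂ)
  rw [tsum_eq_single j]
  · simp
  · intro m hm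
    simp [lp.single_apply, hm]

theorem abs_entry_le_frob {Nb : ℕ} (A : Matrix (Fin Nb) (Fin Nb) ℝ) (a b : Fin Nb) :
    |A a b| ≤ frob A := by
  apply Real.abs_le_sqrt
  calc A a b ^ 2 ≤ ∑ b', A a b' ^ 2 :=
        Finset.single_le_sum (f := fun b' => A a b' ^ 2) (fun _ _ => sq_nonneg _)
          (Finset.mem_univ b)
    _ ≤ ∑ a', ∑ b', A a' b' ^ 2 :=
        Finset.single_le_sum (f := fun a' => ∑ b', A a' b' ^ 2)
          (fun _ _ => Finset.sum_nonneg fun _ _ => sq_nonneg _) (Finset.mem_univ a)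

theorem TBFunctions.block_symm {d Nb : ℕ} {Λ : Type uSite} {S : Type uSpecies}
    {M : TBFunctions d Nb S} {u : Configuration d Λ S} (hM : IsTightBinding M u) (l k : Λ)
    (a b : Fin Nb) : M.block u l k a b = M.block u k l b a := by
  simp only [TBFunctions.block, Matrix.of_apply]
  congr 1
  · congr 1
    · rw [hM.symm_h l k, Matrix.transpose_apply]
    · rw [← (Equiv.subtypeEquivRight fun m : Λ => and_comm (a := m ≠ k) (b := m ≠ l)).tsum_eq]
      refine tsum_congr fun m => ?_
      rw [hM.symm_t l k, Matrix.transpose_apply]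
      rfl
  · by_cases h : l = k
    · subst h
      simp [eq_comm]
    · have h' : ¬ k = l := fun h' => h h'.symm
      simp [h, h']

/-- For a tight binding model and an admissible configuration, the operator with the blocks
`H(u)_{ℓk}` exists as a bounded operator. -/
theorem opEntry_hamiltonian {d Nb : ℕ} {Λ : Type uSite} {S : Type uSpecies} [Countable Λ]
    (M : TBFunctions d Nb S) (u : Configuration d Λ S) (hu : u.Admissible)
    (hM : IsTightBinding M u) (i j : Λ × Fin Nb) :
    opEntry (hamiltonian M u) i j = (M.block u i.1 j.1 i.2 j.2 : ℂ) := by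
  classical
  suffices hex : ∃ H : StateSpace Λ Nb →L[ℂ] StateSpace Λ Nb,
      ∀ i j, opEntry H i j = (M.block u i.1 j.1 i.2 j.2 : ℂ) by
    rw [hamiltonian, dif_pos hex]
    exact hex.choose_spec i j
  obtain ⟨⟨ρ, hρ, hsep⟩, V, hV⟩ := hu
  obtain ⟨h₀, hh₀, γ₀, hγ₀, hh, ht⟩ := hM.decay
  obtain ⟨s, hs, hsum⟩ := exists_tsum_exp_le u.r ρ γ₀ hρ hγ₀ hsep
  set E : Λ → Λ → ℝ≥0∞ := fun l k => ENNReal.ofReal (Real.exp (-γ₀ * ‖u.r k - u.r l‖)) with hE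
  have hEsymm : ∀ l k, E l k = E k l := fun l k => by simp only [hE, norm_sub_rev (u.r k)]
  set e₀ := ENNReal.ofReal h₀
  have hfr : ∀ {F : Type} [NormedAddCommGroup F] [NormedSpace ℝ F]
      (f : F → Matrix (Fin Nb) (Fin Nb) ℝ) (x : F), 0 ≤ gradNorm f x :=
    fun f x => Real.sqrt_nonneg _
  have hbound : ∀ l k a b, ‖M.block u l k a b‖ₑ ≤
      e₀ * E l k + ∑' m, e₀ * (E l m * E m k) + (if k = l then ENNReal.ofReal V else 0) := by
    intro l k a b
    simp only [TBFunctions.block, Matrix.of_apply]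
    refine (enorm_add_le _ _).trans (add_le_add ((enorm_add_le _ _).trans (add_le_add ?_ ?_)) ?_)
    · rw [Real.enorm_eq_ofReal_abs, ← ENNReal.ofReal_mul hh₀.le]
      apply ENNReal.ofReal_le_ofReal
      refine (abs_entry_le_frob _ a b).trans ((le_add_of_nonneg_right ?_).trans (hh l k))
      exact hfr _ _
    · refine enorm_tsum_le_tsum_enorm.trans ?_
      refine le_trans (ENNReal.tsum_le_tsum (g := fun m : {m : Λ // m ≠ l ∧ m ≠ k} =>
        e₀ * (E l m * E m k)) fun m => ?_)
        (ENNReal.tsum_comp_le_tsum_of_injective Subtype.val_injective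
          fun m => e₀ * (E l m * E m k))
      rw [hEsymm m k, ← ENNReal.ofReal_mul (Real.exp_pos _).le, ← Real.exp_add, ← mul_add,
        ← ENNReal.ofReal_mul hh₀.le, Real.enorm_eq_ofReal_abs]
      apply ENNReal.ofReal_le_ofReal
      refine (abs_entry_le_frob _ a b).trans
        ((le_add_of_nonneg_right ?_).trans (ht l k m m.2.1 m.2.2))
      exact hfr _ _
    · by_cases h : l = k
      · subst h
        by_cases h' : a = b
        · simpa [h', Real.enorm_eq_ofReal_abs] using ENNReal.ofReal_le_ofReal (hV l)
        · simp [h']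
      · simp [h]
  set K : ℝ≥0∞ := Nb * (e₀ * s + e₀ * (s * s) + ENNReal.ofReal V) with hK
  have hKt : K ≠ ⊤ := by
    have := ENNReal.ofReal_ne_top (r := h₀)
    have := ENNReal.ofReal_ne_top (r := V)
    rw [hK]
    finiteness
  have hrow : ∀ i : Λ × Fin Nb,
      ∑' j : Λ × Fin Nb, ‖M.block u i.1 j.1 i.2 j.2‖ₑ ≤ K := by
    rintro ⟨l, a⟩
    refine (ENNReal.tsum_prod (f := fun k b => ‖M.block u l k a b‖ₑ)).trans_le ?_
    rw [hK]
    calc ∑' k, ∑' b, ‖M.block u l k a b‖ₑ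
        ≤ ∑' k, ∑' b : Fin Nb, (e₀ * E l k + ∑' m, e₀ * (E l m * E m k)
            + (if k = l then ENNReal.ofReal V else 0)) :=
          ENNReal.tsum_le_tsum fun k => ENNReal.tsum_le_tsum fun b => hbound l k a b
      _ = Nb * (e₀ * ∑' k, E l k + e₀ * ∑' m, E l m * ∑' k, E m k + ENNReal.ofReal V) := by
          simp only [tsum_fintype, Finset.sum_const, Finset.card_univ, Fintype.card_fin,
            nsmul_eq_mul]
          rw [ENNReal.tsum_mul_left, ENNReal.tsum_add, ENNReal.tsum_add, ENNReal.tsum_mul_left,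
            ENNReal.tsum_comm, tsum_ite_eq]
          simp only [ENNReal.tsum_mul_left]
      _ ≤ Nb * (e₀ * s + e₀ * (s * s) + ENNReal.ofReal V) := by
          have h1 : ∑' m, E l m * ∑' k, E m k ≤ s * s :=
            calc ∑' m, E l m * ∑' k, E m k ≤ ∑' m, E l m * s :=
                  ENNReal.tsum_le_tsum fun m => mul_le_mul_right (hsum m) _
              _ = (∑' m, E l m) * s := ENNReal.tsum_mul_right
              _ ≤ s * s := mul_le_mul_left (hsum l) _
          gcongr
          exact hsum l
  have hsm : ∀ i : Λ × Fin Nb, Summable fun j : Λ × Fin Nb => |M.block u i.1 j.1 i.2 j.2| := by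
    intro i
    have h1 := ENNReal.summable_toReal (ne_top_of_le_ne_top hKt (hrow i))
    simpa using h1
  obtain ⟨H, hH⟩ := exists_operator_of_schur
    (fun i j : Λ × Fin Nb => M.block u i.1 j.1 i.2 j.2) K.toReal
    (fun i j => by rw [TBFunctions.block_symm hM]) hsm
    (fun i => by
      have h1 := ENNReal.toReal_mono hKt (hrow i)
      rw [ENNReal.tsum_toReal_eq fun j => enorm_ne_top] at h1
      simpa using h1)
  exact ⟨H, hH⟩

/-- `tr [A_{ℓℓ}]`, the trace of the diagonal block of the (self-adjoint) operator `A` at site `ℓ`. -/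
noncomputable def siteTrace {Λ : Type uSite} {Nb : ℕ}
    (A : StateSpace Λ Nb →L[ℂ] StateSpace Λ Nb) (l : Λ) : ℝ :=
  ∑ a : Fin Nb, (opEntry A (l, a) (l, a)).re

/-! ## Observables -/

/-- The Fermi-Dirac function `F^β` at inverse temperature `β ∈ (0, ∞]` and chemical potential
`μ`. -/
noncomputable def fermiDirac (β : ℝ≥0∞) (μ x : ℝ) : ℝ :=
  if β = ⊤ then (if x < μ then 1 else if x = μ then 1 / 2 else 0)
  else (1 + Real.exp (β.toReal * (x - μ)))⁻¹

/-- The grand potential function `G^β`. -/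
noncomputable def grandPotential (β : ℝ≥0∞) (μ x : ℝ) : ℝ :=
  if β = ⊤ then (if x < μ then 2 * (x - μ) else 0)
  else 2 / β.toReal * Real.log (1 - fermiDirac β μ x)

/-- The operator `O(A)` for a self-adjoint bounded operator `A` and a function `O` that is continuous
on its spectrum. -/
noncomputable def opFunction {E : Type*} [NormedAddCommGroup E] [InnerProductSpace ℂ E]
    [CompleteSpace E] (O : ℝ → ℝ) (A : E →L[ℂ] E) : E →L[ℂ] E :=
  cfc O A

/-- The local observable `O_ℓ(u) = tr [O(H(u))_{ℓℓ}]`. -/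
noncomputable def localObservable {d Nb : ℕ} {Λ : Type uSite} {S : Type uSpecies}
    (M : TBFunctions d Nb S) (u : Configuration d Λ S) (O : ℝ → ℝ) (l : Λ) : ℝ :=
  siteTrace (opFunction O (hamiltonian M u)) l

/-- The moments `x_j = Nb⁻¹ tr [H^(j+1)]_{ℓℓ}`, `j = 0, …, N - 1`, of the unit-mass local density of
states at `ℓ`. -/
noncomputable def ldosMoments {d Nb : ℕ} {Λ : Type uSite} {S : Type uSpecies}
    (M : TBFunctions d Nb S) (u : Configuration d Λ S) (l : Λ) (N : ℕ) : Fin N → ℝ :=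
  fun j => siteTrace (hamiltonian M u ^ (j.val + 1)) l / Nb

/-! ## The recursion method -/

section Recursion

open Polynomial

/-- The moment sequence `1, x_0, …, x_{N-1}, 0, 0, …`. -/
def momentSeq {N : ℕ} (x : Fin N → ℝ) : ℕ → ℝ
  | 0 => 1
  | j + 1 => if hj : j < N then x ⟨j, hj⟩ else 0

/-- The integral of the polynomial `Q` against a measure with moments `x`. -/
noncomputable def momentIntegral {N : ℕ} (x : Fin N → ℝ) (Q : ℝ[X]) : ℝ :=
  Q.sum fun j c => c * momentSeq x j

/-- The state `(b_k, p_{k-1}, p_k)` of the recursion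
`b_{k+1} p_{k+1} = (X - a_k) p_k - b_k p_{k-1}`, `∫ p_{k+1}² = 1`, `a_k = ∫ X p_k²`, with
`p_{-1} = 0` and `p_0 = 1`.  If `b_{k+1} = 0`, then the recursion has terminated, and all later
polynomials and coefficients are zero. -/
noncomputable def recursionState {N : ℕ} (x : Fin N → ℝ) : ℕ → ℝ × ℝ[X] × ℝ[X]
  | 0 => (0, 0, 1)
  | k + 1 =>
    let b := (recursionState x k).1
    let p' := (recursionState x k).2.1
    let p := (recursionState x k).2.2
    let q := (X - C (momentIntegral x (X * p ^ 2))) * p - C b * p'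
    let b' := √(momentIntegral x (q ^ 2))
    (b', p, C b'⁻¹ * q)

/-- The orthonormal polynomial `p_k`. -/
noncomputable def orthoPoly {N : ℕ} (x : Fin N → ℝ) (k : ℕ) : ℝ[X] := (recursionState x k).2.2

/-- The recursion coefficient `a_k = ∫ X p_k²`. -/
noncomputable def recA {N : ℕ} (x : Fin N → ℝ) (k : ℕ) : ℝ :=
  momentIntegral x (X * orthoPoly x k ^ 2)

/-- The recursion coefficient `b_k`, for `k ≥ 1`. -/
noncomputable def recB {N : ℕ} (x : Fin N → ℝ) (k : ℕ) : ℝ := (recursionState x k).1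

end Recursion

/-- The `(n+1) × (n+1)` tridiagonal (Jacobi) matrix `T_n` with diagonal `a_0, …, a_n` and
off-diagonal `b_1, …, b_n`, built from `2n + 1` moments. -/
noncomputable def jacobiMatrix (n : ℕ) (x : Fin (2 * n + 1) → ℝ) :
    Matrix (Fin (n + 1)) (Fin (n + 1)) ℝ :=
  Matrix.of fun i j =>
    if i = j then recA x i
    else if j.val = i.val + 1 then recB x j
    else if i.val = j.val + 1 then recB x i
    else 0

theorem jacobiMatrix_isHermitian (n : ℕ) (x : Fin (2 * n + 1) → ℝ) :
    (jacobiMatrix n x).IsHermitian := by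
  ext i j
  simp only [Matrix.conjTranspose_apply, jacobiMatrix, Matrix.of_apply, star_trivial]
  rcases lt_trichotomy i j with hij | rfl | hij
  · have h1 : j ≠ i := hij.ne'
    have h2 : i ≠ j := hij.ne
    have h3 : ¬ (i.val = j.val + 1) := by have := Fin.lt_def.mp hij; omega
    simp only [h1, h2, h3, if_false]
  · rfl
  · have h1 : i ≠ j := hij.ne'
    have h2 : j ≠ i := hij.ne
    have h3 : ¬ (j.val = i.val + 1) := by have := Fin.lt_def.mp hij; omega
    simp only [h1, h2, h3, if_false]

/-- The recursion does not terminate before step `n`. -/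
def RecursionRegular (n : ℕ) (x : Fin (2 * n + 1) → ℝ) : Prop :=
  ∀ k, 1 ≤ k → k ≤ n → 0 < recB x k

/-- The nonlinear map `Θ(x) = O(T_n)_{00} = ∑_s O(λ_s) [ψ_s]_0²` on real moment vectors `x` of length
`N = 2n + 1`, where `(λ_s, ψ_s)` are normalised eigenpairs of `T_n`. -/
noncomputable def bopTheta (O : ℝ → ℝ) (n : ℕ) (x : Fin (2 * n + 1) → ℝ) : ℝ :=
  ∑ s, O ((jacobiMatrix_isHermitian n x).eigenvalues s)
    * ((jacobiMatrix_isHermitian n x).eigenvectorBasis s 0) ^ 2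

/-! ## Bands, gaps and defect states -/

/-- Two nonempty compact intervals `I₋ = [minLower, maxLower]` and `I₊ = [minUpper, maxUpper]` and a
chemical potential `μ` with `max I₋ ≤ μ ≤ min I₊`. -/
structure Bands where
  minLower : ℝ
  maxLower : ℝ
  minUpper : ℝ
  maxUpper : ℝ
  μ : ℝ
  lower_le : minLower ≤ maxLower
  lower_le_μ : maxLower ≤ μ
  μ_le_upper : μ ≤ minUpper
  upper_le : minUpper ≤ maxUpper

/-- The gap `g = min I₊ - max I₋`. -/
def Bands.gap (B : Bands) : ℝ := B.minUpper - B.maxLower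

/-- The defect gap
`g^def = min (I₊ ∪ {λ_j : λ_j ≥ μ}) - max (I₋ ∪ {λ_j : λ_j ≤ μ})`. -/
noncomputable def Bands.defectGap (B : Bands) (lam : Finset ℝ) : ℝ :=
  (insert B.minUpper (lam.filter fun x => B.μ ≤ x)).min' (Finset.insert_nonempty _ _)
    - (insert B.maxLower (lam.filter fun x => x ≤ B.μ)).max' (Finset.insert_nonempty _ _)

/-- `I₋ ∪ {λ_j} ∪ I₊`. -/
def Bands.withDefects (B : Bands) (lam : Finset ℝ) : Set ℝ :=
  Set.Icc B.minLower B.maxLower ∪ (lam : Set ℝ) ∪ Set.Icc B.minUpper B.maxUpper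

/-- The chemical potential lies in the interior of the gap: `max I₋ < μ < min I₊`.  In particular
the gap is positive. -/
def Bands.Insulating (B : Bands) : Prop := B.maxLower < B.μ ∧ B.μ < B.minUpper

/-- The gap lies symmetrically about the chemical potential. -/
def Bands.Symmetric (B : Bands) : Prop := B.μ - B.maxLower = B.minUpper - B.μ

/-!
The moments `m_j` are those of a positive functional `φ` on polynomials with `φ(1) = 1`, the local
density of states at `ℓ` normalised to mass one (`ldosFunctional`).  The map `Θ` integrates the
observable `O` with the Gauss quadrature rule of this functional, whose nodes are the eigenvalues of the
Jacobi matrix `T_n` and which is exact on polynomials of degree at most `2n + 1`, whether or not the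
recursion terminates early (`bopTheta_eval_eq`).

**Error estimate.**  If polynomials `P`, `W` of degree at most `2n + 1` satisfy `|O - P| ≤ W` on the
whole real line, then integrating this bound against the quadrature rule gives
`|Θ - φ(P)| ≤ φ(W)`, and therefore the error is controlled by the size of `W` on the spectrum alone
(`localObservable_error`).  In particular, the nodes of the quadrature rule that lie in the gap do not
have to be located.

Such a pair is constructed as follows.  Put `ξ = x - μ`.  Up to an affine function, the Fermi–Dirac
function is a multiple of `tanh (β ξ / 2)` and the grand potential one of `log (cosh (β ξ / 2))`, and
these are `ξ` and `ξ²` times a positive combination of the functions `1 / (ξ² + τ')`, where `τ'` is at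
least the square `τ` of the lowest Matsubara frequency `π / β`; for `β = ∞` they become `sign ξ` and
`|ξ|`, with `τ = 0` (`observable_decomposition`).  If `a ≥ 0` is a polynomial with
`0 < a(-τ) ≤ a(-τ')` for all `τ' ≥ τ`, then Hermite interpolation of `1 / (y + τ')` at the zeros of `a`
has relative error `a(y) / a(-τ') ≤ a(y) / a(-τ)` on the positive half-line.  This bound is linear in the
function and survives pointwise limits, because the degree of the interpolating polynomials is bounded
(`HasRelApprox`).  The result is a polynomial approximation with
`W = (1 + ξ²) a(ξ²) / a(-τ)`.  For `a` one takes the square of the product of a Chebyshev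
polynomial, for an interval that contains all `ξ²` with `x` in the bands, and the linear factors
`y - (λ_j - μ)²` (`dampingPoly`).  The defects are zeros of `W` and influence only the constant, and,
as long as it is small, the rate of decay is proportional to `dist + β⁻¹`, where `dist` is the distance
of `μ` to the bands (`decayRate_pos`, `decayRate_comparable`).  The rates `γ_N` can be taken independent of `N`.

**Analyticity.**  Near moments `x` for which the recursion is regular, the recursion for complex moments
depends analytically on them (`polyAnalyticAt_recursion`).  The nodes are the zeros of the last residual
polynomial, which are simple by the Christoffel–Darboux identity, and hence analytic by the implicit
function theorem; the weights are the values of the Christoffel function `1 / ∑ p_k²` at the nodes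
(`exists_local_extension`).  The local extensions obtained in this way agree where they overlap, by the
identity theorem on complex lines through real points (`exists_analytic_extension`).
-/

/-! ### The Lanczos recursion and the eigenvectors of the Jacobi matrix -/

section GaussQuadrature

open Polynomial

/-- The polynomial `p_{k-1}` that enters the three-term recursion at step `k`. -/
noncomputable def prevPoly {N : ℕ} (x : Fin N → ℝ) (k : ℕ) : ℝ[X] := (recursionState x k).2.1

/-- The residual `(X - a_k) p_k - b_k p_{k-1}`, i.e. `b_{k+1} p_{k+1}` as long as the recursion has
not terminated. -/
noncomputable def residualPoly {N : ℕ} (x : Fin N → ℝ) (k : ℕ) : ℝ[X] :=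
  (X - C (recA x k)) * orthoPoly x k - C (recB x k) * prevPoly x k

section Recursion

variable {N : ℕ} (x : Fin N → ℝ)

@[simp] theorem orthoPoly_zero : orthoPoly x 0 = 1 := rfl

@[simp] theorem recB_zero : recB x 0 = 0 := rfl

@[simp] theorem prevPoly_zero : prevPoly x 0 = 0 := rfl

@[simp] theorem prevPoly_succ (k : ℕ) : prevPoly x (k + 1) = orthoPoly x k := rfl

theorem recB_succ (k : ℕ) : recB x (k + 1) = √(momentIntegral x (residualPoly x k ^ 2)) := rfl

theorem orthoPoly_succ (k : ℕ) :
    orthoPoly x (k + 1) = C (recB x (k + 1))⁻¹ * residualPoly x k := rfl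

theorem recB_mul_orthoPoly_succ {k : ℕ} (h : 0 < recB x (k + 1)) :
    C (recB x (k + 1)) * orthoPoly x (k + 1) = residualPoly x k := by
  rw [orthoPoly_succ, ← mul_assoc, ← C_mul, mul_inv_cancel₀ h.ne', C_1, one_mul]

theorem natDegree_orthoPoly_prevPoly_le (k : ℕ) :
    (orthoPoly x k).natDegree ≤ k ∧ (prevPoly x k).natDegree ≤ k := by
  induction k with
  | zero => simp
  | succ k ih =>
    refine ⟨?_, ih.1.trans (Nat.le_succ k)⟩
    rw [orthoPoly_succ]
    refine (natDegree_C_mul_le _ _).trans ((natDegree_sub_le _ _).trans (max_le ?_ ?_))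
    · refine natDegree_mul_le.trans ?_
      rw [natDegree_X_sub_C]
      omega
    · exact (natDegree_C_mul_le _ _).trans (ih.2.trans (Nat.le_succ k))

theorem natDegree_orthoPoly_le (k : ℕ) : (orthoPoly x k).natDegree ≤ k :=
  (natDegree_orthoPoly_prevPoly_le x k).1

theorem natDegree_residualPoly_le (k : ℕ) : (residualPoly x k).natDegree ≤ k + 1 := by
  refine (natDegree_sub_le _ _).trans (max_le ?_ ?_)
  · refine natDegree_mul_le.trans ?_
    rw [natDegree_X_sub_C]
    have := natDegree_orthoPoly_le x k
    omega
  · exact (natDegree_C_mul_le _ _).trans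
      ((natDegree_orthoPoly_prevPoly_le x k).2.trans (Nat.le_succ k))

theorem coeff_residualPoly_succ (k : ℕ) :
    (residualPoly x k).coeff (k + 1) = (orthoPoly x k).coeff k := by
  have h1 : (prevPoly x k).natDegree < k + 1 :=
    Nat.lt_succ_of_le (natDegree_orthoPoly_prevPoly_le x k).2
  have h2 : (orthoPoly x k).natDegree < k + 1 := Nat.lt_succ_of_le (natDegree_orthoPoly_le x k)
  rw [residualPoly, sub_mul, coeff_sub, coeff_sub, coeff_X_mul, coeff_C_mul, coeff_C_mul,
    coeff_eq_zero_of_natDegree_lt h1, coeff_eq_zero_of_natDegree_lt h2]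
  ring

theorem coeff_orthoPoly_pos {m : ℕ} (h : ∀ k, 1 ≤ k → k ≤ m → 0 < recB x k) :
    0 < (orthoPoly x m).coeff m := by
  induction m with
  | zero => simp
  | succ m ih =>
    rw [orthoPoly_succ, coeff_C_mul, coeff_residualPoly_succ]
    exact mul_pos (inv_pos.2 (h _ (by omega) le_rfl)) (ih fun k h1 h2 => h k h1 (by omega))

end Recursion

/-- A vector indexed by `Fin (n + 1)`, continued by zero. -/
def zeroExtend {n : ℕ} (v : Fin (n + 1) → ℝ) (k : ℕ) : ℝ :=
  if h : k < n + 1 then v ⟨k, h⟩ else 0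

@[simp] theorem zeroExtend_val {n : ℕ} (v : Fin (n + 1) → ℝ) (i : Fin (n + 1)) :
    zeroExtend v i = v i :=
  dif_pos i.2

theorem jacobiMatrix_mulVec {n : ℕ} (x : Fin (2 * n + 1) → ℝ) (v : Fin (n + 1) → ℝ)
    (i : Fin (n + 1)) :
    (jacobiMatrix n x).mulVec v i = recA x i * zeroExtend v i
      + recB x i * zeroExtend v (i - 1) + recB x (i + 1) * zeroExtend v (i + 1) := by
  have h1 : (jacobiMatrix n x).mulVec v i = ∑ j : Fin (n + 1),
      ((if (j : ℕ) = i then recA x i * zeroExtend v i else 0)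
        + (if (j : ℕ) = i - 1 then recB x i * zeroExtend v (i - 1) else 0)
        + (if (j : ℕ) = i + 1 then recB x (i + 1) * zeroExtend v (i + 1) else 0)) := by
    rw [Matrix.mulVec, dotProduct]
    refine Finset.sum_congr rfl fun j _ => ?_
    rw [jacobiMatrix, Matrix.of_apply]
    obtain ⟨i, hi⟩ := i
    obtain ⟨j, hj⟩ := j
    simp only [Fin.mk.injEq]
    by_cases h : i = j
    · subst h
      rcases Nat.eq_zero_or_pos i with rfl | h0
      · simp [zeroExtend]
      · have : ¬ i = i - 1 := by omega
        simp [this, zeroExtend, hi]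
    · by_cases h' : j = i + 1
      · subst h'
        have h2 : ¬ i + 1 = i - 1 := by omega
        simp [h2, zeroExtend, hj]
      · by_cases h2 : i = j + 1
        · subst h2
          simp [zeroExtend, hj, show ¬ j = j + 1 + 1 by omega]
        · simp only [h, h', h2, if_false, Ne.symm h]
          rcases Nat.eq_zero_or_pos i with rfl | h0
          · simp
          · simp [show ¬ j = i - 1 by omega]
  rw [h1, Fin.sum_univ_eq_sum_range (fun j : ℕ =>
    ((if (j : ℕ) = i then recA x i * zeroExtend v i else 0)
        + (if (j : ℕ) = i - 1 then recB x i * zeroExtend v (i - 1) else 0)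
        + (if (j : ℕ) = i + 1 then recB x (i + 1) * zeroExtend v (i + 1) else 0))) (n + 1)]
  rw [Finset.sum_add_distrib, Finset.sum_add_distrib, Finset.sum_ite_eq', Finset.sum_ite_eq',
    Finset.sum_ite_eq']
  have hi := i.2
  rw [if_pos (Finset.mem_range.2 hi), if_pos (Finset.mem_range.2 (by omega))]
  by_cases h : (i : ℕ) + 1 < n + 1
  · rw [if_pos (Finset.mem_range.2 h)]
  · rw [if_neg (by simpa using h), zeroExtend, zeroExtend, zeroExtend, dif_neg h, mul_zero]

section Eigenvector

variable {n : ℕ} {x : Fin (2 * n + 1) → ℝ} {v : Fin (n + 1) → ℝ} {θ : ℝ}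

/-- Row `k` of the eigenvalue equation, given that the first `k + 1` components of the eigenvector are
proportional to the values of the orthonormal polynomials.  The hypothesis on component `k - 1` is
multiplied by `b_k`, so that it is void for `k = 0`. -/
theorem eigenvector_step (hv : (jacobiMatrix n x).mulVec v = θ • v) {k : ℕ} (hk : k ≤ n)
    (h1 : zeroExtend v k = zeroExtend v 0 * (orthoPoly x k).eval θ)
    (h2 : recB x k * zeroExtend v (k - 1) = recB x k * (zeroExtend v 0 * (prevPoly x k).eval θ)) :
    zeroExtend v 0 * (residualPoly x k).eval θ = recB x (k + 1) * zeroExtend v (k + 1) := by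
  have h3 := jacobiMatrix_mulVec x v ⟨k, by omega⟩
  rw [hv, Pi.smul_apply, smul_eq_mul, ← zeroExtend_val v] at h3
  simp only at h3
  rw [residualPoly, eval_sub, eval_mul, eval_mul, eval_sub, eval_X, eval_C, eval_C]
  linear_combination (-(θ - recA x k)) * h1 + h2 + h3

/-- The components of an eigenvector of `T_n` are the values of the orthonormal polynomials at the
eigenvalue, up to a common factor, as long as the recursion has not terminated. -/
theorem eigenvector_eq_orthoPoly (hv : (jacobiMatrix n x).mulVec v = θ • v) {m : ℕ} (hm : m ≤ n)
    (hreg : ∀ k, 1 ≤ k → k ≤ m → 0 < recB x k) :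
    ∀ k ≤ m, zeroExtend v k = zeroExtend v 0 * (orthoPoly x k).eval θ ∧
      recB x k * zeroExtend v (k - 1) =
        recB x k * (zeroExtend v 0 * (prevPoly x k).eval θ) := by
  intro k
  induction k with
  | zero => simp
  | succ k ih =>
    intro hk
    obtain ⟨h1, h2⟩ := ih (by omega)
    have h3 := eigenvector_step hv (by omega) h1 h2
    have hb := hreg (k + 1) (by omega) hk
    refine ⟨?_, by simp [h1]⟩
    rw [orthoPoly_succ, eval_mul, eval_C]
    field_simp
    linear_combination -h3

/-- Row `m` of the eigenvalue equation.  The right-hand side vanishes for `m = n`, where `T_n` is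
truncated, and also if the recursion terminates at step `m + 1`. -/
theorem eigenvector_residualPoly (hv : (jacobiMatrix n x).mulVec v = θ • v) {m : ℕ} (hm : m ≤ n)
    (hreg : ∀ k, 1 ≤ k → k ≤ m → 0 < recB x k) :
    zeroExtend v 0 * (residualPoly x m).eval θ = recB x (m + 1) * zeroExtend v (m + 1) :=
  eigenvector_step hv hm (eigenvector_eq_orthoPoly hv hm hreg m le_rfl).1
    (eigenvector_eq_orthoPoly hv hm hreg m le_rfl).2

end Eigenvector

/-! ### Exactness of the quadrature rule -/

/-- A linear functional that vanishes on polynomials `p_0, …, p_m` with `deg p_i = i` vanishes on all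
polynomials of degree at most `m`. -/
theorem linearMap_eq_zero_of_natDegree_le (φ : ℝ[X] →ₗ[ℝ] ℝ) (p : ℕ → ℝ[X]) (m : ℕ)
    (hdeg : ∀ i ≤ m, (p i).natDegree ≤ i) (hlead : ∀ i ≤ m, (p i).coeff i ≠ 0)
    (hφ : ∀ i ≤ m, φ (p i) = 0) : ∀ R : ℝ[X], R.natDegree ≤ m → φ R = 0 := by
  induction m with
  | zero =>
    intro R hR
    have h1 : R = C (R.coeff 0 / (p 0).coeff 0) * p 0 := by
      rw [eq_C_of_natDegree_le_zero hR, eq_C_of_natDegree_le_zero (hdeg 0 le_rfl), ← C_mul]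
      have := hlead 0 le_rfl
      simp [div_mul_cancel₀ _ this]
    rw [h1, ← smul_eq_C_mul, map_smul, hφ 0 le_rfl, smul_zero]
  | succ m ih =>
    intro R hR
    have hl := hlead (m + 1) le_rfl
    set c := R.coeff (m + 1) / (p (m + 1)).coeff (m + 1)
    have h1 : (R - C c * p (m + 1)).natDegree ≤ m := by
      rw [natDegree_le_iff_coeff_eq_zero]
      intro N hN
      rcases Nat.lt_or_ge (m + 1) N with h | h
      · rw [coeff_sub, coeff_C_mul, coeff_eq_zero_of_natDegree_lt (hR.trans_lt h),
          coeff_eq_zero_of_natDegree_lt ((hdeg (m + 1) le_rfl).trans_lt h)]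
        simp
      · obtain rfl : N = m + 1 := by omega
        rw [coeff_sub, coeff_C_mul, div_mul_cancel₀ _ hl, sub_self]
    have h2 := ih (fun i hi => hdeg i (by omega)) (fun i hi => hlead i (by omega))
      (fun i hi => hφ i (by omega)) _ h1
    rw [map_sub, ← smul_eq_C_mul, map_smul, hφ (m + 1) le_rfl, smul_zero, sub_zero] at h2
    exact h2

/-- The moments of a linear functional that are seen by the recursion. -/
theorem momentIntegral_eq {N : ℕ} (φ : ℝ[X] →ₗ[ℝ] ℝ) (hφ1 : φ 1 = 1) (x : Fin N → ℝ)
    (hx : ∀ j : Fin N, x j = φ (X ^ (j.val + 1))) {R : ℝ[X]} (hR : R.natDegree ≤ N) :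
    momentIntegral x R = φ R := by
  conv_rhs => rw [R.as_sum_range' (N + 1) (Nat.lt_succ_of_le hR)]
  rw [momentIntegral, R.sum_over_range' (by simp) (N + 1) (Nat.lt_succ_of_le hR), map_sum]
  refine Finset.sum_congr rfl fun j hj => ?_
  rw [← C_mul_X_pow_eq_monomial, ← smul_eq_C_mul, map_smul, smul_eq_mul]
  rcases j with _ | j
  · simp [momentSeq, hφ1]
  · have : j < N := by simpa using hj
    simp [momentSeq, this, hx]

section Orthogonality

variable {n : ℕ} {x : Fin (2 * n + 1) → ℝ} {φ : ℝ[X] →ₗ[ℝ] ℝ}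

theorem recA_eq (hφ1 : φ 1 = 1) (hx : ∀ j : Fin (2 * n + 1), x j = φ (X ^ (j.val + 1)))
    {k : ℕ} (hk : k ≤ n) : recA x k = φ (X * orthoPoly x k ^ 2) := by
  refine momentIntegral_eq φ hφ1 x hx (natDegree_mul_le.trans ?_)
  have h1 := natDegree_orthoPoly_le x k
  have h2 := natDegree_pow_le (p := orthoPoly x k) (n := 2)
  have h3 := natDegree_X_le (R := ℝ)
  omega

theorem recB_succ_sq (hφ1 : φ 1 = 1) (hpos : ∀ R : ℝ[X], 0 ≤ φ (R ^ 2))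
    (hx : ∀ j : Fin (2 * n + 1), x j = φ (X ^ (j.val + 1)))
    {k : ℕ} (hk : k < n) : recB x (k + 1) ^ 2 = φ (residualPoly x k ^ 2) := by
  have h0 : momentIntegral x (residualPoly x k ^ 2) = φ (residualPoly x k ^ 2) := by
    refine momentIntegral_eq φ hφ1 x hx (natDegree_pow_le.trans ?_)
    have h1 := natDegree_residualPoly_le x k
    omega
  rw [recB_succ, h0, Real.sq_sqrt (hpos _)]

/-- Orthonormality of the polynomials produced by the recursion for the moments of a positive
functional, together with the orthogonality of the residual. -/
theorem orthoPoly_orthonormal (hφ1 : φ 1 = 1) (hpos : ∀ R : ℝ[X], 0 ≤ φ (R ^ 2))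
    (hx : ∀ j : Fin (2 * n + 1), x j = φ (X ^ (j.val + 1))) {m : ℕ} (hm : m ≤ n)
    (hreg : ∀ k, 1 ≤ k → k ≤ m → 0 < recB x k) :
    (∀ i ≤ m, ∀ j < i, φ (orthoPoly x i * orthoPoly x j) = 0) ∧
    (∀ i ≤ m, φ (orthoPoly x i * orthoPoly x i) = 1) ∧
    (∀ i ≤ m, φ (residualPoly x m * orthoPoly x i) = 0) := by
  induction m with
  | zero =>
    refine ⟨by omega, ?_, ?_⟩
    · intro i hi
      obtain rfl : i = 0 := by omega
      simpa using hφ1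
    · intro i hi
      obtain rfl : i = 0 := by omega
      have h1 := recA_eq hφ1 hx hm
      simp only [orthoPoly_zero, one_pow, mul_one] at h1
      have h2 : residualPoly x 0 * orthoPoly x 0 = X - recA x 0 • 1 := by
        simp [residualPoly, smul_eq_C_mul]
      rw [h2, map_sub, map_smul, hφ1, h1]
      simp
  | succ m ih =>
    obtain ⟨h1, h2, h3⟩ := ih (by omega) fun k hk1 hk2 => hreg k hk1 (by omega)
    have hb := hreg (m + 1) (by omega) le_rfl
    have hp : orthoPoly x (m + 1) = (recB x (m + 1))⁻¹ • residualPoly x m := by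
      rw [orthoPoly_succ, smul_eq_C_mul]
    have hq : recB x (m + 1) • orthoPoly x (m + 1) = residualPoly x m := by
      rw [smul_eq_C_mul, recB_mul_orthoPoly_succ x hb]
    -- orthogonality of the new polynomial
    have h4 : ∀ j ≤ m, φ (orthoPoly x (m + 1) * orthoPoly x j) = 0 := by
      intro j hj
      rw [hp, smul_mul_assoc, map_smul, h3 j hj, smul_zero]
    have h5 : φ (orthoPoly x (m + 1) * orthoPoly x (m + 1)) = 1 := by
      have := recB_succ_sq hφ1 hpos hx (k := m) (by omega)
      rw [hp, smul_mul_smul_comm, map_smul, ← sq (residualPoly x m), ← this, smul_eq_mul]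
      field_simp
    have h1' : ∀ i ≤ m + 1, ∀ j < i, φ (orthoPoly x i * orthoPoly x j) = 0 := by
      intro i hi j hj
      rcases Nat.lt_or_ge i (m + 1) with h | h
      · exact h1 i (by omega) j hj
      · obtain rfl : i = m + 1 := by omega
        exact h4 j (by omega)
    have h2' : ∀ i ≤ m + 1, φ (orthoPoly x i * orthoPoly x i) = 1 := by
      intro i hi
      rcases Nat.lt_or_ge i (m + 1) with h | h
      · exact h2 i (by omega)
      · obtain rfl : i = m + 1 := by omega
        exact h5
    refine ⟨h1', h2', ?_⟩
    intro i hi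
    have hexp : residualPoly x (m + 1) * orthoPoly x i =
        X * orthoPoly x i * orthoPoly x (m + 1)
          - recA x (m + 1) • (orthoPoly x (m + 1) * orthoPoly x i)
          - recB x (m + 1) • (orthoPoly x m * orthoPoly x i) := by
      simp only [residualPoly, prevPoly_succ, smul_eq_C_mul]
      ring
    rw [hexp, map_sub, map_sub, map_smul, map_smul, smul_eq_mul, smul_eq_mul]
    rcases Nat.lt_or_ge i (m + 1) with h | h
    · -- expand `X p_i` by the recursion at step `i`
      have hXp : X * orthoPoly x i * orthoPoly x (m + 1) =
          recB x (i + 1) • (orthoPoly x (m + 1) * orthoPoly x (i + 1))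
          + recA x i • (orthoPoly x (m + 1) * orthoPoly x i)
          + recB x i • (orthoPoly x (m + 1) * prevPoly x i) := by
        have := recB_mul_orthoPoly_succ x (hreg (i + 1) (by omega) (by omega))
        simp only [smul_eq_C_mul]
        rw [residualPoly] at this
        linear_combination (-orthoPoly x (m + 1)) * this
      have hprev : φ (orthoPoly x (m + 1) * prevPoly x i) = 0 := by
        rcases i with _ | i
        · simp
        · exact h4 i (by omega)
      rw [hXp, map_add, map_add, map_smul, map_smul, map_smul, hprev, h4 i (by omega)]
      rcases Nat.lt_or_ge i m with h' | h'
      · rw [h4 (i + 1) (by omega), mul_comm (orthoPoly x m),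
          mul_comm (orthoPoly x i) (orthoPoly x m), h1 m le_rfl i h']
        simp
      · obtain rfl : i = m := by omega
        rw [h5, h2 i le_rfl]
        simp
    · obtain rfl : i = m + 1 := by omega
      have := recA_eq hφ1 hx hm
      rw [mul_assoc, ← sq, ← this, sq, h5, mul_comm (orthoPoly x m), h4 m le_rfl]
      simp

end Orthogonality

/-- A null polynomial of a positive functional is orthogonal to all polynomials (Cauchy–Schwarz). -/
theorem map_mul_eq_zero_of_map_sq_eq_zero {φ : ℝ[X] →ₗ[ℝ] ℝ} (hpos : ∀ R : ℝ[X], 0 ≤ φ (R ^ 2))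
    {q : ℝ[X]} (hq : φ (q ^ 2) = 0) (S : ℝ[X]) : φ (q * S) = 0 := by
  have h : ∀ t : ℝ, 0 ≤ φ (S ^ 2) + 2 * t * φ (q * S) := by
    intro t
    have h1 := hpos (S + t • q)
    have h2 : (S + t • q) ^ 2 = S ^ 2 + (2 * t) • (q * S) + (t ^ 2) • q ^ 2 := by
      simp only [smul_eq_C_mul, C_mul, C_pow, C_ofNat]
      ring
    rwa [h2, map_add, map_add, map_smul, map_smul, hq, smul_zero, add_zero, smul_eq_mul] at h1
  by_contra h0
  have h1 := h (-(φ (S ^ 2) + 1) / (2 * φ (q * S)))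
  have h2 : 2 * (-(φ (S ^ 2) + 1) / (2 * φ (q * S))) * φ (q * S) = -(φ (S ^ 2) + 1) := by
    field_simp
  linarith

/-- The quadrature rule `R ↦ R(T_n)_{00}` as a linear functional. -/
noncomputable def jacobiQuadrature (n : ℕ) (x : Fin (2 * n + 1) → ℝ) : ℝ[X] →ₗ[ℝ] ℝ where
  toFun R := bopTheta (fun y => R.eval y) n x
  map_add' R S := by simp [bopTheta, add_mul, Finset.sum_add_distrib]
  map_smul' c R := by simp [bopTheta, mul_assoc, Finset.mul_sum]

/-- The quadrature rule with the eigenvalues of `T_n` as nodes is exact up to degree `2n + 1`, also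
if the recursion terminates early: all nodes with nonzero weight are zeros of the residual `q` of the
last step, and `q` is orthogonal to everything that has to be considered, so that dividing by `q`
reduces the claim to the span of the orthonormal polynomials. -/
theorem bopTheta_eval_eq {n : ℕ} {x : Fin (2 * n + 1) → ℝ} {φ : ℝ[X] →ₗ[ℝ] ℝ} (hφ1 : φ 1 = 1)
    (hpos : ∀ R : ℝ[X], 0 ≤ φ (R ^ 2)) (hx : ∀ j : Fin (2 * n + 1), x j = φ (X ^ (j.val + 1)))
    {R : ℝ[X]} (hR : R.natDegree ≤ 2 * n + 1) : bopTheta (fun y => R.eval y) n x = φ R := by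
  -- `m` is the last step that the recursion reaches: either `n`, or the step where it terminates
  obtain ⟨m, hm, hreg, hlast⟩ : ∃ m ≤ n, (∀ k, 1 ≤ k → k ≤ m → 0 < recB x k) ∧
      (m = n ∨ m < n ∧ recB x (m + 1) = 0) := by
    by_cases h : ∀ k, 1 ≤ k → k ≤ n → 0 < recB x k
    · exact ⟨n, le_rfl, h, Or.inl rfl⟩
    · have hex : ∃ k, 1 ≤ k ∧ k ≤ n ∧ ¬ 0 < recB x k := by
        push Not at h
        obtain ⟨k, h1, h2, h3⟩ := h
        exact ⟨k, h1, h2, h3.not_gt⟩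
      classical
      obtain ⟨h1, h2, h3⟩ := Nat.find_spec hex
      obtain ⟨m, hm⟩ : ∃ m, Nat.find hex = m + 1 := ⟨Nat.find hex - 1, by omega⟩
      rw [hm] at h1 h2 h3
      refine ⟨m, by omega, fun k hk1 hk2 => ?_, Or.inr ⟨by omega, ?_⟩⟩
      · by_contra h4
        exact Nat.find_min hex (m := k) (by omega) ⟨hk1, by omega, h4⟩
      · exact le_antisymm (not_lt.1 h3) (Real.sqrt_nonneg _)
  obtain ⟨ho1, ho2, ho3⟩ := orthoPoly_orthonormal hφ1 hpos hx hm hreg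
  set T := jacobiMatrix_isHermitian n x
  have hmv : ∀ s, (jacobiMatrix n x).mulVec (T.eigenvectorBasis s) =
      T.eigenvalues s • (T.eigenvectorBasis s : Fin (n + 1) → ℝ) := T.mulVec_eigenvectorBasis
  have hlead : ∀ i ≤ m, (orthoPoly x i).coeff i ≠ 0 := fun i hi =>
    (coeff_orthoPoly_pos x fun k h1 h2 => hreg k h1 (h2.trans hi)).ne'
  set q := residualPoly x m with hq
  have hqdeg : q.natDegree = m + 1 := by
    refine le_antisymm (natDegree_residualPoly_le x m) (le_natDegree_of_ne_zero ?_)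
    rw [hq, coeff_residualPoly_succ]
    exact hlead m le_rfl
  -- both functionals annihilate the multiples of the residual (those of sufficiently low degree, in
  -- the case of `φ`): for the quadrature rule because it vanishes at all nodes of nonzero weight
  have hΛ : ∀ S, jacobiQuadrature n x (q * S) = 0 := by
    intro S
    change ∑ s, (q * S).eval (T.eigenvalues s) * T.eigenvectorBasis s 0 ^ 2 = 0
    refine Finset.sum_eq_zero fun s _ => ?_
    have h1 := eigenvector_residualPoly (hmv s) hm hreg
    have h2 : recB x (m + 1) * zeroExtend (T.eigenvectorBasis s) (m + 1) = 0 := by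
      rcases hlast with rfl | ⟨-, h⟩
      · simp [zeroExtend]
      · rw [h, zero_mul]
    rw [h2] at h1
    have h3 : zeroExtend (T.eigenvectorBasis s) 0 = T.eigenvectorBasis s 0 := rfl
    rw [h3] at h1
    rw [eval_mul, sq]
    linear_combination (S.eval (T.eigenvalues s) * T.eigenvectorBasis s 0) * h1
  -- for `φ` by orthogonality to `p_0, …, p_n`, or because `q` is a null polynomial
  have hφ : ∀ S, S.natDegree ≤ 2 * n - m → φ (q * S) = 0 := by
    rcases hlast with rfl | ⟨h1, h2⟩
    · intro S hS
      exact linearMap_eq_zero_of_natDegree_le (φ.comp (LinearMap.mulLeft ℝ q)) (orthoPoly x) m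
        (fun i _ => natDegree_orthoPoly_le x i) hlead ho3 S (by omega)
    · intro S _
      refine map_mul_eq_zero_of_map_sq_eq_zero hpos ?_ S
      rw [hq, ← recB_succ_sq hφ1 hpos hx h1, h2]
      simp
  -- both functionals agree on the orthonormal polynomials: the value of the quadrature rule on `p_i`
  -- is an entry of the product of the orthogonal matrix of eigenvectors with its transpose
  have hlow : ∀ S : ℝ[X], S.natDegree ≤ m → (jacobiQuadrature n x - φ) S = 0 := by
    refine linearMap_eq_zero_of_natDegree_le _ (orthoPoly x) m
      (fun i _ => natDegree_orthoPoly_le x i) hlead fun i hi => ?_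
    rw [LinearMap.sub_apply, sub_eq_zero]
    have h1 : jacobiQuadrature n x (orthoPoly x i) =
        ∑ s, T.eigenvectorBasis s ⟨i, by omega⟩ * T.eigenvectorBasis s 0 := by
      change ∑ s, (orthoPoly x i).eval (T.eigenvalues s) * T.eigenvectorBasis s 0 ^ 2 = _
      refine Finset.sum_congr rfl fun s _ => ?_
      have h2 := (eigenvector_eq_orthoPoly (hmv s) hm hreg i hi).1
      have h3 : zeroExtend (T.eigenvectorBasis s) 0 = T.eigenvectorBasis s 0 := rfl
      have h4 : zeroExtend (T.eigenvectorBasis s) i = T.eigenvectorBasis s ⟨i, by omega⟩ :=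
        dif_pos (by omega)
      rw [h3, h4] at h2
      rw [h2]
      ring
    have h2 : ∑ s, T.eigenvectorBasis s ⟨i, by omega⟩ * T.eigenvectorBasis s 0 =
        if i = 0 then 1 else 0 := by
      have h3 := T.eigenvectorBasis.sum_inner_mul_inner
        (EuclideanSpace.single (⟨i, by omega⟩ : Fin (n + 1)) (1 : ℝ))
        (EuclideanSpace.single (0 : Fin (n + 1)) (1 : ℝ))
      simp only [EuclideanSpace.inner_single_left, EuclideanSpace.inner_single_right, map_one,
        one_mul, starRingEnd_apply, star_trivial] at h3
      simpa [Fin.ext_iff, eq_comm] using h3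
    rw [h1, h2]
    rcases i with _ | i
    · simp [hφ1]
    · simpa using (ho1 (i + 1) hi 0 (by omega)).symm
  have hdiv : R = q * (R / q) + R % q := (EuclideanDomain.div_add_mod R q).symm
  have hq0 : q ≠ 0 := by
    rintro h
    rw [h] at hqdeg
    simp at hqdeg
  have h1 : (R % q).natDegree ≤ m := by
    have := natDegree_mod_lt R (q := q) (by omega)
    omega
  have h2 : (R / q).natDegree ≤ 2 * n - m := by
    rcases eq_or_ne (R / q) 0 with h0 | h0
    · simp [h0]
    · have hle : q.degree ≤ R.degree := not_lt.1 fun h => h0 ((Polynomial.div_eq_zero_iff hq0).2 h)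
      have h3 := degree_add_div hq0 hle
      have hR0 : R ≠ 0 := by
        rintro rfl
        simp at h0
      rw [degree_eq_natDegree hq0, degree_eq_natDegree h0, degree_eq_natDegree hR0] at h3
      norm_cast at h3
      omega
  have h3 : jacobiQuadrature n x R = φ R := by
    have h4 := hlow _ h1
    rw [LinearMap.sub_apply, sub_eq_zero] at h4
    rw [hdiv, map_add, map_add, hΛ, hφ _ h2, h4]
  exact h3

end GaussQuadrature

/-! ### Partial fractions of the hyperbolic tangent -/

section Tanh

theorem hasSum_coth {w : ℝ} (hw : 0 < w) :
    HasSum (fun n : ℕ => 2 * w / (w ^ 2 + (n + 1 : ℝ) ^ 2))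
      (Real.pi * (Real.cosh (Real.pi * w) / Real.sinh (Real.pi * w)) - 1 / w) := by
  have hmem : Complex.I * w ∈ Complex.integerComplement := by
    rintro ⟨n, hn⟩
    have := congrArg Complex.im hn
    simp at this
    exact hw.ne this
  have h1 := (summable_cotTerm hmem).hasSum
  have h2 : ∑' n, cotTerm (Complex.I * w) n = _ := (cot_series_rep' hmem).symm
  rw [h2] at h1
  have h3 := h1.mul_left Complex.I
  rw [← Complex.hasSum_ofReal]
  have hw' : (w : ℂ) ≠ 0 := by exact_mod_cast hw.ne'
  have hs : Real.sinh (Real.pi * w) ≠ 0 := by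
    have := Real.sinh_pos_iff.2 (mul_pos Real.pi_pos hw)
    exact this.ne'
  have hs' : (Real.sinh (Real.pi * w) : ℂ) ≠ 0 := by exact_mod_cast hs
  have e1 : Complex.I * (Real.pi * Complex.cot (Real.pi * (Complex.I * w)) - 1 / (Complex.I * w)) =
      ((Real.pi * (Real.cosh (Real.pi * w) / Real.sinh (Real.pi * w)) - 1 / w : ℝ) : ℂ) := by
    rw [Complex.cot, show (Real.pi : ℂ) * (Complex.I * w) = ((Real.pi * w : ℝ) : ℂ) * Complex.I by
      push_cast; ring, Complex.cos_mul_I, Complex.sin_mul_I, ← Complex.ofReal_cosh,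
      ← Complex.ofReal_sinh]
    push_cast at hs' ⊢
    have hI := Complex.I_ne_zero
    field_simp
  rw [e1] at h3
  refine h3.congr_fun fun n => ?_
  rw [cotTerm_identity hmem]
  have h4 : ((w ^ 2 + (n + 1 : ℝ) ^ 2 : ℝ) : ℂ) ≠ 0 := by
    have : w ^ 2 + (n + 1 : ℝ) ^ 2 ≠ 0 := by positivity
    exact_mod_cast this
  have h5 : (Complex.I * w + (n + 1)) * (Complex.I * w - (n + 1)) =
      -((w ^ 2 + (n + 1 : ℝ) ^ 2 : ℝ) : ℂ) := by
    push_cast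
    linear_combination (w : ℂ) ^ 2 * Complex.I_sq
  rw [h5, Complex.ofReal_div, div_neg, mul_neg, mul_neg, mul_one_div, ← mul_div_assoc,
    ← neg_div]
  congr 1
  push_cast
  linear_combination (2 * w : ℂ) * Complex.I_sq

/-- Obtained from the expansion of the hyperbolic cotangent and `tanh x = 2 coth 2x - coth x`, which
removes every other pole. -/
theorem hasSum_tanh {x : ℝ} (hx : 0 < x) :
    HasSum (fun k : ℕ => 2 * x / (x ^ 2 + (Real.pi * (k + 1 / 2 : ℝ)) ^ 2)) (Real.tanh x) := by
  have hpi := Real.pi_pos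
  set w := x / Real.pi with hw
  have hw0 : 0 < w := by positivity
  have hxw : x = Real.pi * w := by rw [hw]; field_simp
  have h1 := (hasSum_coth (w := 2 * w) (by positivity)).mul_left 2
  have h2 := hasSum_coth hw0
  set f : ℕ → ℝ := fun n => 2 * (2 * (2 * w) / ((2 * w) ^ 2 + (n + 1 : ℝ) ^ 2)) with hf
  have hodd : (fun k : ℕ => f (2 * k + 1)) = fun n : ℕ => 2 * w / (w ^ 2 + (n + 1 : ℝ) ^ 2) := by
    funext k
    simp only [hf]
    push_cast
    field_simp
    ring
  have heven : (fun k : ℕ => f (2 * k)) =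
      fun k : ℕ => Real.pi * (2 * x / (x ^ 2 + (Real.pi * (k + 1 / 2 : ℝ)) ^ 2)) := by
    funext k
    simp only [hf]
    rw [hxw]
    push_cast
    field_simp
  have hs : Summable fun k : ℕ => f (2 * k) :=
    h1.summable.comp_injective (i := fun k : ℕ => 2 * k) fun a b h => by simpa using h
  have h3 := hs.hasSum.even_add_odd (hodd ▸ h2)
  have h4 := h3.unique h1
  have h5 : ∑' k, f (2 * k) = Real.pi * Real.tanh x := by
    rw [eq_sub_of_add_eq h4, Real.tanh_eq_sinh_div_cosh,
      show Real.pi * (2 * w) = 2 * x by rw [hxw]; ring, ← hxw, Real.cosh_two_mul,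
      Real.sinh_two_mul]
    have hs0 := (Real.sinh_pos_iff.2 hx).ne'
    have hc0 := (Real.cosh_pos x).ne'
    field_simp
    ring
  have h6 := hs.hasSum
  rw [h5, heven] at h6
  exact (hasSum_mul_left_iff hpi.ne').1 h6

theorem monotone_tanh : Monotone Real.tanh := by
  intro x y hxy
  have h1 : 0 ≤ Real.sinh (y - x) := Real.sinh_nonneg_iff.2 (sub_nonneg.2 hxy)
  rw [Real.sinh_sub] at h1
  rw [Real.tanh_eq_sinh_div_cosh, Real.tanh_eq_sinh_div_cosh,
    div_le_div_iff₀ (Real.cosh_pos _) (Real.cosh_pos _)]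
  linarith

theorem hasDerivAt_log_cosh (x : ℝ) :
    HasDerivAt (fun y => Real.log (Real.cosh y)) (Real.tanh x) x := by
  rw [Real.tanh_eq_sinh_div_cosh]
  exact (Real.hasDerivAt_cosh x).log (Real.cosh_pos x).ne'

/-- Riemann sums of `tanh` converge to `log cosh`. -/
theorem tendsto_sum_tanh {x : ℝ} (hx : 0 < x) :
    Tendsto (fun m : ℕ => ∑ j ∈ Finset.range m,
      x / (m : ℝ) * Real.tanh ((j + 1 : ℝ) * (x / (m : ℝ)))) atTop
      (𝓝 (Real.log (Real.cosh x))) := by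
  have hd : Differentiable ℝ fun y => Real.log (Real.cosh y) := fun y =>
    (hasDerivAt_log_cosh y).differentiableAt
  have hderiv : deriv (fun y => Real.log (Real.cosh y)) = Real.tanh :=
    funext fun y => (hasDerivAt_log_cosh y).deriv
  -- upper and lower sums of the increasing function `tanh` differ by its last value times the step
  have hstep : ∀ t : ℝ, 0 < t → ∀ m : ℕ,
      Real.log (Real.cosh (m * t)) ≤ ∑ j ∈ Finset.range m, t * Real.tanh ((j + 1 : ℝ) * t) ∧
      ∑ j ∈ Finset.range m, t * Real.tanh ((j + 1 : ℝ) * t) ≤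
        Real.log (Real.cosh (m * t)) + t * Real.tanh (m * t) := by
    intro t ht m
    induction m with
    | zero => simp
    | succ m ih =>
      rw [Finset.sum_range_succ]
      have hle : (m : ℝ) * t ≤ (m + 1 : ℝ) * t := by nlinarith
      have hmem1 : (m : ℝ) * t ∈ Set.Icc ((m : ℝ) * t) ((m + 1 : ℝ) * t) := ⟨le_rfl, hle⟩
      have hmem2 : (m + 1 : ℝ) * t ∈ Set.Icc ((m : ℝ) * t) ((m + 1 : ℝ) * t) := ⟨hle, le_rfl⟩
      have h1 := (convex_Icc ((m : ℝ) * t) ((m + 1 : ℝ) * t)).image_sub_le_mul_sub_of_deriv_le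
        hd.continuous.continuousOn hd.differentiableOn (C := Real.tanh ((m + 1 : ℝ) * t))
        (fun y hy => by
          rw [hderiv]
          exact monotone_tanh (interior_subset hy).2) _ hmem1 _ hmem2 hle
      have h2 := (convex_Icc ((m : ℝ) * t) ((m + 1 : ℝ) * t)).mul_sub_le_image_sub_of_le_deriv
        hd.continuous.continuousOn hd.differentiableOn (C := Real.tanh ((m : ℝ) * t))
        (fun y hy => by
          rw [hderiv]
          exact monotone_tanh (interior_subset hy).1) _ hmem1 _ hmem2 hle
      push_cast
      constructor
      · linarith [ih.1]
      · linarith [ih.2]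
  have hlim : Tendsto (fun m : ℕ => Real.log (Real.cosh x) + x / (m : ℝ)) atTop
      (𝓝 (Real.log (Real.cosh x))) := by
    simpa using tendsto_const_nhds.add (tendsto_const_div_atTop_nhds_zero_nat x)
  refine tendsto_of_tendsto_of_tendsto_of_le_of_le' tendsto_const_nhds hlim ?_ ?_
  · filter_upwards [eventually_gt_atTop 0] with m hm
    have hm' : (0 : ℝ) < m := by exact_mod_cast hm
    have := (hstep (x / m) (by positivity) m).1
    rwa [mul_div_cancel₀ _ hm'.ne'] at this
  · filter_upwards [eventually_gt_atTop 0] with m hm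
    have hm' : (0 : ℝ) < m := by exact_mod_cast hm
    have := (hstep (x / m) (by positivity) m).2
    rw [mul_div_cancel₀ _ hm'.ne'] at this
    have h0 : 0 < x / m := by positivity
    nlinarith [Real.tanh_lt_one x]

theorem tendsto_tanh_atTop : Tendsto Real.tanh atTop (𝓝 1) := by
  have h : ∀ x : ℝ, 0 ≤ x → 1 - (1 + x)⁻¹ ≤ Real.tanh x := by
    intro x hx
    rw [Real.tanh_eq_sinh_div_cosh, le_div_iff₀ (Real.cosh_pos x)]
    have h1 : Real.cosh x - Real.sinh x = Real.exp (-x) := Real.cosh_sub_sinh x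
    have h2 : Real.exp (-x) ≤ (1 + x)⁻¹ := by
      rw [Real.exp_neg]
      gcongr
      linarith [Real.add_one_le_exp x]
    have h3 : (1 + x)⁻¹ * 1 ≤ (1 + x)⁻¹ * Real.cosh x := by
      gcongr
      exact Real.one_le_cosh x
    linarith
  have hlim : Tendsto (fun x : ℝ => 1 - (1 + x)⁻¹) atTop (𝓝 1) := by
    simpa using tendsto_const_nhds.sub (tendsto_inv_atTop_zero.comp
      (tendsto_atTop_add_const_left atTop (1 : ℝ) tendsto_id))
  refine tendsto_of_tendsto_of_tendsto_of_le_of_le' hlim tendsto_const_nhds ?_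
    (Eventually.of_forall fun x => (Real.tanh_lt_one x).le)
  filter_upwards [eventually_ge_atTop 0] with x hx using h x hx

end Tanh

/-! ### Polynomial approximation of Stieltjes functions -/

section Stieltjes

open Polynomial

/-- The function `f` has a polynomial approximation on the positive half-line, of degree at most
that of `a`, whose relative error is at most `a(y) / a(-τ)`. -/
def HasRelApprox (a : ℝ[X]) (τ : ℝ) (f : ℝ → ℝ) : Prop :=
  ∃ P : ℝ[X], P.natDegree ≤ a.natDegree ∧
    ∀ y > 0, |f y - P.eval y| ≤ a.eval y / a.eval (-τ) * f y

/-- A nonnegative polynomial that is positive at `-τ` and not smaller to the left of `-τ`. -/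
structure IsDamping (a : ℝ[X]) (τ : ℝ) : Prop where
  nonneg : ∀ y, 0 ≤ a.eval y
  pos : 0 < a.eval (-τ)
  mono : ∀ τ' ≥ τ, a.eval (-τ) ≤ a.eval (-τ')

variable {a : ℝ[X]} {τ : ℝ}

/-- Hermite interpolation of `1 / (y + τ')` in the zeros of `a`: with
`P(y) = (1 - a(y) / a(-τ')) / (y + τ')` the relative error is exactly `a(y) / a(-τ')`. -/
theorem HasRelApprox.inv_add (ha : IsDamping a τ) {τ' : ℝ} (hτ' : 0 ≤ τ') (hle : τ ≤ τ') :
    HasRelApprox a τ fun y => 1 / (y + τ') := by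
  obtain ⟨b, hb⟩ : X - C (-τ') ∣ a - C (a.eval (-τ')) := X_sub_C_dvd_sub_C_eval
  have hpos' := ha.pos.trans_le (ha.mono τ' hle)
  refine ⟨C (-(a.eval (-τ'))⁻¹) * b, ?_, ?_⟩
  · refine (natDegree_C_mul_le _ _).trans ?_
    rcases eq_or_ne b 0 with rfl | hb0
    · simp
    · have h1 := congrArg natDegree hb
      rw [natDegree_mul (X_sub_C_ne_zero _) hb0, natDegree_X_sub_C, natDegree_sub_C] at h1
      omega
  · intro y hy
    have h1 := congrArg (eval y) hb
    simp only [eval_sub, eval_mul, eval_C, eval_X] at h1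
    have hyτ : 0 < y + τ' := by positivity
    have h2 : 1 / (y + τ') - (C (-(a.eval (-τ'))⁻¹) * b).eval y =
        a.eval y / a.eval (-τ') * (1 / (y + τ')) := by
      rw [eval_mul, eval_C]
      field_simp
      linear_combination -h1
    rw [h2, abs_of_nonneg (mul_nonneg (div_nonneg (ha.nonneg y) hpos'.le) (by positivity))]
    have := ha.nonneg y
    have := ha.pos
    have := ha.mono τ' hle
    gcongr

theorem HasRelApprox.const_mul {f : ℝ → ℝ} (hf : HasRelApprox a τ f) {c : ℝ} (hc : 0 ≤ c) :
    HasRelApprox a τ fun y => c * f y := by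
  obtain ⟨P, hP, hfP⟩ := hf
  refine ⟨C c * P, (natDegree_C_mul_le _ _).trans hP, fun y hy => ?_⟩
  rw [eval_mul, eval_C, ← mul_sub, abs_mul, abs_of_nonneg hc, mul_left_comm]
  exact mul_le_mul_of_nonneg_left (hfP y hy) hc

theorem HasRelApprox.sum {ι : Type*} (s : Finset ι) {f : ι → ℝ → ℝ}
    (hf : ∀ i ∈ s, HasRelApprox a τ (f i)) : HasRelApprox a τ fun y => ∑ i ∈ s, f i y := by
  choose! P hP hfP using hf
  refine ⟨∑ i ∈ s, P i, natDegree_sum_le_of_forall_le _ _ hP, fun y hy => ?_⟩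
  rw [eval_finsetSum, ← Finset.sum_sub_distrib, Finset.mul_sum]
  exact (Finset.abs_sum_le_sum_abs _ _).trans (Finset.sum_le_sum fun i hi => hfP i hi y hy)

/-- Pointwise limits: the approximating polynomials are bounded at `deg a + 1` interpolation nodes,
so that a subsequence converges. -/
theorem HasRelApprox.of_tendsto {f : ℕ → ℝ → ℝ} {g : ℝ → ℝ} (hf : ∀ m, HasRelApprox a τ (f m))
    (hlim : ∀ y > 0, Tendsto (fun m => f m y) atTop (𝓝 (g y))) : HasRelApprox a τ g := by
  choose P hP hfP using hf
  set D := a.natDegree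
  set v : Fin (D + 1) → ℝ := fun i => (i : ℝ) + 1 with hv
  have hvpos : ∀ i, 0 < v i := fun i => by positivity
  have hinj : Function.Injective v := fun i j h => by
    simpa [hv, Fin.ext_iff] using h
  set w : ℕ → Fin (D + 1) → ℝ := fun m i => (P m).eval (v i) with hw
  have hbdd : Bornology.IsBounded (Set.range w) := by
    have h1 : ∀ i, ∃ K, ∀ m, |w m i| ≤ K := by
      intro i
      obtain ⟨K, hK⟩ := (hlim (v i) (hvpos i)).norm.bddAbove_range
      refine ⟨K + |a.eval (v i) / a.eval (-τ)| * K, fun m => ?_⟩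
      have h2 : |f m (v i)| ≤ K := hK ⟨m, rfl⟩
      have h3 := hfP m (v i) (hvpos i)
      have h4 : a.eval (v i) / a.eval (-τ) * f m (v i) ≤ |a.eval (v i) / a.eval (-τ)| * K :=
        (le_abs_self _).trans (by rw [abs_mul]; gcongr)
      have h5 : |w m i| ≤ |f m (v i)| + |f m (v i) - (P m).eval (v i)| := by
        have := abs_sub (f m (v i)) (f m (v i) - (P m).eval (v i))
        rwa [sub_sub_cancel] at this
      linarith
    choose K hK using h1
    rw [isBounded_iff_forall_norm_le]
    refine ⟨∑ i, |K i|, ?_⟩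
    rintro _ ⟨m, rfl⟩
    rw [pi_norm_le_iff_of_nonneg (Finset.sum_nonneg fun i _ => abs_nonneg _)]
    intro i
    exact ((hK i m).trans (le_abs_self _)).trans
      (Finset.single_le_sum (f := fun i => |K i|) (fun i _ => abs_nonneg _) (Finset.mem_univ i))
  obtain ⟨w₀, -, φ, hφ, hconv⟩ := tendsto_subseq_of_bounded hbdd fun m => Set.mem_range_self m
  have hinterp : ∀ m, P m = Lagrange.interpolate Finset.univ v (w m) := fun m =>
    Lagrange.eq_interpolate hinj.injOn (by
      rw [Finset.card_univ, Fintype.card_fin]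
      exact (degree_le_natDegree).trans_lt (by exact_mod_cast Nat.lt_succ_of_le (hP m)))
  have heval : ∀ (r : Fin (D + 1) → ℝ) y, (Lagrange.interpolate Finset.univ v r).eval y =
      ∑ i, r i * (Lagrange.basis Finset.univ v i).eval y := fun r y => by
    rw [Lagrange.interpolate_apply, eval_finsetSum]
    simp
  refine ⟨Lagrange.interpolate Finset.univ v w₀, ?_, fun y hy => ?_⟩
  · have := Lagrange.degree_interpolate_lt w₀ (s := Finset.univ) hinj.injOn
    rw [Finset.card_univ, Fintype.card_fin] at this
    exact natDegree_le_iff_degree_le.2 (Order.le_of_lt_succ this)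
  · have h1 : Tendsto (fun m => (P (φ m)).eval y) atTop
        (𝓝 ((Lagrange.interpolate Finset.univ v w₀).eval y)) := by
      rw [heval]
      simp_rw [hinterp, heval]
      refine tendsto_finsetSum _ fun i _ => ?_
      exact ((tendsto_pi_nhds.1 hconv) i).mul_const _
    have h2 := (hlim y hy).comp hφ.tendsto_atTop
    exact le_of_tendsto_of_tendsto (h2.sub h1).abs (h2.const_mul _)
      (Eventually.of_forall fun m => hfP (φ m) y hy)

/-- As a function of `y`, `tanh (s √y) / √y` is a positive combination of the functions
`1 / (y + τ')`, where the smallest `τ'` is `(π / 2s)²`. -/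
theorem hasRelApprox_tanh (ha : IsDamping a τ) {s : ℝ} (hs : 0 < s)
    (hτ : τ ≤ (Real.pi / (2 * s)) ^ 2) :
    HasRelApprox a τ fun y => Real.tanh (s * √y) / √y := by
  have hpi := Real.pi_pos
  refine HasRelApprox.of_tendsto
    (f := fun m y => ∑ k ∈ Finset.range m, 2 / s * (1 / (y + (Real.pi * (k + 1 / 2) / s) ^ 2)))
    (fun m => HasRelApprox.sum _ fun k _ => (HasRelApprox.inv_add ha (by positivity)
      (hτ.trans ?_)).const_mul (by positivity)) fun y hy => ?_
  · have : Real.pi / (2 * s) ≤ Real.pi * (k + 1 / 2) / s := by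
      rw [div_le_div_iff₀ (by positivity) hs]
      have : 0 ≤ Real.pi * s * k := by positivity
      nlinarith
    gcongr
  · have hy' := Real.sqrt_pos.2 hy
    have h1 := ((hasSum_tanh (x := s * √y) (by positivity)).div_const (√y)).tendsto_sum_nat
    refine h1.congr fun m => Finset.sum_congr rfl fun k _ => ?_
    have h2 : (s * √y) ^ 2 = s ^ 2 * y := by rw [mul_pow, Real.sq_sqrt hy.le]
    rw [h2]
    field_simp

/-- `log (cosh (s √y)) / y` is the integral of `tanh (t √y) / √y` over `0 < t < s`. -/
theorem hasRelApprox_log_cosh (ha : IsDamping a τ) {s : ℝ} (hs : 0 < s)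
    (hτ : τ ≤ (Real.pi / (2 * s)) ^ 2) :
    HasRelApprox a τ fun y => Real.log (Real.cosh (s * √y)) / y := by
  have hpi := Real.pi_pos
  refine HasRelApprox.of_tendsto
    (f := fun m y => ∑ j ∈ Finset.range m,
      s / (m : ℝ) * (Real.tanh ((j + 1 : ℝ) * (s / (m : ℝ)) * √y) / √y))
    (fun m => HasRelApprox.sum _ fun j hj => ?_) fun y hy => ?_
  · have hjm : j + 1 ≤ m := Finset.mem_range.1 hj
    have hm : (0 : ℝ) < m := by exact_mod_cast (Nat.succ_pos j).trans_le hjm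
    have hjm' : (j + 1 : ℝ) ≤ m := by exact_mod_cast hjm
    have hle : (j + 1 : ℝ) * (s / m) ≤ s := by
      rw [mul_div_assoc', div_le_iff₀ hm]
      nlinarith
    refine (hasRelApprox_tanh ha (by positivity) (hτ.trans ?_)).const_mul (by positivity)
    gcongr
  · have hy' := Real.sqrt_pos.2 hy
    have h1 := (tendsto_sum_tanh (x := s * √y) (by positivity)).div_const y
    refine h1.congr fun m => ?_
    rw [Finset.sum_div]
    refine Finset.sum_congr rfl fun j _ => ?_
    have h2 : (j + 1 : ℝ) * (s * √y / m) = (j + 1 : ℝ) * (s / m) * √y := by ring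
    rw [h2]
    have h3 : √y / y = 1 / √y := by
      rw [div_eq_div_iff hy.ne' hy'.ne', Real.mul_self_sqrt hy.le, one_mul]
    linear_combination (s / m * Real.tanh ((j + 1 : ℝ) * (s / m) * √y)) * h3

/-- The limit `s → ∞` of `hasRelApprox_tanh`. -/
theorem hasRelApprox_inv_sqrt (ha : IsDamping a 0) : HasRelApprox a 0 fun y => 1 / √y := by
  refine HasRelApprox.of_tendsto (f := fun m y => Real.tanh ((m + 1 : ℝ) * √y) / √y)
    (fun m => hasRelApprox_tanh ha (by positivity) (by positivity)) fun y hy => ?_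
  have hy' := Real.sqrt_pos.2 hy
  refine Tendsto.div_const (tendsto_tanh_atTop.comp ?_) _
  exact (tendsto_atTop_add_const_right atTop (1 : ℝ) tendsto_natCast_atTop_atTop).atTop_mul_const hy'

/-- An approximation relative to the size of `ξ` or `ξ²` times a function of `ξ²`, on the whole real
line.  At `ξ = 0` both sides vanish. -/
theorem HasRelApprox.exists_poly (ha : IsDamping a τ) {f : ℝ → ℝ} (hf : HasRelApprox a τ f)
    (c : ℝ) {i : ℕ} (hi : 1 ≤ i) (hi2 : i ≤ 2) :
    ∃ P : ℝ[X], P.natDegree ≤ 2 * a.natDegree + 2 ∧ ∀ ξ, |c * (ξ ^ i * f (ξ ^ 2)) - P.eval ξ| ≤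
      a.eval (ξ ^ 2) / a.eval (-τ) * |c * (ξ ^ i * f (ξ ^ 2))| := by
  obtain ⟨P, hP, hfP⟩ := hf
  refine ⟨C c * (X ^ i * P.comp (X ^ 2)), ?_, fun ξ => ?_⟩
  · refine (natDegree_C_mul_le _ _).trans (natDegree_mul_le.trans ?_)
    have h1 : (P.comp (X ^ 2)).natDegree ≤ P.natDegree * 2 := by
      have := natDegree_comp_le (p := P) (q := X ^ 2)
      rwa [natDegree_X_pow] at this
    rw [natDegree_X_pow]
    omega
  · simp only [eval_mul, eval_C, eval_pow, eval_X, eval_comp]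
    rw [← mul_sub, ← mul_sub, abs_mul, abs_mul, abs_mul, abs_mul]
    rcases eq_or_ne ξ 0 with rfl | hξ
    · simp [show i ≠ 0 by omega]
    · have h1 := hfP (ξ ^ 2) (by positivity)
      have h2 : a.eval (ξ ^ 2) / a.eval (-τ) * f (ξ ^ 2) ≤
          a.eval (ξ ^ 2) / a.eval (-τ) * |f (ξ ^ 2)| :=
        mul_le_mul_of_nonneg_left (le_abs_self _) (div_nonneg (ha.nonneg _) ha.pos.le)
      calc |c| * (|ξ ^ i| * |f (ξ ^ 2) - P.eval (ξ ^ 2)|)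
          ≤ |c| * (|ξ ^ i| * (a.eval (ξ ^ 2) / a.eval (-τ) * |f (ξ ^ 2)|)) := by
            gcongr
            exact h1.trans h2
        _ = _ := by ring

end Stieltjes

/-! ### Polynomial approximation of the observables -/

section Observables

open Polynomial

/-- The square of the lowest Matsubara frequency `π / β`. -/
noncomputable def matsubara (β : ℝ≥0∞) : ℝ := (Real.pi * β⁻¹.toReal) ^ 2

/-- Both observables are the sum of an affine function and a multiple of `ξ` or `ξ²` times a Stieltjes
function of `ξ²`, where `ξ = x - μ`: at positive temperature,
`F(x) = 1/2 - 1/2 tanh (β ξ / 2)` and `G(x) = ξ - (2 / β) log (2 cosh (β ξ / 2))`; at zero temperature,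
`F(x) = 1/2 - 1/2 sign ξ` and `G(x) = ξ - |ξ|`. -/
theorem observable_decomposition {β : ℝ≥0∞} (hβ : 0 < β) (μ : ℝ) {O : ℝ → ℝ}
    (hO : O = fermiDirac β μ ∨ O = grandPotential β μ) :
    ∃ (A : ℝ[X]) (h : ℝ → ℝ), A.natDegree ≤ 1 ∧ (∀ x, O x = A.eval (x - μ) + h (x - μ)) ∧
      (∀ ξ, |h ξ| ≤ 1 + ξ ^ 2) ∧
      ∀ a : ℝ[X], IsDamping a (matsubara β) → ∃ P : ℝ[X], P.natDegree ≤ 2 * a.natDegree + 2 ∧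
        ∀ ξ, |h ξ - P.eval ξ| ≤ a.eval (ξ ^ 2) / a.eval (-matsubara β) * |h ξ| := by
  have habs : ∀ ξ : ℝ, |ξ| ≤ 1 + ξ ^ 2 := fun ξ => by
    rw [← sq_abs]
    nlinarith [sq_nonneg (|ξ| - 1), abs_nonneg ξ]
  have hlin : ∀ c : ℝ, (X - C c : ℝ[X]).natDegree ≤ 1 := fun c => (natDegree_X_sub_C c).le
  by_cases htop : β = ⊤
  · subst htop
    have hM : matsubara ⊤ = 0 := by simp [matsubara]
    rw [hM]
    have hsgn : ∀ ξ : ℝ, ξ ^ 1 * (1 / √(ξ ^ 2)) = if ξ < 0 then -1 else if ξ = 0 then 0 else 1 := by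
      intro ξ
      rw [Real.sqrt_sq_eq_abs, pow_one]
      rcases lt_trichotomy ξ 0 with h | rfl | h
      · rw [if_pos h, abs_of_neg h, mul_one_div, div_neg, div_self h.ne]
      · simp
      · rw [if_neg h.not_gt, if_neg h.ne', abs_of_pos h]
        field_simp
    have habs' : ∀ ξ : ℝ, ξ ^ 2 * (1 / √(ξ ^ 2)) = |ξ| := by
      intro ξ
      rw [Real.sqrt_sq_eq_abs, ← sq_abs]
      rcases eq_or_ne ξ 0 with rfl | h
      · simp
      · have := abs_ne_zero.2 h
        field_simp
    rcases hO with rfl | rfl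
    · refine ⟨C (1 / 2), fun ξ => -(1 / 2) * (ξ ^ 1 * (1 / √(ξ ^ 2))), by simp, fun x => ?_,
        fun ξ => ?_, fun a ha => (hasRelApprox_inv_sqrt ha).exists_poly ha _ le_rfl one_le_two⟩
      · simp only [hsgn]
        rw [fermiDirac, if_pos rfl, eval_C]
        simp only [sub_neg, sub_eq_zero]
        split_ifs <;> norm_num
      · simp only [hsgn]
        split_ifs <;> norm_num <;> nlinarith [sq_nonneg ξ]
    · refine ⟨X, fun ξ => -1 * (ξ ^ 2 * (1 / √(ξ ^ 2))), by simp, fun x => ?_,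
        fun ξ => ?_, fun a ha => (hasRelApprox_inv_sqrt ha).exists_poly ha _ one_le_two le_rfl⟩
      · simp only [habs']
        rw [grandPotential, if_pos rfl, eval_X]
        split_ifs with h
        · rw [abs_of_neg (by linarith)]
          ring
        · rw [abs_of_nonneg (by linarith)]
          ring
      · simp only [habs']
        simpa using habs ξ
  · have hb : 0 < β.toReal := ENNReal.toReal_pos hβ.ne' htop
    set b := β.toReal with hbdef
    have hM : matsubara β = (Real.pi / (2 * (b / 2))) ^ 2 := by
      rw [matsubara, ENNReal.toReal_inv, ← hbdef]
      congr 1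
      field_simp
    have hs : 0 < b / 2 := by positivity
    have htanh : ∀ ξ : ℝ, ξ ^ 1 * (Real.tanh (b / 2 * √(ξ ^ 2)) / √(ξ ^ 2)) =
        Real.tanh (b / 2 * ξ) := by
      intro ξ
      rw [Real.sqrt_sq_eq_abs, pow_one]
      rcases lt_trichotomy ξ 0 with h | rfl | h
      · have := h.ne
        rw [abs_of_neg h, mul_neg, Real.tanh_neg]
        field_simp
      · simp
      · rw [abs_of_pos h]
        field_simp
    have hcosh : ∀ ξ : ℝ, ξ ^ 2 * (Real.log (Real.cosh (b / 2 * √(ξ ^ 2))) / ξ ^ 2) =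
        Real.log (Real.cosh (b / 2 * ξ)) := by
      intro ξ
      have h1 : Real.cosh (b / 2 * √(ξ ^ 2)) = Real.cosh (b / 2 * ξ) := by
        rw [Real.sqrt_sq_eq_abs, ← Real.cosh_abs (b / 2 * ξ), abs_mul, abs_of_pos hs]
      rw [h1]
      rcases eq_or_ne ξ 0 with rfl | h
      · simp
      · field_simp
    have hF : ∀ x, fermiDirac β μ x = 1 / 2 - 1 / 2 * Real.tanh (b / 2 * (x - μ)) := by
      intro x
      rw [fermiDirac, if_neg htop, Real.tanh_eq_sinh_div_cosh, Real.sinh_eq, Real.cosh_eq,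
        show b * (x - μ) = b / 2 * (x - μ) + b / 2 * (x - μ) by ring, Real.exp_add, Real.exp_neg]
      have := Real.exp_pos (b / 2 * (x - μ))
      field_simp
      ring
    rcases hO with rfl | rfl
    · refine ⟨C (1 / 2),
        fun ξ => -(1 / 2) * (ξ ^ 1 * (Real.tanh (b / 2 * √(ξ ^ 2)) / √(ξ ^ 2))), by simp,
        fun x => ?_, fun ξ => ?_,
        fun a ha => (hasRelApprox_tanh ha hs hM.le).exists_poly ha _ le_rfl one_le_two⟩
      · simp only [htanh]
        rw [hF, eval_C]
        ring
      · simp only [htanh]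
        rw [abs_mul]
        have h1 := Real.abs_tanh_lt_one (b / 2 * ξ)
        norm_num
        nlinarith [sq_nonneg ξ]
    · refine ⟨X - C (2 / b * Real.log 2),
        fun ξ => -(2 / b) * (ξ ^ 2 * (Real.log (Real.cosh (b / 2 * √(ξ ^ 2))) / ξ ^ 2)), hlin _,
        fun x => ?_, fun ξ => ?_,
        fun a ha => (hasRelApprox_log_cosh ha hs hM.le).exists_poly ha _ one_le_two le_rfl⟩
      · simp only [hcosh]
        rw [grandPotential, if_neg htop, ← hbdef]
        have h1 : 1 - fermiDirac β μ x =
            Real.exp (b / 2 * (x - μ)) / (2 * Real.cosh (b / 2 * (x - μ))) := by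
          rw [hF, ← Real.cosh_add_sinh, Real.tanh_eq_sinh_div_cosh]
          have := Real.cosh_pos (b / 2 * (x - μ))
          field_simp
          ring
        rw [h1, Real.log_div (Real.exp_pos _).ne' (by positivity), Real.log_exp,
          Real.log_mul two_ne_zero (Real.cosh_pos _).ne', eval_sub, eval_X, eval_C]
        field_simp
        ring
      · simp only [hcosh]
        have h1 : 0 ≤ Real.log (Real.cosh (b / 2 * ξ)) := Real.log_nonneg (Real.one_le_cosh _)
        have h2 : Real.log (Real.cosh (b / 2 * ξ)) ≤ |b / 2 * ξ| := by
          rw [Real.log_le_iff_le_exp (Real.cosh_pos _), ← Real.cosh_abs, Real.cosh_eq]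
          have : Real.exp (-|b / 2 * ξ|) ≤ Real.exp |b / 2 * ξ| :=
            Real.exp_le_exp.2 (by linarith [abs_nonneg (b / 2 * ξ)])
          linarith
        rw [abs_mul, abs_of_nonneg h1, abs_neg, abs_of_pos (by positivity : 0 < 2 / b)]
        rw [abs_mul, abs_of_pos hs] at h2
        calc 2 / b * Real.log (Real.cosh (b / 2 * ξ)) ≤ 2 / b * (b / 2 * |ξ|) := by gcongr
          _ = |ξ| := by field_simp
          _ ≤ _ := habs ξ

end Observables

/-! ### Damping polynomials for two bands and finitely many defects -/

section Damping

open Polynomial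

/-- The distance of the chemical potential to the bands. -/
noncomputable def Bands.dist (B : Bands) : ℝ := min (B.μ - B.maxLower) (B.minUpper - B.μ)

/-- A radius of an interval about the chemical potential that contains the bands; the summand `1`
makes it larger than the distance of the bands. -/
noncomputable def Bands.radius (B : Bands) : ℝ := 1 + max (B.μ - B.minLower) (B.maxUpper - B.μ)

/-- An exponential rate of convergence, which depends on the bands and the temperature only. -/
noncomputable def decayRate (B : Bands) (β : ℝ≥0∞) : ℝ :=
  min 1 ((B.dist + β⁻¹.toReal) / (2 * B.radius)) / 2

theorem Bands.dist_nonneg (B : Bands) : 0 ≤ B.dist :=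
  le_min (sub_nonneg.2 B.lower_le_μ) (sub_nonneg.2 B.μ_le_upper)

theorem Bands.dist_add_one_le_radius (B : Bands) : B.dist + 1 ≤ B.radius := by
  have h1 : B.dist ≤ B.μ - B.maxLower := min_le_left _ _
  have h2 : B.μ - B.minLower ≤ max (B.μ - B.minLower) (B.maxUpper - B.μ) := le_max_left _ _
  have h3 := B.lower_le
  rw [Bands.radius]
  linarith

theorem Bands.radius_pos (B : Bands) : 0 < B.radius := by
  linarith [B.dist_nonneg, B.dist_add_one_le_radius]

/-- In the variable `(x - μ)²` both bands lie in the single interval `[dist², radius²]`. -/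
theorem Bands.sq_mem_of_mem_withDefects {B : Bands} {lam : Finset ℝ} {x : ℝ}
    (hx : x ∈ B.withDefects lam) :
    x ∈ lam ∨ (B.dist ^ 2 ≤ (x - B.μ) ^ 2 ∧ (x - B.μ) ^ 2 ≤ B.radius ^ 2) := by
  have h0 := B.dist_nonneg
  have h1 : B.dist ≤ B.μ - B.maxLower := min_le_left _ _
  have h2 : B.dist ≤ B.minUpper - B.μ := min_le_right _ _
  have h3 : B.μ - B.minLower ≤ max (B.μ - B.minLower) (B.maxUpper - B.μ) := le_max_left _ _
  have h4 : B.maxUpper - B.μ ≤ max (B.μ - B.minLower) (B.maxUpper - B.μ) := le_max_right _ _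
  have h5 : B.radius = 1 + max (B.μ - B.minLower) (B.maxUpper - B.μ) := rfl
  rcases hx with (⟨h6, h7⟩ | h6) | ⟨h6, h7⟩
  · right
    constructor
    · nlinarith
    · nlinarith
  · exact Or.inl h6
  · right
    constructor
    · nlinarith
    · nlinarith

/-- The polynomial in `y = (x - μ)²` that is small on the bands, vanishes at the defects, and is
large at the square `-τ` of an imaginary frequency: the Chebyshev polynomial for the interval
`[dist², radius²]`, multiplied by the linear factors of the defects, and squared. -/
noncomputable def dampingPoly (B : Bands) (lam : Finset ℝ) (k : ℕ) : ℝ[X] :=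
  ((Chebyshev.T ℝ k).comp (C (B.radius ^ 2 - B.dist ^ 2)⁻¹ * (C (B.radius ^ 2 + B.dist ^ 2) - 2 * X))
    * ∏ z ∈ lam, (X - C ((z - B.μ) ^ 2))) ^ 2

variable (B : Bands) (lam : Finset ℝ) (k : ℕ)

theorem eval_dampingPoly (y : ℝ) : (dampingPoly B lam k).eval y =
    ((Chebyshev.T ℝ k).eval ((B.radius ^ 2 + B.dist ^ 2 - 2 * y) / (B.radius ^ 2 - B.dist ^ 2))
      * ∏ z ∈ lam, (y - (z - B.μ) ^ 2)) ^ 2 := by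
  have h : (C (B.radius ^ 2 - B.dist ^ 2)⁻¹ * (C (B.radius ^ 2 + B.dist ^ 2) - 2 * X)).eval y =
      (B.radius ^ 2 + B.dist ^ 2 - 2 * y) / (B.radius ^ 2 - B.dist ^ 2) := by
    simp only [eval_mul, eval_C, eval_sub, eval_ofNat, eval_X]
    ring
  rw [dampingPoly, eval_pow, eval_mul, eval_comp, h, eval_prod]
  simp

theorem natDegree_dampingPoly_le : (dampingPoly B lam k).natDegree ≤ 2 * (k + lam.card) := by
  refine natDegree_pow_le.trans (Nat.mul_le_mul_left 2 (natDegree_mul_le.trans ?_))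
  have h1 : (C (B.radius ^ 2 - B.dist ^ 2)⁻¹ *
      (C (B.radius ^ 2 + B.dist ^ 2) - 2 * X) : ℝ[X]).natDegree ≤ 1 := by
    compute_degree
  have h2 : ((Chebyshev.T ℝ k).comp (C (B.radius ^ 2 - B.dist ^ 2)⁻¹ *
      (C (B.radius ^ 2 + B.dist ^ 2) - 2 * X))).natDegree ≤ k := by
    refine natDegree_comp_le.trans ?_
    rw [Chebyshev.natDegree_T, Int.natAbs_natCast]
    nlinarith
  have h3 : (∏ z ∈ lam, (X - C ((z - B.μ) ^ 2)) : ℝ[X]).natDegree ≤ lam.card := by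
    rw [natDegree_prod_of_monic _ _ fun z _ => monic_X_sub_C _]
    simp only [natDegree_X_sub_C, Finset.sum_const, smul_eq_mul, mul_one, le_refl]
  exact add_le_add h2 h3

theorem Bands.sq_sub_sq_pos : 0 < B.radius ^ 2 - B.dist ^ 2 := by
  nlinarith [B.dist_nonneg, B.dist_add_one_le_radius]

theorem eval_dampingPoly_neg (τ : ℝ) : (dampingPoly B lam k).eval (-τ) =
    ((Chebyshev.T ℝ k).eval (1 + 2 * (B.dist ^ 2 + τ) / (B.radius ^ 2 - B.dist ^ 2))
      * ∏ z ∈ lam, (τ + (z - B.μ) ^ 2)) ^ 2 := by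
  have h := B.sq_sub_sq_pos
  have h1 : (B.radius ^ 2 + B.dist ^ 2 - 2 * -τ) / (B.radius ^ 2 - B.dist ^ 2) =
      1 + 2 * (B.dist ^ 2 + τ) / (B.radius ^ 2 - B.dist ^ 2) := by
    field_simp
    ring
  have h2 : ∏ z ∈ lam, (-τ - (z - B.μ) ^ 2) = (-1) ^ lam.card * ∏ z ∈ lam, (τ + (z - B.μ) ^ 2) := by
    rw [← Finset.prod_const, ← Finset.prod_mul_distrib]
    exact Finset.prod_congr rfl fun z _ => by ring
  rw [eval_dampingPoly, h1, h2, mul_pow, mul_pow, mul_pow, ← pow_mul, mul_comm _ 2, pow_mul]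
  norm_num

theorem chebyshev_eval_mono {x y : ℝ} (hx : 1 ≤ x) (hxy : x ≤ y) :
    (Chebyshev.T ℝ k).eval x ≤ (Chebyshev.T ℝ k).eval y := by
  have hy := hx.trans hxy
  rw [← Real.cosh_arcosh hx, ← Real.cosh_arcosh hy, Chebyshev.T_real_cosh, Chebyshev.T_real_cosh,
    Real.cosh_le_cosh, abs_mul, abs_mul, abs_of_nonneg (Real.arcosh_nonneg hx),
    abs_of_nonneg (Real.arcosh_nonneg hy)]
  gcongr
  exact (Real.arcosh_le_arcosh (by linarith) (by linarith)).2 hxy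

theorem isDamping_dampingPoly {τ : ℝ} (hτ : 0 ≤ τ) (h : ∀ z ∈ lam, 0 < τ + (z - B.μ) ^ 2) :
    IsDamping (dampingPoly B lam k) τ := by
  have hL := B.sq_sub_sq_pos
  have harg : ∀ τ' ≥ τ, 1 ≤ 1 + 2 * (B.dist ^ 2 + τ') / (B.radius ^ 2 - B.dist ^ 2) := by
    intro τ' hτ'
    have : 0 ≤ 2 * (B.dist ^ 2 + τ') / (B.radius ^ 2 - B.dist ^ 2) := by
      have : 0 ≤ τ' := hτ.trans hτ'
      positivity
    linarith
  have hT : 1 ≤ (Chebyshev.T ℝ k).eval (1 + 2 * (B.dist ^ 2 + τ) / (B.radius ^ 2 - B.dist ^ 2)) :=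
    Chebyshev.one_le_eval_T_real k (harg τ le_rfl)
  refine ⟨fun y => ?_, ?_, fun τ' hτ' => ?_⟩
  · rw [eval_dampingPoly]
    exact sq_nonneg _
  · rw [eval_dampingPoly_neg]
    have := Finset.prod_pos h
    positivity
  · rw [eval_dampingPoly_neg, eval_dampingPoly_neg]
    have h1 : 0 ≤ ∏ z ∈ lam, (τ + (z - B.μ) ^ 2) := Finset.prod_nonneg fun z hz => (h z hz).le
    have h2 : (Chebyshev.T ℝ k).eval (1 + 2 * (B.dist ^ 2 + τ) / (B.radius ^ 2 - B.dist ^ 2)) ≤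
        (Chebyshev.T ℝ k).eval (1 + 2 * (B.dist ^ 2 + τ') / (B.radius ^ 2 - B.dist ^ 2)) :=
      chebyshev_eval_mono k (harg τ le_rfl) (by gcongr)
    have h3 : ∏ z ∈ lam, (τ + (z - B.μ) ^ 2) ≤ ∏ z ∈ lam, (τ' + (z - B.μ) ^ 2) :=
      Finset.prod_le_prod (fun z hz => (h z hz).le) fun z _ => by linarith
    have h4 := zero_le_one.trans (hT.trans h2)
    gcongr

theorem decayRate_nonneg (β : ℝ≥0∞) : 0 ≤ decayRate B β := by
  have h1 := B.dist_nonneg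
  have h2 := B.radius_pos
  have h3 : 0 ≤ β⁻¹.toReal := ENNReal.toReal_nonneg
  rw [decayRate]
  positivity

theorem decayRate_pos {β : ℝ≥0∞} (hβ : 0 < β) (h : β = ⊤ → B.Insulating) :
    0 < decayRate B β := by
  have h1 := B.dist_nonneg
  have h2 := B.radius_pos
  have h3 : 0 ≤ β⁻¹.toReal := ENNReal.toReal_nonneg
  have h4 : 0 < B.dist + β⁻¹.toReal := by
    by_cases htop : β = ⊤
    · obtain ⟨h5, h6⟩ := h htop
      have : 0 < B.dist := lt_min (sub_pos.2 h5) (sub_pos.2 h6)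
      linarith
    · have : 0 < β⁻¹.toReal :=
        ENNReal.toReal_pos (ENNReal.inv_ne_zero.2 htop) (ENNReal.inv_ne_top.2 hβ.ne')
      linarith
  rw [decayRate]
  positivity

/-- Growth of the Chebyshev polynomial at the lowest Matsubara frequency: with `e` twice the rate, its
argument is at least `1 + e² ≥ cosh e`, and `T_k (cosh e) = cosh (k e)`. -/
theorem exp_le_chebyshev (β : ℝ≥0∞) : Real.exp (k * (2 * decayRate B β)) / 2 ≤
    (Chebyshev.T ℝ k).eval
      (1 + 2 * (B.dist ^ 2 + matsubara β) / (B.radius ^ 2 - B.dist ^ 2)) := by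
  set e := 2 * decayRate B β with he
  have he0 : 0 ≤ e := by have := decayRate_nonneg B β; positivity
  have hee : e = min 1 ((B.dist + β⁻¹.toReal) / (2 * B.radius)) := by rw [he, decayRate]; ring
  have he1 : e ≤ 1 := hee ▸ min_le_left _ _
  have he2 : e ≤ (B.dist + β⁻¹.toReal) / (2 * B.radius) := hee ▸ min_le_right _ _
  have hd := B.dist_nonneg
  have hr := B.radius_pos
  have ht : 0 ≤ β⁻¹.toReal := ENNReal.toReal_nonneg
  have hL := B.sq_sub_sq_pos
  have h1 : Real.cosh e ≤ 1 + e ^ 2 := by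
    refine (Real.cosh_le_exp_half_sq e).trans ?_
    have h2 : |e ^ 2 / 2| ≤ 1 := by
      rw [abs_of_nonneg (by positivity : 0 ≤ e ^ 2 / 2)]
      nlinarith
    have h3 := (abs_le.1 (Real.abs_exp_sub_one_le h2)).2
    rw [abs_of_nonneg (by positivity : 0 ≤ e ^ 2 / 2)] at h3
    linarith
  have h2 : e ^ 2 ≤ 2 * (B.dist ^ 2 + matsubara β) / (B.radius ^ 2 - B.dist ^ 2) := by
    have h3 : e ^ 2 ≤ ((B.dist + β⁻¹.toReal) / (2 * B.radius)) ^ 2 := by gcongr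
    refine h3.trans ?_
    rw [div_pow, div_le_div_iff₀ (by positivity) hL]
    have h4 : β⁻¹.toReal ^ 2 ≤ matsubara β := by
      rw [matsubara, mul_pow]
      have : 1 ≤ Real.pi ^ 2 := by nlinarith [Real.pi_gt_three]
      nlinarith [sq_nonneg β⁻¹.toReal]
    have h5 : (B.dist + β⁻¹.toReal) ^ 2 ≤ 2 * (B.dist ^ 2 + matsubara β) := by
      nlinarith [sq_nonneg (B.dist - β⁻¹.toReal)]
    have h6 : B.radius ^ 2 - B.dist ^ 2 ≤ (2 * B.radius) ^ 2 := by nlinarith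
    exact mul_le_mul h5 h6 hL.le ((sq_nonneg _).trans h5)
  have h3 : Real.exp (k * e) / 2 ≤ (Chebyshev.T ℝ k).eval (Real.cosh e) := by
    rw [Chebyshev.T_real_cosh, Real.cosh_eq]
    push_cast
    have := Real.exp_pos (-(k * e))
    linarith
  exact h3.trans (chebyshev_eval_mono k (Real.one_le_cosh e) (by linarith))

/-- The relative size of the damping polynomial on the spectrum.  The defects only enter the constant:
the polynomial vanishes there. -/
theorem dampingPoly_le_exp {β : ℝ≥0∞} (h : ∀ z ∈ lam, 0 < matsubara β + (z - B.μ) ^ 2) :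
    ∃ K > 0, ∀ k : ℕ, ∀ x ∈ B.withDefects lam, (1 + (x - B.μ) ^ 2) *
      ((dampingPoly B lam k).eval ((x - B.μ) ^ 2) / (dampingPoly B lam k).eval (-matsubara β)) ≤
        K * Real.exp (-(4 * decayRate B β) * k) := by
  set m := ∏ z ∈ lam, (matsubara β + (z - B.μ) ^ 2) with hm
  set M := ∏ z ∈ lam, (B.radius ^ 2 + (z - B.μ) ^ 2) with hM
  have hm0 : 0 < m := Finset.prod_pos h
  have hM0 : 0 < M := Finset.prod_pos fun z _ => by
    have := B.radius_pos
    positivity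
  refine ⟨(1 + B.radius ^ 2) * (4 * M ^ 2 / m ^ 2), by positivity, fun k x hx => ?_⟩
  rcases B.sq_mem_of_mem_withDefects hx with hx | ⟨hx1, hx2⟩
  · have h0 : (dampingPoly B lam k).eval ((x - B.μ) ^ 2) = 0 := by
      rw [eval_dampingPoly, Finset.prod_eq_zero (i := x) hx (sub_self ((x - B.μ) ^ 2)), mul_zero,
        zero_pow two_ne_zero]
    rw [h0, zero_div, mul_zero]
    positivity
  · have hL := B.sq_sub_sq_pos
    rw [eval_dampingPoly, eval_dampingPoly_neg, ← hm]
    set s := (B.radius ^ 2 + B.dist ^ 2 - 2 * (x - B.μ) ^ 2) / (B.radius ^ 2 - B.dist ^ 2)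
    have hs : |s| ≤ 1 := by
      rw [abs_le, le_div_iff₀ hL, div_le_iff₀ hL]
      constructor <;> linarith
    have hT := Chebyshev.abs_eval_T_real_le_one k hs
    have hprod : |∏ z ∈ lam, ((x - B.μ) ^ 2 - (z - B.μ) ^ 2)| ≤ M := by
      rw [Finset.abs_prod]
      refine Finset.prod_le_prod (fun _ _ => abs_nonneg _) fun z _ => ?_
      rw [abs_le]
      constructor <;> nlinarith [sq_nonneg (x - B.μ), sq_nonneg (z - B.μ)]
    have hnum : ((Chebyshev.T ℝ k).eval s * ∏ z ∈ lam, ((x - B.μ) ^ 2 - (z - B.μ) ^ 2)) ^ 2 ≤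
        M ^ 2 := by
      rw [← sq_abs, abs_mul]
      have : |(Chebyshev.T ℝ k).eval s| * |∏ z ∈ lam, ((x - B.μ) ^ 2 - (z - B.μ) ^ 2)| ≤ 1 * M :=
        mul_le_mul hT hprod (abs_nonneg _) zero_le_one
      rw [one_mul] at this
      gcongr
    have hden : (Real.exp (k * (2 * decayRate B β)) / 2 * m) ^ 2 ≤
        ((Chebyshev.T ℝ k).eval (1 + 2 * (B.dist ^ 2 + matsubara β) /
          (B.radius ^ 2 - B.dist ^ 2)) * m) ^ 2 := by
      have := exp_le_chebyshev B k β
      gcongr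
    have hE : Real.exp (-(4 * decayRate B β) * k) = (Real.exp (k * (2 * decayRate B β)) ^ 2)⁻¹ := by
      rw [← Real.exp_nat_mul, ← Real.exp_neg]
      congr 1
      push_cast
      ring
    rw [hE]
    calc _ ≤ (1 + B.radius ^ 2) *
          (M ^ 2 / (Real.exp (k * (2 * decayRate B β)) / 2 * m) ^ 2) := by
          gcongr
      _ = _ := by
          have := Real.exp_pos (k * (2 * decayRate B β))
          field_simp
          ring

end Damping

/-! ### Approximation on the whole line, with small error on the spectrum -/

section Approximation

open Polynomial

theorem matsubara_nonneg (β : ℝ≥0∞) : 0 ≤ matsubara β := sq_nonneg _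

/-- The zeros of the damping polynomial at the defects avoid the singularities of the observable. -/
theorem matsubara_add_sq_pos {B : Bands} {lam : Finset ℝ} {β : ℝ≥0∞} (hβ : 0 < β)
    (h : β = ⊤ → 0 < B.defectGap lam) : ∀ z ∈ lam, 0 < matsubara β + (z - B.μ) ^ 2 := by
  intro z hz
  by_cases htop : β = ⊤
  · have hgap := h htop
    have hne : z ≠ B.μ := by
      rintro rfl
      have h1 : (insert B.minUpper (lam.filter fun x => B.μ ≤ x)).min'
          (Finset.insert_nonempty _ _) ≤ B.μ :=
        Finset.min'_le _ _ (Finset.mem_insert_of_mem (Finset.mem_filter.2 ⟨hz, le_rfl⟩))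
      have h2 : B.μ ≤ (insert B.maxLower (lam.filter fun x => x ≤ B.μ)).max'
          (Finset.insert_nonempty _ _) :=
        Finset.le_max' _ _ (Finset.mem_insert_of_mem
          (show B.μ ∈ lam.filter fun x => x ≤ B.μ from Finset.mem_filter.2 ⟨hz, le_rfl⟩))
      rw [Bands.defectGap] at hgap
      linarith
    have := sub_ne_zero.2 hne
    have := matsubara_nonneg β
    positivity
  · have h1 : 0 < β⁻¹.toReal :=
      ENNReal.toReal_pos (ENNReal.inv_ne_zero.2 htop) (ENNReal.inv_ne_top.2 hβ.ne')
    have h2 := Real.pi_pos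
    rw [matsubara]
    positivity

/-- The observable is approximated by a polynomial `P` on the whole real line up to a polynomial
error bound `W` that is exponentially small on the spectrum.  For the finitely many `n` for which
there are not enough degrees of freedom to annihilate all defects, `W` is a fixed parabola. -/
theorem observable_approx {B : Bands} {lam : Finset ℝ} {β : ℝ≥0∞} (hβ : 0 < β)
    (hgap : β = ⊤ → 0 < B.defectGap lam) {O : ℝ → ℝ}
    (hO : O = fermiDirac β B.μ ∨ O = grandPotential β B.μ) :
    ∃ K > 0, ∀ n : ℕ, ∃ P W : ℝ[X], P.natDegree ≤ 2 * n + 1 ∧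
      (W.natDegree ≤ 2 * n + 1 ∨ W = 1 + (X - C B.μ) ^ 2) ∧
      (∀ x, |O x - P.eval x| ≤ W.eval x) ∧
      ∀ x ∈ B.withDefects lam,
        W.eval x ≤ K * Real.exp (-decayRate B β * ((2 * n + 1 : ℕ) : ℝ)) := by
  have hpos := matsubara_add_sq_pos hβ hgap
  obtain ⟨A, f, hA, hOf, hf, happ⟩ := observable_decomposition hβ B.μ hO
  obtain ⟨K₁, hK₁, hdamp⟩ := dampingPoly_le_exp B lam hpos
  set q := lam.card
  set γ := decayRate B β with hγ
  have hγ0 : 0 ≤ γ := decayRate_nonneg B β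
  set K₂ := 1 + B.radius ^ 2 + ∑ z ∈ lam, (z - B.μ) ^ 2 with hK₂
  have hK₂0 : 0 < K₂ := by
    have := Finset.sum_nonneg fun z (_ : z ∈ lam) => sq_nonneg (z - B.μ)
    positivity
  have hAcomp : (A.comp (X - C B.μ)).natDegree ≤ 1 := by
    refine natDegree_comp_le.trans ?_
    rw [natDegree_X_sub_C]
    omega
  refine ⟨K₁ * Real.exp (γ * (4 * q + 5)) + K₂ * Real.exp (γ * (4 * q + 3)), by positivity,
    fun n => ?_⟩
  rcases Nat.lt_or_ge n (2 * q + 1) with hn | hn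
  -- small `n`: only the affine part of the observable is kept
  · refine ⟨A.comp (X - C B.μ), 1 + (X - C B.μ) ^ 2, by omega, Or.inr rfl, fun x => ?_,
      fun x hx => ?_⟩
    · rw [hOf, eval_comp]
      simp only [eval_sub, eval_X, eval_C, eval_add, eval_one, eval_pow, add_sub_cancel_left]
      exact hf _
    · simp only [eval_sub, eval_X, eval_C, eval_add, eval_one, eval_pow]
      have h1 : 1 + (x - B.μ) ^ 2 ≤ K₂ := by
        rcases B.sq_mem_of_mem_withDefects hx with hx | ⟨-, hx⟩
        · have := Finset.single_le_sum (f := fun z => (z - B.μ) ^ 2)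
            (fun z _ => sq_nonneg (z - B.μ)) hx
          have := sq_nonneg B.radius
          linarith
        · have := Finset.sum_nonneg fun z (_ : z ∈ lam) => sq_nonneg (z - B.μ)
          linarith
      have h2 : 1 ≤ Real.exp (γ * (4 * q + 3)) * Real.exp (-γ * ((2 * n + 1 : ℕ) : ℝ)) := by
        rw [← Real.exp_add]
        apply Real.one_le_exp
        have : (n : ℝ) ≤ 2 * q := by exact_mod_cast Nat.le_of_lt_succ hn
        push_cast
        nlinarith
      have h3 : 0 ≤ K₁ * Real.exp (γ * (4 * q + 5)) * Real.exp (-γ * ((2 * n + 1 : ℕ) : ℝ)) := by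
        positivity
      nlinarith
  -- `k` is the largest degree for which `(1 + ξ²) a(ξ²)`, of degree `4 (k + q) + 2`, is admissible
  · set k := (n - 1) / 2 - q with hk
    have hk1 : 4 * (k + q) + 2 ≤ 2 * n := by omega
    have hk2 : n ≤ 2 * k + 2 * q + 2 := by omega
    set a := dampingPoly B lam k
    have ha : IsDamping a (matsubara β) := isDamping_dampingPoly B lam k (matsubara_nonneg β) hpos
    have hdeg : a.natDegree ≤ 2 * (k + q) := natDegree_dampingPoly_le B lam k
    obtain ⟨P, hP, hfP⟩ := happ a ha
    refine ⟨(A + P).comp (X - C B.μ),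
      (1 + (X - C B.μ) ^ 2) * (C (a.eval (-matsubara β))⁻¹ * a.comp ((X - C B.μ) ^ 2)), ?_,
      Or.inl ?_, fun x => ?_, fun x hx => ?_⟩
    · refine natDegree_comp_le.trans ?_
      rw [natDegree_X_sub_C, mul_one]
      refine (natDegree_add_le _ _).trans (max_le ?_ ?_) <;> omega
    · have h1 : ((X - C B.μ) ^ 2 : ℝ[X]).natDegree ≤ 2 := by compute_degree
      have h2 : (1 + (X - C B.μ) ^ 2 : ℝ[X]).natDegree ≤ 2 := by compute_degree
      have h3 : (a.comp ((X - C B.μ) ^ 2)).natDegree ≤ a.natDegree * 2 :=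
        natDegree_comp_le.trans (Nat.mul_le_mul_left _ h1)
      have h4 : (C (a.eval (-matsubara β))⁻¹ * a.comp ((X - C B.μ) ^ 2)).natDegree ≤ _ :=
        natDegree_C_mul_le _ _
      refine natDegree_mul_le.trans ?_
      omega
    · rw [hOf]
      simp only [eval_comp, eval_add, eval_mul, eval_sub, eval_X, eval_C, eval_one, eval_pow,
        add_sub_add_left_eq_sub]
      refine (hfP (x - B.μ)).trans ?_
      have h1 : 0 ≤ a.eval ((x - B.μ) ^ 2) / a.eval (-matsubara β) :=
        div_nonneg (ha.nonneg _) ha.pos.le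
      rw [mul_comm, inv_mul_eq_div]
      exact mul_le_mul_of_nonneg_right (hf _) h1
    · simp only [eval_comp, eval_add, eval_mul, eval_sub, eval_X, eval_C, eval_one, eval_pow]
      rw [inv_mul_eq_div]
      refine (hdamp k x hx).trans ?_
      have h2 : Real.exp (-(4 * γ) * k) ≤
          Real.exp (γ * (4 * q + 5)) * Real.exp (-γ * ((2 * n + 1 : ℕ) : ℝ)) := by
        rw [← Real.exp_add]
        apply Real.exp_le_exp.2
        have : (n : ℝ) ≤ 2 * k + 2 * q + 2 := by exact_mod_cast hk2
        push_cast
        nlinarith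
      have h3 : 0 ≤ K₂ * Real.exp (γ * (4 * q + 3)) * Real.exp (-γ * ((2 * n + 1 : ℕ) : ℝ)) := by
        positivity
      calc K₁ * Real.exp (-(4 * γ) * k)
          ≤ K₁ * (Real.exp (γ * (4 * q + 5)) * Real.exp (-γ * ((2 * n + 1 : ℕ) : ℝ))) := by gcongr
        _ ≤ _ := by linarith

/-- The rate is proportional to the sum of the gap and the temperature. -/
theorem decayRate_comparable (b : ℝ) {a μ : ℝ} (ha : a < μ) :
    ∃ c₁ > 0, ∃ c₂ > 0, ∃ ε > 0, ∀ (B : Bands) (β : ℝ≥0∞),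
      B.minLower = a → B.maxUpper = b → B.μ = μ → B.Symmetric → 0 < β →
      0 < B.gap + β⁻¹.toReal → B.gap + β⁻¹.toReal < ε →
      c₁ * (B.gap + β⁻¹.toReal) ≤ decayRate B β ∧
        decayRate B β ≤ c₂ * (B.gap + β⁻¹.toReal) := by
  set r := 1 + max (μ - a) (b - μ) with hr
  have hr1 : 1 ≤ r := by
    have := (sub_pos.2 ha).le.trans (le_max_left (μ - a) (b - μ))
    linarith
  have hr0 : 0 < r := by linarith
  refine ⟨1 / (8 * r), by positivity, 1 / (4 * r), by positivity, 1, one_pos, ?_⟩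
  intro B β h1 h2 h3 hsymm _ _ hlt
  have hrad : B.radius = r := by rw [Bands.radius, h1, h2, h3]
  have hs : B.μ - B.maxLower = B.minUpper - B.μ := hsymm
  have hgap : B.gap = 2 * B.dist := by
    rw [Bands.gap, Bands.dist, ← hs, min_self]
    linarith
  have hd := B.dist_nonneg
  have ht : 0 ≤ β⁻¹.toReal := ENNReal.toReal_nonneg
  have hle : (B.dist + β⁻¹.toReal) / (2 * r) ≤ 1 := by
    rw [div_le_one (by positivity)]
    linarith
  rw [decayRate, hrad, min_eq_right hle, hgap]
  constructor
  · rw [div_mul_eq_mul_div, div_div, div_le_div_iff₀ (by positivity) (by positivity)]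
    nlinarith
  · rw [div_mul_eq_mul_div, div_div, div_le_div_iff₀ (by positivity) (by positivity)]
    nlinarith

end Approximation

/-! ### The local density of states of the Hamiltonian -/

section LocalDensity

open Polynomial

section FunctionalCalculus

variable {E : Type*} [NormedAddCommGroup E] [InnerProductSpace ℂ E] [CompleteSpace E]
  {A : E →L[ℂ] E}

theorem isSelfAdjoint_aeval (hA : IsSelfAdjoint A) (R : ℝ[X]) : IsSelfAdjoint (aeval A R) := by
  rw [← cfc_polynomial R A hA]
  exact cfc_predicate _ A

theorem norm_aeval_le (hA : IsSelfAdjoint A) {W : ℝ[X]} {c : ℝ} (hc : 0 ≤ c)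
    (hW : ∀ x ∈ spectrum ℝ A, |W.eval x| ≤ c) : ‖aeval A W‖ ≤ c := by
  rw [← cfc_polynomial W A hA]
  exact norm_cfc_le hc hW

theorem norm_opFunction_sub_aeval_le (hA : IsSelfAdjoint A) {O : ℝ → ℝ}
    (hO : ContinuousOn O (spectrum ℝ A)) {P : ℝ[X]} {c : ℝ} (hc : 0 ≤ c)
    (hP : ∀ x ∈ spectrum ℝ A, |O x - P.eval x| ≤ c) : ‖opFunction O A - aeval A P‖ ≤ c := by
  rw [opFunction, ← cfc_polynomial P A hA,
    ← cfc_sub O (fun x => P.eval x) A hO P.continuous.continuousOn]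
  exact norm_cfc_le hc hP

end FunctionalCalculus

variable {Λ : Type uSite} {Nb : ℕ}

open Classical in
theorem opEntry_eq_inner (A : StateSpace Λ Nb →L[ℂ] StateSpace Λ Nb) (i j : Λ × Fin Nb) :
    opEntry A i j = inner ℂ (lp.single 2 i (1 : ℂ) : StateSpace Λ Nb) (A (lp.single 2 j (1 : ℂ))) := by
  rw [lp.inner_single_left]
  simp [opEntry]

theorem eq_of_opEntry_eq {A B : StateSpace Λ Nb →L[ℂ] StateSpace Λ Nb}
    (h : ∀ i j, opEntry A i j = opEntry B i j) : A = B := by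
  classical
  have h1 : ∀ j, A (lp.single 2 j (1 : ℂ)) = B (lp.single 2 j (1 : ℂ)) := by
    intro j
    ext i
    have := h i j
    rw [opEntry, opEntry] at this
    convert! this
  ext1 f
  have hf := lp.hasSum_single (by norm_num : (2 : ℝ≥0∞) ≠ ⊤) f
  refine (hf.mapL A).unique ?_
  convert! hf.mapL B using 2 with j
  have h2 : (lp.single 2 j (f j) : StateSpace Λ Nb) = f j • lp.single 2 j (1 : ℂ) := by
    rw [← lp.single_smul, smul_eq_mul, mul_one]
  rw [h2, map_smul, map_smul, h1]

theorem isSelfAdjoint_of_opEntry {A : StateSpace Λ Nb →L[ℂ] StateSpace Λ Nb}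
    (h : ∀ i j, opEntry A i j = starRingEnd ℂ (opEntry A j i)) : IsSelfAdjoint A := by
  rw [ContinuousLinearMap.isSelfAdjoint_iff']
  refine eq_of_opEntry_eq fun i j => ?_
  rw [opEntry_eq_inner, ContinuousLinearMap.adjoint_inner_right, h, opEntry_eq_inner,
    inner_conj_symm]

theorem isSelfAdjoint_hamiltonian {d : ℕ} {S : Type uSpecies} [Countable Λ]
    {M : TBFunctions d Nb S} {u : Configuration d Λ S} (hu : u.Admissible)
    (hM : IsTightBinding M u) : IsSelfAdjoint (hamiltonian M u) := by
  refine isSelfAdjoint_of_opEntry fun i j => ?_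
  rw [opEntry_hamiltonian M u hu hM, opEntry_hamiltonian M u hu hM, Complex.conj_ofReal,
    TBFunctions.block_symm hM]

theorem norm_opEntry_le (A : StateSpace Λ Nb →L[ℂ] StateSpace Λ Nb) (i j : Λ × Fin Nb) :
    ‖opEntry A i j‖ ≤ ‖A‖ := by
  classical
  refine (lp.norm_apply_le_norm (by norm_num) _ i).trans ?_
  refine (A.le_opNorm _).trans ?_
  rw [lp.norm_single (by norm_num), norm_one, mul_one]

theorem abs_siteTrace_le (A : StateSpace Λ Nb →L[ℂ] StateSpace Λ Nb) (l : Λ) :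
    |siteTrace A l| ≤ Nb * ‖A‖ := by
  refine (Finset.abs_sum_le_sum_abs _ _).trans ?_
  refine (Finset.sum_le_sum fun a _ => (Complex.abs_re_le_norm _).trans
    (norm_opEntry_le A (l, a) (l, a))).trans ?_
  simp

theorem siteTrace_sub (A B : StateSpace Λ Nb →L[ℂ] StateSpace Λ Nb) (l : Λ) :
    siteTrace (A - B) l = siteTrace A l - siteTrace B l := by
  simp [siteTrace, opEntry]

theorem siteTrace_one (l : Λ) : siteTrace (1 : StateSpace Λ Nb →L[ℂ] StateSpace Λ Nb) l = Nb := by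
  simp [siteTrace, opEntry]

theorem siteTrace_sq_nonneg {A : StateSpace Λ Nb →L[ℂ] StateSpace Λ Nb} (hA : IsSelfAdjoint A)
    (l : Λ) : 0 ≤ siteTrace (A ^ 2) l := by
  classical
  refine Finset.sum_nonneg fun a _ => ?_
  rw [opEntry_eq_inner, sq, mul_apply_eq_comp,
    ← ContinuousLinearMap.adjoint_inner_left, (ContinuousLinearMap.isSelfAdjoint_iff'.1 hA)]
  exact inner_self_nonneg (𝕜 := ℂ)

/-- Integration of polynomials against the local density of states at `l`, normalised to mass one. -/
noncomputable def ldosFunctional (A : StateSpace Λ Nb →L[ℂ] StateSpace Λ Nb) (l : Λ) :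
    ℝ[X] →ₗ[ℝ] ℝ where
  toFun R := siteTrace (aeval A R) l / Nb
  map_add' R S := by simp [siteTrace, opEntry, Finset.sum_add_distrib, add_div]
  map_smul' c R := by simp [siteTrace, opEntry, ← Finset.mul_sum, mul_div_assoc]

theorem ldosFunctional_apply (A : StateSpace Λ Nb →L[ℂ] StateSpace Λ Nb) (l : Λ) (R : ℝ[X]) :
    ldosFunctional A l R = siteTrace (aeval A R) l / Nb := rfl

variable {A : StateSpace Λ Nb →L[ℂ] StateSpace Λ Nb}

theorem ldosFunctional_one (hNb : 0 < Nb) (l : Λ) : ldosFunctional A l 1 = 1 := by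
  have : (Nb : ℝ) ≠ 0 := by exact_mod_cast hNb.ne'
  rw [ldosFunctional_apply, map_one, siteTrace_one, div_self this]

theorem ldosFunctional_sq_nonneg (hA : IsSelfAdjoint A) (l : Λ) (R : ℝ[X]) :
    0 ≤ ldosFunctional A l (R ^ 2) := by
  rw [ldosFunctional_apply, map_pow]
  exact div_nonneg (siteTrace_sq_nonneg (isSelfAdjoint_aeval hA R) l) (Nat.cast_nonneg _)

theorem ldosFunctional_le (hA : IsSelfAdjoint A) (l : Λ) {W : ℝ[X]} {c : ℝ} (hc : 0 ≤ c)
    (hW : ∀ x ∈ spectrum ℝ A, |W.eval x| ≤ c) : ldosFunctional A l W ≤ c := by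
  rw [ldosFunctional_apply]
  refine div_le_of_le_mul₀ (Nat.cast_nonneg _) hc ?_
  refine (le_abs_self _).trans ((abs_siteTrace_le _ l).trans ?_)
  rw [mul_comm]
  gcongr
  exact norm_aeval_le hA hc hW

theorem abs_siteTrace_cfc_sub_le (hNb : 0 < Nb) (hA : IsSelfAdjoint A) (l : Λ) {O : ℝ → ℝ}
    (hO : ContinuousOn O (spectrum ℝ A)) {P : ℝ[X]} {c : ℝ} (hc : 0 ≤ c)
    (hP : ∀ x ∈ spectrum ℝ A, |O x - P.eval x| ≤ c) :
    |siteTrace (opFunction O A) l - Nb * ldosFunctional A l P| ≤ Nb * c := by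
  have hNb' : (Nb : ℝ) ≠ 0 := by exact_mod_cast hNb.ne'
  rw [ldosFunctional_apply, mul_div_cancel₀ _ hNb', ← siteTrace_sub]
  refine (abs_siteTrace_le _ l).trans ?_
  gcongr
  exact norm_opFunction_sub_aeval_le hA hO hc hP

theorem spectrum_subset_withDefects {B : Bands} {lam : Finset ℝ}
    (hσ : spectrum ℂ A ⊆ (fun x : ℝ => (x : ℂ)) '' B.withDefects lam) :
    spectrum ℝ A ⊆ B.withDefects lam := by
  intro x hx
  obtain ⟨y, hy, hxy⟩ := hσ (spectrum.algebraMap_mem ℂ hx)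
  obtain rfl : y = x := Complex.ofReal_injective hxy
  exact hy

end LocalDensity

/-! ### The error estimate -/

section ErrorEstimate

open Polynomial

/-- At zero temperature the chemical potential is not in the spectrum, so that the observables, which
are not smooth there, are continuous on it. -/
theorem notMem_withDefects {B : Bands} {lam : Finset ℝ} (hB : B.Insulating)
    (hgap : 0 < B.defectGap lam) : B.μ ∉ B.withDefects lam := by
  rintro ((⟨-, h⟩ | h) | ⟨h, -⟩)
  · exact absurd hB.1 h.not_gt
  · have := matsubara_add_sq_pos (β := ⊤) (by simp) (fun _ => hgap) B.μ h
    simp [matsubara] at this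
  · exact absurd hB.2 h.not_gt

theorem fermiDirac_lt_one {β : ℝ≥0∞} (h : β ≠ ⊤) (μ x : ℝ) : fermiDirac β μ x < 1 := by
  rw [fermiDirac, if_neg h]
  apply inv_lt_one_of_one_lt₀
  linarith [Real.exp_pos (β.toReal * (x - μ))]

theorem continuousOn_observable {β : ℝ≥0∞} {μ : ℝ} {O : ℝ → ℝ}
    (hO : O = fermiDirac β μ ∨ O = grandPotential β μ) {s : Set ℝ} (hs : β = ⊤ → μ ∉ s) :
    ContinuousOn O s := by
  by_cases htop : β = ⊤
  · have hμ := hs htop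
    intro x hx
    refine ContinuousAt.continuousWithinAt ?_
    have hne : x ≠ μ := fun h => hμ (h ▸ hx)
    rcases hne.lt_or_gt with h | h
    · have hev : ∀ᶠ y in 𝓝 x, y < μ := eventually_lt_nhds h
      rcases hO with rfl | rfl
      · refine (continuousAt_const (y := (1 : ℝ))).congr (hev.mono fun y hy => ?_)
        simp [fermiDirac, htop, hy]
      · have hc : ContinuousAt (fun y : ℝ => 2 * (y - μ)) x := by fun_prop
        refine hc.congr (hev.mono fun y hy => ?_)
        simp [grandPotential, htop, hy]
    · have hev : ∀ᶠ y in 𝓝 x, μ < y := eventually_gt_nhds h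
      rcases hO with rfl | rfl
      · refine (continuousAt_const (y := (0 : ℝ))).congr (hev.mono fun y hy => ?_)
        simp [fermiDirac, htop, hy.not_gt, hy.ne']
      · refine (continuousAt_const (y := (0 : ℝ))).congr (hev.mono fun y hy => ?_)
        simp [grandPotential, htop, hy.not_gt]
  · have hF : Continuous (fermiDirac β μ) := by
      have : fermiDirac β μ = fun x => (1 + Real.exp (β.toReal * (x - μ)))⁻¹ := by
        funext x
        simp [fermiDirac, htop]
      rw [this]
      refine Continuous.inv₀ (by fun_prop) fun x => ?_
      positivity
    rcases hO with rfl | rfl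
    · exact hF.continuousOn
    · have hG : grandPotential β μ =
          fun x => 2 / β.toReal * Real.log (1 - fermiDirac β μ x) := by
        funext x
        simp [grandPotential, htop]
      rw [hG]
      refine (Continuous.mul continuous_const (Continuous.log (by fun_prop) fun x => ?_)).continuousOn
      linarith [fermiDirac_lt_one htop μ x]

theorem abs_bopTheta_sub_le {n : ℕ} (x : Fin (2 * n + 1) → ℝ) {O P W : ℝ → ℝ}
    (h : ∀ y, |O y - P y| ≤ W y) : |bopTheta O n x - bopTheta P n x| ≤ bopTheta W n x := by
  rw [bopTheta, bopTheta, bopTheta, ← Finset.sum_sub_distrib]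
  refine (Finset.abs_sum_le_sum_abs _ _).trans (Finset.sum_le_sum fun s _ => ?_)
  rw [← sub_mul, abs_mul, abs_sq]
  exact mul_le_mul_of_nonneg_right (h _) (sq_nonneg _)

/-- For `n ≥ 1` the quadrature rule is exact on parabolas, and for `n = 0` this is Jensen's
inequality. -/
theorem bopTheta_parabola_le {n : ℕ} {x : Fin (2 * n + 1) → ℝ} {φ : ℝ[X] →ₗ[ℝ] ℝ}
    (hφ1 : φ 1 = 1) (hpos : ∀ R : ℝ[X], 0 ≤ φ (R ^ 2))
    (hx : ∀ j : Fin (2 * n + 1), x j = φ (X ^ (j.val + 1))) (μ : ℝ) :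
    bopTheta (fun y => (1 + (X - C μ) ^ 2 : ℝ[X]).eval y) n x ≤ φ (1 + (X - C μ) ^ 2) := by
  rcases Nat.eq_zero_or_pos n with rfl | hn
  · have h1 := bopTheta_eval_eq hφ1 hpos hx (R := 1) (by simp)
    have h2 := bopTheta_eval_eq hφ1 hpos hx (R := X - C μ) (by simp)
    simp only [bopTheta, Fin.sum_univ_succ, Finset.univ_eq_empty, Finset.sum_empty, add_zero,
      eval_one, one_mul, eval_sub, eval_X, eval_C, eval_add, eval_pow] at h1 h2 ⊢
    rw [hφ1] at h1
    rw [h1, mul_one] at h2 ⊢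
    have h3 := hpos (X - C μ - C (φ (X - C μ)))
    have h4 : (X - C μ - C (φ (X - C μ))) ^ 2 = (X - C μ) ^ 2 - (2 * φ (X - C μ)) • (X - C μ)
        + (φ (X - C μ) ^ 2) • (1 : ℝ[X]) := by
      simp only [smul_eq_C_mul, C_mul, C_pow, C_ofNat]
      ring
    rw [h4, map_add, map_sub, map_smul, map_smul, hφ1, smul_eq_mul, smul_eq_mul] at h3
    rw [map_add, hφ1, h2]
    nlinarith
  · refine (bopTheta_eval_eq hφ1 hpos hx ?_).le
    have : (1 + (X - C μ) ^ 2 : ℝ[X]).natDegree ≤ 2 := by compute_degree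
    omega

/-- The polynomials `P` and `W` of `observable_approx` bound the error twice by the integral of `W`, once
for the local density of states and once for the quadrature rule; the latter integral is at most the
former. -/
theorem localObservable_error {d Nb : ℕ} {Λ : Type uSite} {S : Type uSpecies} [Countable Λ]
    (M : TBFunctions d Nb S) (u : Configuration d Λ S) (hNb : 0 < Nb) (hu : u.Admissible)
    (hM : IsTightBinding M u) (B : Bands) (lam : Finset ℝ) (β : ℝ≥0∞) (O : ℝ → ℝ) (hβ : 0 < β)
    (hσ : spectrum ℂ (hamiltonian M u) ⊆ (fun x : ℝ => (x : ℂ)) '' B.withDefects lam)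
    (hB : β = ⊤ → B.Insulating ∧ 0 < B.defectGap lam)
    (hO : O = fermiDirac β B.μ ∨ O = grandPotential β B.μ) :
    ∃ K > 0, ∀ (l : Λ) (n : ℕ),
      |localObservable M u O l - Nb * bopTheta O n (ldosMoments M u l (2 * n + 1))|
        ≤ K * Real.exp (-decayRate B β * ((2 * n + 1 : ℕ) : ℝ)) := by
  obtain ⟨K, hK, happ⟩ := observable_approx hβ (fun h => (hB h).2) hO
  have hNb' : (0 : ℝ) < Nb := by exact_mod_cast hNb
  refine ⟨2 * Nb * K, by positivity, fun l n => ?_⟩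
  obtain ⟨P, W, hP, hW, hOP, hsmall⟩ := happ n
  set H := hamiltonian M u
  have hH : IsSelfAdjoint H := isSelfAdjoint_hamiltonian hu hM
  have hσ' := spectrum_subset_withDefects hσ
  set ε := K * Real.exp (-decayRate B β * ((2 * n + 1 : ℕ) : ℝ)) with hε
  have hε0 : 0 ≤ ε := by positivity
  set φ := ldosFunctional H l
  have hφ1 : φ 1 = 1 := ldosFunctional_one hNb l
  have hpos : ∀ R : ℝ[X], 0 ≤ φ (R ^ 2) := ldosFunctional_sq_nonneg hH l
  set x := ldosMoments M u l (2 * n + 1)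
  have hx : ∀ j : Fin (2 * n + 1), x j = φ (X ^ (j.val + 1)) := fun j => by
    rw [ldosFunctional_apply, map_pow, aeval_X]
    rfl
  have hcont : ContinuousOn O (spectrum ℝ H) := continuousOn_observable hO fun h hμ =>
    notMem_withDefects (hB h).1 (hB h).2 (hσ' hμ)
  have h1 : |localObservable M u O l - Nb * φ P| ≤ Nb * ε :=
    abs_siteTrace_cfc_sub_le hNb hH l hcont hε0 fun y hy =>
      (hOP y).trans (hsmall y (hσ' hy))
  have h2 : φ W ≤ ε := ldosFunctional_le hH l hε0 fun y hy => by
    rw [abs_of_nonneg ((abs_nonneg _).trans (hOP y))]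
    exact hsmall y (hσ' hy)
  have h3 : bopTheta (fun y => W.eval y) n x ≤ φ W := by
    rcases hW with hW | rfl
    · exact (bopTheta_eval_eq hφ1 hpos hx hW).le
    · exact bopTheta_parabola_le hφ1 hpos hx B.μ
  have h4 := abs_bopTheta_sub_le x hOP
  rw [bopTheta_eval_eq hφ1 hpos hx hP] at h4
  have h5 : |φ P - bopTheta O n x| ≤ ε := by
    rw [abs_sub_comm]
    exact h4.trans (h3.trans h2)
  calc |localObservable M u O l - Nb * bopTheta O n x|
      = |(localObservable M u O l - Nb * φ P) + Nb * (φ P - bopTheta O n x)| := by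
        congr 1
        ring
    _ ≤ Nb * ε + Nb * ε := by
        refine (abs_add_le _ _).trans (add_le_add h1 ?_)
        rw [abs_mul, abs_of_pos hNb']
        gcongr
    _ = 2 * Nb * K * Real.exp (-decayRate B β * ((2 * n + 1 : ℕ) : ℝ)) := by
        rw [hε]
        ring

end ErrorEstimate

/-! ### Gluing local analytic extensions of a function of real variables -/

section Gluing

/-- The inclusion of `ℝ^N` in `ℂ^N`. -/
def toComplex {N : ℕ} (x : Fin N → ℝ) : Fin N → ℂ := fun j => (x j : ℂ)

theorem continuous_toComplex {N : ℕ} : Continuous (toComplex (N := N)) := by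
  unfold toComplex
  fun_prop

theorem dist_toComplex {N : ℕ} (x y : Fin N → ℝ) :
    dist (toComplex x) (toComplex y) = dist x y := by
  simp only [dist_pi_def, toComplex]
  congr 2
  funext j
  ext
  simp [Complex.dist_of_im_eq, Real.dist_eq]

/-- Two analytic functions on balls with real centres agree at a common point if they agree at the
common real points: the complex line through the real and the imaginary part of the point meets the
intersection of the balls in a convex set that contains a real interval. -/
theorem eq_of_eqOn_real {N : ℕ} {f g : (Fin N → ℂ) → ℂ} {x₁ x₂ : Fin N → ℝ} {r₁ r₂ : ℝ}
    (hf : AnalyticOnNhd ℂ f (Metric.ball (toComplex x₁) r₁))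
    (hg : AnalyticOnNhd ℂ g (Metric.ball (toComplex x₂) r₂))
    (h : ∀ x ∈ Metric.ball x₁ r₁ ∩ Metric.ball x₂ r₂, f (toComplex x) = g (toComplex x))
    {z : Fin N → ℂ} (hz : z ∈ Metric.ball (toComplex x₁) r₁ ∩ Metric.ball (toComplex x₂) r₂) :
    f z = g z := by
  set C := Metric.ball (toComplex x₁) r₁ ∩ Metric.ball (toComplex x₂) r₂ with hC
  -- the line `ζ ↦ a + ζ b` has real values for real `ζ` and passes through `z` at `ζ = i`
  set a : Fin N → ℝ := fun j => (z j).re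
  set b : Fin N → ℝ := fun j => (z j).im
  set line : ℂ → Fin N → ℂ := fun ζ => toComplex a + ζ • toComplex b with hline
  have hlineI : line Complex.I = z := by
    funext j
    simp only [hline, toComplex, Pi.add_apply, Pi.smul_apply, smul_eq_mul, a, b]
    rw [mul_comm]
    exact Complex.re_add_im (z j)
  have hlineR : ∀ t : ℝ, line t = toComplex (a + t • b) := fun t => by
    funext j
    simp [hline, toComplex]
  have hcont : Continuous line := by fun_prop
  have hana : ∀ ζ, AnalyticAt ℂ line ζ := fun ζ => by
    rw [hline]
    exact analyticAt_const.add (analyticAt_id.smul analyticAt_const)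
  have hconv : Convex ℝ (line ⁻¹' C) := by
    have hCc : Convex ℝ C := (convex_ball _ _).inter (convex_ball _ _)
    intro ζ₁ h₁ ζ₂ h₂ s t hs ht hst
    have h3 : line (s • ζ₁ + t • ζ₂) = s • line ζ₁ + t • line ζ₂ := by
      have : (s : ℂ) + t = 1 := by exact_mod_cast hst
      funext j
      simp only [hline, Pi.add_apply, Pi.smul_apply, smul_eq_mul, Complex.real_smul]
      linear_combination (-(toComplex a j)) * this
    rw [Set.mem_preimage, h3]
    exact hCc h₁ h₂ hs ht hst
  have hopen : IsOpen (line ⁻¹' C) :=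
    (Metric.isOpen_ball.inter Metric.isOpen_ball).preimage hcont
  have hre : ∀ y : Fin N → ℝ, dist a y ≤ dist z (toComplex y) := fun y => by
    rw [dist_pi_le_iff dist_nonneg]
    intro j
    refine le_trans ?_ (dist_le_pi_dist z (toComplex y) j)
    rw [Real.dist_eq, Complex.dist_eq]
    simpa [toComplex] using Complex.abs_re_le_norm (z j - toComplex y j)
  have h0 : (0 : ℂ) ∈ line ⁻¹' C := by
    have h1 : line 0 = toComplex a := by simp [hline]
    rw [Set.mem_preimage, h1]
    refine ⟨?_, ?_⟩
    · rw [Metric.mem_ball, dist_toComplex]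
      exact (hre x₁).trans_lt hz.1
    · rw [Metric.mem_ball, dist_toComplex]
      exact (hre x₂).trans_lt hz.2
  have hI : Complex.I ∈ line ⁻¹' C := by rwa [Set.mem_preimage, hlineI]
  have hfreq : ∃ᶠ ζ in 𝓝[≠] (0 : ℂ), f (line ζ) = g (line ζ) := by
    have hev : ∀ᶠ t : ℝ in 𝓝[≠] 0, f (line t) = g (line t) := by
      have h1 : ∀ᶠ t : ℝ in 𝓝 0, (t : ℂ) ∈ line ⁻¹' C :=
        Complex.continuous_ofReal.continuousAt.eventually_mem
          (hopen.mem_nhds (by simpa using h0))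
      refine (h1.filter_mono nhdsWithin_le_nhds).mono fun t ht => ?_
      rw [Set.mem_preimage, hlineR] at ht
      rw [hlineR]
      refine h _ ⟨?_, ?_⟩
      · have := ht.1
        rwa [Metric.mem_ball, dist_toComplex] at this
      · have := ht.2
        rwa [Metric.mem_ball, dist_toComplex] at this
    have hmap : Tendsto (fun t : ℝ => (t : ℂ)) (𝓝[≠] 0) (𝓝[≠] 0) := by
      refine tendsto_nhdsWithin_iff.2 ⟨?_, ?_⟩
      · exact (Complex.continuous_ofReal.tendsto' 0 0 (by simp)).mono_left nhdsWithin_le_nhds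
      · filter_upwards [self_mem_nhdsWithin] with t ht
        simpa using ht
    exact hmap.frequently hev.frequently
  have hfl : AnalyticOnNhd ℂ (fun ζ => f (line ζ)) (line ⁻¹' C) := fun ζ hζ =>
    (hf _ hζ.1).comp (hana ζ)
  have hgl : AnalyticOnNhd ℂ (fun ζ => g (line ζ)) (line ⁻¹' C) := fun ζ hζ =>
    (hg _ hζ.2).comp (hana ζ)
  have := hfl.eqOn_of_preconnected_of_frequently_eq hgl hconv.isPreconnected h0 hfreq hI
  simpa only [hlineI] using this

/-- A function of real variables that extends analytically near each point of `G` extends analytically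
to one neighbourhood of `G`: on balls with real centres the local extensions agree by
`eq_of_eqOn_real`. -/
theorem exists_analytic_extension {N : ℕ} (G : Set (Fin N → ℝ)) (θ : (Fin N → ℝ) → ℂ)
    (h : ∀ x₀ ∈ G, ∃ f : (Fin N → ℂ) → ℂ, AnalyticAt ℂ f (toComplex x₀) ∧
      ∀ᶠ x in 𝓝 x₀, f (toComplex x) = θ x) :
    ∃ (U : Set (Fin N → ℂ)) (F : (Fin N → ℂ) → ℂ), IsOpen U ∧ AnalyticOnNhd ℂ F U ∧
      ∀ x ∈ G, toComplex x ∈ U ∧ F (toComplex x) = θ x := by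
  have h' : ∀ x₀ : G, ∃ (f : (Fin N → ℂ) → ℂ) (r : ℝ), 0 < r ∧
      AnalyticOnNhd ℂ f (Metric.ball (toComplex x₀.1) r) ∧
      ∀ x ∈ Metric.ball x₀.1 r, f (toComplex x) = θ x := by
    rintro ⟨x₀, hx₀⟩
    obtain ⟨f, hf, hfθ⟩ := h x₀ hx₀
    obtain ⟨r₁, hr₁, h1⟩ := hf.exists_ball_analyticOnNhd
    obtain ⟨r₂, hr₂, h2⟩ := Metric.eventually_nhds_iff_ball.1 hfθ
    exact ⟨f, min r₁ r₂, lt_min hr₁ hr₂, h1.mono (Metric.ball_subset_ball (min_le_left _ _)),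
      fun x hx => h2 x (Metric.ball_subset_ball (min_le_right _ _) hx)⟩
  choose f r hr hana hval using h'
  classical
  set F : (Fin N → ℂ) → ℂ := fun z =>
    if hz : ∃ x₀ : G, z ∈ Metric.ball (toComplex x₀.1) (r x₀) then f hz.choose z else 0 with hF
  have hFf : ∀ (x₀ : G), ∀ z ∈ Metric.ball (toComplex x₀.1) (r x₀), F z = f x₀ z := by
    intro x₀ z hz
    have hex : ∃ x₀ : G, z ∈ Metric.ball (toComplex x₀.1) (r x₀) := ⟨x₀, hz⟩
    simp only [hF, dif_pos hex]
    exact eq_of_eqOn_real (hana _) (hana _)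
      (fun x hx => (hval _ x hx.1).trans (hval _ x hx.2).symm) ⟨hex.choose_spec, hz⟩
  refine ⟨⋃ x₀ : G, Metric.ball (toComplex x₀.1) (r x₀), F,
    isOpen_iUnion fun _ => Metric.isOpen_ball, fun z hz => ?_, fun x hx => ?_⟩
  · obtain ⟨x₀, hx₀⟩ := Set.mem_iUnion.1 hz
    refine (hana x₀ z hx₀).congr ?_
    filter_upwards [Metric.isOpen_ball.mem_nhds hx₀] with w hw using (hFf x₀ w hw).symm
  · have hmem : toComplex x ∈ Metric.ball (toComplex x) (r ⟨x, hx⟩) :=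
      Metric.mem_ball_self (hr _)
    refine ⟨Set.mem_iUnion.2 ⟨⟨x, hx⟩, hmem⟩, ?_⟩
    rw [hFf ⟨x, hx⟩ _ hmem]
    exact hval ⟨x, hx⟩ x (Metric.mem_ball_self (hr _))

end Gluing

/-! ### Polynomials depending analytically on parameters -/

section PolynomialFamilies

open Polynomial

variable {E : Type*} [NormedAddCommGroup E] [NormedSpace ℂ E]

/-- A family of polynomials of bounded degree whose coefficients are analytic at `z₀`. -/
def PolyAnalyticAt (P : E → ℂ[X]) (z₀ : E) : Prop :=
  (∃ D, ∀ z, (P z).natDegree ≤ D) ∧ ∀ j, AnalyticAt ℂ (fun z => (P z).coeff j) z₀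

variable {P Q : E → ℂ[X]} {z₀ : E}

theorem PolyAnalyticAt.const (R : ℂ[X]) : PolyAnalyticAt (fun _ : E => R) z₀ :=
  ⟨⟨R.natDegree, fun _ => le_rfl⟩, fun _ => analyticAt_const⟩

theorem PolyAnalyticAt.C {f : E → ℂ} (hf : AnalyticAt ℂ f z₀) :
    PolyAnalyticAt (fun z => Polynomial.C (f z)) z₀ := by
  refine ⟨⟨0, fun z => (natDegree_C _).le⟩, fun j => ?_⟩
  rcases j with _ | j
  · simpa using hf
  · simpa [coeff_C] using analyticAt_const

theorem PolyAnalyticAt.sub (hP : PolyAnalyticAt P z₀) (hQ : PolyAnalyticAt Q z₀) :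
    PolyAnalyticAt (fun z => P z - Q z) z₀ := by
  obtain ⟨⟨D, hD⟩, hPa⟩ := hP
  obtain ⟨⟨D', hD'⟩, hQa⟩ := hQ
  refine ⟨⟨max D D', fun z => (natDegree_sub_le _ _).trans (max_le_max (hD z) (hD' z))⟩,
    fun j => ?_⟩
  simp only [coeff_sub]
  exact (hPa j).sub (hQa j)

theorem PolyAnalyticAt.mul (hP : PolyAnalyticAt P z₀) (hQ : PolyAnalyticAt Q z₀) :
    PolyAnalyticAt (fun z => P z * Q z) z₀ := by
  obtain ⟨⟨D, hD⟩, hPa⟩ := hP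
  obtain ⟨⟨D', hD'⟩, hQa⟩ := hQ
  refine ⟨⟨D + D', fun z => natDegree_mul_le.trans (add_le_add (hD z) (hD' z))⟩, fun j => ?_⟩
  simp only [coeff_mul]
  exact Finset.analyticAt_fun_sum _ fun i _ => (hPa i.1).mul (hQa i.2)

theorem PolyAnalyticAt.sq (hP : PolyAnalyticAt P z₀) : PolyAnalyticAt (fun z => P z ^ 2) z₀ := by
  simp only [pow_two]
  exact hP.mul hP

theorem PolyAnalyticAt.analyticAt_eval (hP : PolyAnalyticAt P z₀) (ζ₀ : ℂ) :
    AnalyticAt ℂ (fun w : E × ℂ => (P w.1).eval w.2) (z₀, ζ₀) := by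
  obtain ⟨⟨D, hD⟩, hPa⟩ := hP
  have h : (fun w : E × ℂ => (P w.1).eval w.2) =
      fun w => ∑ j ∈ Finset.range (D + 1), (P w.1).coeff j * w.2 ^ j := by
    funext w
    exact eval_eq_sum_range' (Nat.lt_succ_of_le (hD w.1)) w.2
  rw [h]
  refine Finset.analyticAt_fun_sum _ fun j _ => AnalyticAt.mul ?_ (analyticAt_snd.pow j)
  exact (hPa j).comp_of_eq analyticAt_fst rfl

theorem PolyAnalyticAt.eval (hP : PolyAnalyticAt P z₀) {f : E → ℂ} (hf : AnalyticAt ℂ f z₀) :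
    AnalyticAt ℂ (fun z => (P z).eval (f z)) z₀ :=
  (hP.analyticAt_eval (f z₀)).comp (f := fun z => (z, f z)) (analyticAt_id.prod hf)

/-- Simple zeros depend analytically on the parameters. -/
theorem PolyAnalyticAt.exists_root [CompleteSpace E] (hP : PolyAnalyticAt P z₀) {ζ₀ : ℂ}
    (h0 : (P z₀).eval ζ₀ = 0) (h1 : (P z₀).derivative.eval ζ₀ ≠ 0) :
    ∃ f : E → ℂ, AnalyticAt ℂ f z₀ ∧ f z₀ = ζ₀ ∧ ∀ᶠ z in 𝓝 z₀, (P z).eval (f z) = 0 := by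
  set Φ : E × ℂ → ℂ := fun w => (P w.1).eval w.2 with hΦ
  have hana : AnalyticAt ℂ Φ (z₀, ζ₀) := hP.analyticAt_eval ζ₀
  have hcd : ContDiffAt ℂ ⊤ Φ (z₀, ζ₀) := hana.contDiffAt
  have hinv : (fderiv ℂ Φ (z₀, ζ₀) ∘L .inr ℂ E ℂ).IsInvertible := by
    have h2 : HasFDerivAt (fun ζ => Φ (z₀, ζ)) (fderiv ℂ Φ (z₀, ζ₀) ∘L .inr ℂ E ℂ) ζ₀ :=
      hana.differentiableAt.hasFDerivAt.comp ζ₀ (hasFDerivAt_prodMk_right z₀ ζ₀)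
    have h3 := h2.hasDerivAt.unique ((P z₀).hasDerivAt ζ₀)
    set c := (P z₀).derivative.eval ζ₀
    refine ⟨ContinuousLinearEquiv.unitsEquivAut ℂ (Units.mk0 c h1), ?_⟩
    ext
    rw [h3]
    simp
  have hne : (⊤ : WithTop ℕ∞) ≠ 0 := by simp
  refine ⟨hcd.implicitFunction hne hinv, ?_, hcd.implicitFunction_apply_self hne hinv, ?_⟩
  · exact (hcd.contDiffAt_implicitFunction hne hinv).analyticAt
  · filter_upwards [hcd.eventually_apply_implicitFunction hne hinv] with z hz
    exact hz.trans h0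

end PolynomialFamilies

/-! ### The recursion for complex moments -/

section ComplexRecursion

open Polynomial

variable {N : ℕ}

/-- The sequence `1, z_0, …, z_{N-1}, 0, 0, …` of complex moments. -/
def complexMomentSeq (z : Fin N → ℂ) : ℕ → ℂ
  | 0 => 1
  | j + 1 => if hj : j < N then z ⟨j, hj⟩ else 0

/-- The functional on complex polynomials with moments `z`. -/
noncomputable def complexMomentIntegral (z : Fin N → ℂ) (Q : ℂ[X]) : ℂ :=
  Q.sum fun j c => c * complexMomentSeq z j

/-- The recursion of `recursionState` for complex moments, with the principal branch of the square
root. -/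
noncomputable def complexRecursionState (z : Fin N → ℂ) : ℕ → ℂ × ℂ[X] × ℂ[X]
  | 0 => (0, 0, 1)
  | k + 1 =>
    let b := (complexRecursionState z k).1
    let p' := (complexRecursionState z k).2.1
    let p := (complexRecursionState z k).2.2
    let q := (X - C (complexMomentIntegral z (X * p ^ 2))) * p - C b * p'
    let b' := complexMomentIntegral z (q ^ 2) ^ (1 / 2 : ℂ)
    (b', p, C b'⁻¹ * q)

/-- The complex counterpart of `orthoPoly`. -/
noncomputable def complexOrthoPoly (z : Fin N → ℂ) (k : ℕ) : ℂ[X] :=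
  (complexRecursionState z k).2.2

/-- The complex counterpart of `residualPoly`. -/
noncomputable def complexResidualPoly (z : Fin N → ℂ) (k : ℕ) : ℂ[X] :=
  (X - C (complexMomentIntegral z (X * complexOrthoPoly z k ^ 2))) * complexOrthoPoly z k
    - C (complexRecursionState z k).1 * (complexRecursionState z k).2.1

theorem complexRecursionState_succ (z : Fin N → ℂ) (k : ℕ) : complexRecursionState z (k + 1) =
    (complexMomentIntegral z (complexResidualPoly z k ^ 2) ^ (1 / 2 : ℂ), complexOrthoPoly z k,
      C (complexMomentIntegral z (complexResidualPoly z k ^ 2) ^ (1 / 2 : ℂ))⁻¹ *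
        complexResidualPoly z k) := rfl

theorem complexMomentIntegral_map (x : Fin N → ℝ) (Q : ℝ[X]) :
    complexMomentIntegral (toComplex x) (Q.map Complex.ofRealHom) = (momentIntegral x Q : ℂ) := by
  have h1 : ∀ j, complexMomentSeq (toComplex x) j = (momentSeq x j : ℂ) := by
    rintro (_ | j)
    · simp [complexMomentSeq, momentSeq]
    · simp only [complexMomentSeq, momentSeq, toComplex]
      split_ifs <;> simp
  rw [complexMomentIntegral, momentIntegral,
    sum_over_range' _ (by simp) (Q.natDegree + 1) (Nat.lt_succ_of_le natDegree_map_le),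
    sum_over_range' _ (by simp) (Q.natDegree + 1) (Nat.lt_succ_self _)]
  push_cast
  refine Finset.sum_congr rfl fun j _ => ?_
  rw [h1, coeff_map, Complex.ofRealHom_eq_coe]

theorem complexRecursionState_toComplex (x : Fin N → ℝ) {m : ℕ}
    (hreg : ∀ k, 1 ≤ k → k ≤ m → 0 < recB x k) :
    complexRecursionState (toComplex x) m = ((recB x m : ℂ),
        (prevPoly x m).map Complex.ofRealHom, (orthoPoly x m).map Complex.ofRealHom) ∧
      complexResidualPoly (toComplex x) m = (residualPoly x m).map Complex.ofRealHom := by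
  have hres : ∀ k, complexRecursionState (toComplex x) k = ((recB x k : ℂ),
      (prevPoly x k).map Complex.ofRealHom, (orthoPoly x k).map Complex.ofRealHom) →
      complexResidualPoly (toComplex x) k = (residualPoly x k).map Complex.ofRealHom := by
    intro k hk
    have h1 : X * (orthoPoly x k).map Complex.ofRealHom ^ 2 =
        (X * orthoPoly x k ^ 2).map Complex.ofRealHom := by simp
    rw [complexResidualPoly, complexOrthoPoly, hk, h1, complexMomentIntegral_map]
    simp [residualPoly, recA]
  induction m with
  | zero =>
    have h0 : complexRecursionState (toComplex x) 0 = ((recB x 0 : ℂ),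
        (prevPoly x 0).map Complex.ofRealHom, (orthoPoly x 0).map Complex.ofRealHom) := by
      simp [complexRecursionState]
    exact ⟨h0, hres 0 h0⟩
  | succ m ih =>
    obtain ⟨h1, h2⟩ := ih fun k hk1 hk2 => hreg k hk1 (by omega)
    have hb := hreg (m + 1) (by omega) le_rfl
    have hrad : complexMomentIntegral (toComplex x) (complexResidualPoly (toComplex x) m ^ 2) ^
        (1 / 2 : ℂ) = (recB x (m + 1) : ℂ) := by
      have h0 : 0 ≤ momentIntegral x (residualPoly x m ^ 2) := by
        rw [recB_succ] at hb
        exact (Real.sqrt_pos.1 hb).le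
      rw [h2, ← Polynomial.map_pow, complexMomentIntegral_map, recB_succ, Real.sqrt_eq_rpow,
        Complex.ofReal_cpow h0]
      norm_num
    have h3 : complexRecursionState (toComplex x) (m + 1) = ((recB x (m + 1) : ℂ),
        (prevPoly x (m + 1)).map Complex.ofRealHom,
        (orthoPoly x (m + 1)).map Complex.ofRealHom) := by
      rw [complexRecursionState_succ, hrad, complexOrthoPoly, h1, h2, orthoPoly_succ]
      simp
    exact ⟨h3, hres _ h3⟩

theorem PolyAnalyticAt.complexMomentIntegral {P : (Fin N → ℂ) → ℂ[X]} {z₀ : Fin N → ℂ}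
    (hP : PolyAnalyticAt P z₀) : AnalyticAt ℂ (fun z => complexMomentIntegral z (P z)) z₀ := by
  obtain ⟨⟨D, hD⟩, hPa⟩ := hP
  have h1 : (fun z => _root_.complexMomentIntegral z (P z)) =
      fun z => ∑ j ∈ Finset.range (D + 1), (P z).coeff j * complexMomentSeq z j := by
    funext z
    exact sum_over_range' _ (by simp) (D + 1) (Nat.lt_succ_of_le (hD z))
  rw [h1]
  refine Finset.analyticAt_fun_sum _ fun j _ => (hPa j).mul ?_
  rcases j with _ | j
  · exact analyticAt_const
  · simp only [complexMomentSeq]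
    split_ifs with hj
    · exact (ContinuousLinearMap.proj (R := ℂ) (φ := fun _ : Fin N => ℂ) ⟨j, hj⟩).analyticAt z₀
    · exact analyticAt_const

/-- The recursion depends analytically on the moments near real moments for which it is regular. -/
theorem polyAnalyticAt_recursion (x : Fin N → ℝ) {m : ℕ}
    (hreg : ∀ k, 1 ≤ k → k ≤ m → 0 < recB x k) :
    AnalyticAt ℂ (fun z => (complexRecursionState z m).1) (toComplex x) ∧
    PolyAnalyticAt (fun z => (complexRecursionState z m).2.1) (toComplex x) ∧
    PolyAnalyticAt (fun z => complexOrthoPoly z m) (toComplex x) ∧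
    PolyAnalyticAt (fun z => complexResidualPoly z m) (toComplex x) := by
  have hres : ∀ k, AnalyticAt ℂ (fun z => (complexRecursionState z k).1) (toComplex x) →
      PolyAnalyticAt (fun z => (complexRecursionState z k).2.1) (toComplex x) →
      PolyAnalyticAt (fun z => complexOrthoPoly z k) (toComplex x) →
      PolyAnalyticAt (fun z => complexResidualPoly z k) (toComplex x) := by
    intro k h1 h2 h3
    exact (((PolyAnalyticAt.const X).sub
      (PolyAnalyticAt.C ((PolyAnalyticAt.const X).mul h3.sq).complexMomentIntegral)).mul h3).sub
      ((PolyAnalyticAt.C h1).mul h2)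
  induction m with
  | zero =>
    have h1 : AnalyticAt ℂ (fun z : Fin N → ℂ => (complexRecursionState z 0).1) (toComplex x) :=
      analyticAt_const
    have h2 : PolyAnalyticAt (fun z : Fin N → ℂ => (complexRecursionState z 0).2.1)
      (toComplex x) := PolyAnalyticAt.const 0
    have h3 : PolyAnalyticAt (fun z : Fin N → ℂ => complexOrthoPoly z 0) (toComplex x) :=
      PolyAnalyticAt.const 1
    exact ⟨h1, h2, h3, hres 0 h1 h2 h3⟩
  | succ m ih =>
    obtain ⟨-, -, h3, h4⟩ := ih fun k hk1 hk2 => hreg k hk1 (by omega)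
    have hb := hreg (m + 1) (by omega) le_rfl
    have hrad : complexMomentIntegral (toComplex x) (complexResidualPoly (toComplex x) m ^ 2) =
        (momentIntegral x (residualPoly x m ^ 2) : ℂ) := by
      rw [(complexRecursionState_toComplex x fun k hk1 hk2 => hreg k hk1 (by omega)).2,
        ← Polynomial.map_pow, complexMomentIntegral_map]
    have hpos : 0 < momentIntegral x (residualPoly x m ^ 2) := by
      rw [recB_succ] at hb
      exact Real.sqrt_pos.1 hb
    have hb' : AnalyticAt ℂ (fun z => (complexRecursionState z (m + 1)).1) (toComplex x) := by
      simp only [complexRecursionState_succ]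
      refine h4.sq.complexMomentIntegral.cpow analyticAt_const ?_
      rw [hrad]
      exact Complex.ofReal_mem_slitPlane.2 hpos
    have hne : (complexRecursionState (toComplex x) (m + 1)).1 ≠ 0 := by
      rw [(complexRecursionState_toComplex x hreg).1]
      exact Complex.ofReal_ne_zero.2 hb.ne'
    have hp : PolyAnalyticAt (fun z => complexOrthoPoly z (m + 1)) (toComplex x) :=
      (PolyAnalyticAt.C (hb'.inv hne)).mul h4
    exact ⟨hb', h3, hp, hres _ hb' h3 hp⟩

theorem eventually_regular (x : Fin N → ℝ) {m : ℕ}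
    (hreg : ∀ k, 1 ≤ k → k ≤ m → 0 < recB x k) :
    ∀ᶠ y in 𝓝 x, ∀ k, 1 ≤ k → k ≤ m → 0 < recB y k := by
  induction m with
  | zero => exact Eventually.of_forall fun y k h1 h2 => by omega
  | succ m ih =>
    have hreg' : ∀ k, 1 ≤ k → k ≤ m → 0 < recB x k := fun k hk1 hk2 => hreg k hk1 (by omega)
    have hb := hreg (m + 1) (by omega) le_rfl
    obtain ⟨-, -, -, h4⟩ := polyAnalyticAt_recursion x hreg'
    have hrad : ∀ y : Fin N → ℝ, (∀ k, 1 ≤ k → k ≤ m → 0 < recB y k) →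
        complexMomentIntegral (toComplex y) (complexResidualPoly (toComplex y) m ^ 2) =
        (momentIntegral y (residualPoly y m ^ 2) : ℂ) := by
      intro y hy
      rw [(complexRecursionState_toComplex y hy).2, ← Polynomial.map_pow,
        complexMomentIntegral_map]
    have hcont : ContinuousAt (fun y : Fin N → ℝ => (complexMomentIntegral (toComplex y)
        (complexResidualPoly (toComplex y) m ^ 2)).re) x :=
      Complex.continuous_re.continuousAt.comp
        (h4.sq.complexMomentIntegral.continuousAt.comp continuous_toComplex.continuousAt)
    have hpos : 0 < (complexMomentIntegral (toComplex x)
        (complexResidualPoly (toComplex x) m ^ 2)).re := by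
      rw [hrad x hreg', Complex.ofReal_re]
      rw [recB_succ] at hb
      exact Real.sqrt_pos.1 hb
    filter_upwards [ih hreg', hcont.eventually (lt_mem_nhds hpos)] with y hy1 hy2 k hk1 hk2
    rcases Nat.lt_or_ge k (m + 1) with h | h
    · exact hy1 k hk1 (by omega)
    · obtain rfl : k = m + 1 := by omega
      rw [hrad y hy1, Complex.ofReal_re] at hy2
      rw [recB_succ]
      exact Real.sqrt_pos.2 hy2

end ComplexRecursion

/-! ### Nodes and weights of the quadrature rule in the regular case -/

section RegularNodes

open Polynomial

/-- The Christoffel–Darboux identity on the diagonal. -/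
theorem christoffel_darboux {N : ℕ} (x : Fin N → ℝ) {m : ℕ}
    (hreg : ∀ k, 1 ≤ k → k ≤ m → 0 < recB x k) :
    derivative (residualPoly x m) * orthoPoly x m - derivative (orthoPoly x m) * residualPoly x m =
      ∑ k ∈ Finset.range (m + 1), orthoPoly x k ^ 2 := by
  have hstep : ∀ k, derivative (residualPoly x k) * orthoPoly x k
      - derivative (orthoPoly x k) * residualPoly x k = orthoPoly x k ^ 2
        + C (recB x k) * (derivative (orthoPoly x k) * prevPoly x k
          - derivative (prevPoly x k) * orthoPoly x k) := by
    intro k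
    simp only [residualPoly, derivative_sub, derivative_mul, derivative_X, derivative_C]
    ring
  induction m with
  | zero =>
    rw [hstep]
    simp
  | succ m ih =>
    have hb := recB_mul_orthoPoly_succ x (hreg (m + 1) (by omega) le_rfl)
    have hb' := congrArg derivative hb
    simp only [derivative_mul, derivative_C, zero_mul, zero_add] at hb'
    rw [Finset.sum_range_succ, ← ih fun k hk1 hk2 => hreg k hk1 (by omega), hstep, prevPoly_succ]
    linear_combination (orthoPoly x m) * hb' - (derivative (orthoPoly x m)) * hb

variable {n : ℕ} {x : Fin (2 * n + 1) → ℝ}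

theorem eigenvectorBasis_eq (hreg : RecursionRegular n x) (s k : Fin (n + 1)) :
    (jacobiMatrix_isHermitian n x).eigenvectorBasis s k =
      (jacobiMatrix_isHermitian n x).eigenvectorBasis s 0 *
        (orthoPoly x k).eval ((jacobiMatrix_isHermitian n x).eigenvalues s) := by
  have h1 := (eigenvector_eq_orthoPoly
    ((jacobiMatrix_isHermitian n x).mulVec_eigenvectorBasis s) le_rfl hreg k
    (Nat.le_of_lt_succ k.2)).1
  rwa [zeroExtend_val] at h1

theorem sum_eigenvectorBasis_mul (s t : Fin (n + 1)) :
    ∑ k, (jacobiMatrix_isHermitian n x).eigenvectorBasis s k *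
      (jacobiMatrix_isHermitian n x).eigenvectorBasis t k = if s = t then 1 else 0 := by
  have h1 := (orthonormal_iff_ite (𝕜 := ℝ)).1
    (jacobiMatrix_isHermitian n x).eigenvectorBasis.orthonormal s t
  rw [PiLp.inner_apply] at h1
  rw [← h1]
  refine Finset.sum_congr rfl fun k _ => ?_
  simp [mul_comm]

/-- The weight of a node is the value of the Christoffel function at the node. -/
theorem weight_mul_sum_sq (hreg : RecursionRegular n x) (s : Fin (n + 1)) :
    (jacobiMatrix_isHermitian n x).eigenvectorBasis s 0 ^ 2 * ∑ k : Fin (n + 1),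
      (orthoPoly x k).eval ((jacobiMatrix_isHermitian n x).eigenvalues s) ^ 2 = 1 := by
  have h1 := sum_eigenvectorBasis_mul (x := x) s s
  rw [if_pos rfl] at h1
  rw [← h1, Finset.mul_sum]
  refine Finset.sum_congr rfl fun k _ => ?_
  rw [eigenvectorBasis_eq hreg s k]
  ring

theorem eigenvectorBasis_zero_ne_zero (hreg : RecursionRegular n x) (s : Fin (n + 1)) :
    (jacobiMatrix_isHermitian n x).eigenvectorBasis s 0 ≠ 0 := by
  intro h
  have := weight_mul_sum_sq hreg s
  rw [h] at this
  simp at this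

/-- In the regular case an eigenvector is determined by its eigenvalue, up to a factor. -/
theorem eigenvalues_injective (hreg : RecursionRegular n x) :
    Function.Injective (jacobiMatrix_isHermitian n x).eigenvalues := by
  intro s t hst
  by_contra hne
  have h1 := sum_eigenvectorBasis_mul (x := x) s t
  rw [if_neg hne] at h1
  have h2 : (jacobiMatrix_isHermitian n x).eigenvectorBasis s 0 *
      (jacobiMatrix_isHermitian n x).eigenvectorBasis t 0 * ∑ k : Fin (n + 1),
      (orthoPoly x k).eval ((jacobiMatrix_isHermitian n x).eigenvalues s) ^ 2 = 0 := by
    rw [← h1, Finset.mul_sum]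
    refine Finset.sum_congr rfl fun k _ => ?_
    rw [eigenvectorBasis_eq hreg s k, eigenvectorBasis_eq hreg t k, ← hst]
    ring
  rcases mul_eq_zero.1 h2 with h3 | h3
  · exact (mul_ne_zero (eigenvectorBasis_zero_ne_zero hreg s)
      (eigenvectorBasis_zero_ne_zero hreg t)) h3
  · have := weight_mul_sum_sq hreg s
    rw [h3] at this
    simp at this

theorem eval_residualPoly_eigenvalues (hreg : RecursionRegular n x) (s : Fin (n + 1)) :
    (residualPoly x n).eval ((jacobiMatrix_isHermitian n x).eigenvalues s) = 0 := by
  have h1 := eigenvector_residualPoly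
    ((jacobiMatrix_isHermitian n x).mulVec_eigenvectorBasis s) le_rfl hreg
  have h2 : zeroExtend ((jacobiMatrix_isHermitian n x).eigenvectorBasis s) (n + 1) = 0 :=
    dif_neg (lt_irrefl _)
  rw [h2, mul_zero] at h1
  exact (mul_eq_zero.1 h1).resolve_left (eigenvectorBasis_zero_ne_zero hreg s)

theorem sum_orthoPoly_sq_pos (x : Fin (2 * n + 1) → ℝ) (θ : ℝ) :
    0 < ∑ k : Fin (n + 1), (orthoPoly x k).eval θ ^ 2 :=
  Finset.sum_pos' (fun k _ => sq_nonneg _) ⟨0, Finset.mem_univ _, by simp⟩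

theorem eval_derivative_residualPoly_ne_zero (hreg : RecursionRegular n x) (s : Fin (n + 1)) :
    (derivative (residualPoly x n)).eval ((jacobiMatrix_isHermitian n x).eigenvalues s) ≠ 0 := by
  intro h
  have h1 := congrArg (eval ((jacobiMatrix_isHermitian n x).eigenvalues s))
    (christoffel_darboux x hreg)
  rw [eval_sub, eval_mul, eval_mul, h, eval_residualPoly_eigenvalues hreg s, eval_finsetSum,
    Finset.sum_range] at h1
  simp only [eval_pow, zero_mul, mul_zero, sub_zero] at h1
  exact (sum_orthoPoly_sq_pos x _).ne h1

theorem bopTheta_eq_sum (hreg : RecursionRegular n x) (O : ℝ → ℝ) :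
    bopTheta O n x = ∑ s, O ((jacobiMatrix_isHermitian n x).eigenvalues s) /
      ∑ k : Fin (n + 1), (orthoPoly x k).eval
        ((jacobiMatrix_isHermitian n x).eigenvalues s) ^ 2 := by
  refine Finset.sum_congr rfl fun s _ => ?_
  rw [eq_div_iff (sum_orthoPoly_sq_pos x _).ne', mul_assoc, weight_mul_sum_sq hreg s, mul_one]

/-- In the regular case the nodes can be replaced by any family of `n + 1` distinct complex zeros of
the residual. -/
theorem sum_roots_eq_bopTheta (hreg : RecursionRegular n x) {O : ℝ → ℝ} {Oc : ℂ → ℂ}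
    (hO : ∀ y : ℝ, Oc y = O y) {r : Fin (n + 1) → ℂ} (hr : Function.Injective r)
    (hroot : ∀ s, ((residualPoly x n).map Complex.ofRealHom).eval (r s) = 0) :
    ∑ s, Oc (r s) / ∑ k : Fin (n + 1), ((orthoPoly x k).map Complex.ofRealHom).eval (r s) ^ 2 =
      (bopTheta O n x : ℂ) := by
  classical
  set θ := (jacobiMatrix_isHermitian n x).eigenvalues with hθ
  set R := (residualPoly x n).map Complex.ofRealHom with hR
  have hR0 : R ≠ 0 := by
    intro h
    rw [hR, Polynomial.map_eq_zero] at h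
    exact eval_derivative_residualPoly_ne_zero hreg 0 (by rw [h]; simp)
  -- `R` has at most `n + 1` zeros, so that both families exhaust them
  have hcard : R.roots.toFinset.card ≤ n + 1 :=
    (Multiset.toFinset_card_le _).trans ((card_roots' R).trans
      (natDegree_map_le.trans (natDegree_residualPoly_le x n)))
  have himage : ∀ f : Fin (n + 1) → ℂ, Function.Injective f → (∀ s, R.eval (f s) = 0) →
      Finset.univ.image f = R.roots.toFinset := by
    intro f hf hf0
    refine Finset.eq_of_subset_of_card_le ?_ ?_
    · intro y hy
      obtain ⟨s, -, rfl⟩ := Finset.mem_image.1 hy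
      rw [Multiset.mem_toFinset, mem_roots hR0]
      exact hf0 s
    · rw [Finset.card_image_of_injective _ hf, Finset.card_univ, Fintype.card_fin]
      exact hcard
  have h1 := himage r hr hroot
  have h2 := himage (fun s => (θ s : ℂ))
    (Complex.ofReal_injective.comp (eigenvalues_injective hreg)) fun s => by
      rw [hR, eval_map, ← Complex.ofRealHom_eq_coe, eval₂_hom,
        eval_residualPoly_eigenvalues hreg s, map_zero]
  set g : ℂ → ℂ := fun ζ =>
    Oc ζ / ∑ k : Fin (n + 1), ((orthoPoly x k).map Complex.ofRealHom).eval ζ ^ 2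
  have h3 : ∑ s, g (r s) = ∑ s, g (θ s) := by
    rw [← Finset.sum_image (f := g) (g := r) hr.injOn,
      ← Finset.sum_image (f := g) (g := fun s => (θ s : ℂ))
        (Complex.ofReal_injective.comp (eigenvalues_injective hreg)).injOn, h1, h2]
  refine h3.trans ?_
  rw [bopTheta_eq_sum hreg]
  push_cast
  refine Finset.sum_congr rfl fun s _ => ?_
  simp only [g, hO]
  congr 1
  refine Finset.sum_congr rfl fun k _ => ?_
  rw [eval_map, ← Complex.ofRealHom_eq_coe, eval₂_hom]
  rfl

end RegularNodes

/-! ### Analyticity of the nonlinear map -/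

section Analyticity

open Polynomial

/-- A complex extension of the observable that is analytic near the real points at which the observable
is smooth.  At zero temperature it is defined by the real part of the argument. -/
theorem exists_complex_observable {β : ℝ≥0∞} {μ : ℝ} {O : ℝ → ℝ}
    (hO : O = fermiDirac β μ ∨ O = grandPotential β μ) :
    ∃ Oc : ℂ → ℂ, (∀ y : ℝ, Oc y = O y) ∧ ∀ y : ℝ, (β = ⊤ → y ≠ μ) → AnalyticAt ℂ Oc y := by
  by_cases htop : β = ⊤
  · have hlt : ∀ y : ℝ, y < μ → ∀ᶠ z : ℂ in 𝓝 (y : ℂ), z.re < μ := fun y hy =>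
      Complex.continuous_re.continuousAt.eventually (gt_mem_nhds (by simpa using hy))
    have hgt : ∀ y : ℝ, μ < y → ∀ᶠ z : ℂ in 𝓝 (y : ℂ), μ < z.re := fun y hy =>
      Complex.continuous_re.continuousAt.eventually (lt_mem_nhds (by simpa using hy))
    rcases hO with rfl | rfl
    · refine ⟨fun z => (fermiDirac β μ z.re : ℂ), fun y => by simp, fun y hy => ?_⟩
      rcases (hy htop).lt_or_gt with h | h
      · refine (analyticAt_const (v := (1 : ℂ))).congr ((hlt y h).mono fun z hz => ?_)
        simp [fermiDirac, htop, hz]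
      · refine (analyticAt_const (v := (0 : ℂ))).congr ((hgt y h).mono fun z hz => ?_)
        simp [fermiDirac, htop, hz.not_gt, hz.ne']
    · refine ⟨fun z => if z.re < μ then 2 * (z - μ) else 0, fun y => ?_, fun y hy => ?_⟩
      · simp only [grandPotential, htop, if_true, Complex.ofReal_re]
        split_ifs <;> simp
      · rcases (hy htop).lt_or_gt with h | h
        · have h1 : AnalyticAt ℂ (fun z : ℂ => 2 * (z - μ)) y := by fun_prop
          refine h1.congr ((hlt y h).mono fun z hz => ?_)
          simp [hz]
        · refine (analyticAt_const (v := (0 : ℂ))).congr ((hgt y h).mono fun z hz => ?_)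
          simp [hz.not_gt]
  · set b := β.toReal
    have hden : ∀ y : ℝ, (1 + Complex.exp (b * (y - μ)) : ℂ) ≠ 0 := fun y => by
      have : (1 + Real.exp (b * (y - μ))) ≠ 0 := by positivity
      exact_mod_cast this
    have hF : ∀ y : ℝ, ((1 + Complex.exp (b * (y - μ)))⁻¹ : ℂ) = (fermiDirac β μ y : ℂ) := fun y => by
      simp [fermiDirac, htop, b]
    have hFa : ∀ y : ℝ, AnalyticAt ℂ (fun z : ℂ => (1 + Complex.exp (b * (z - μ)))⁻¹) y := fun y =>
      AnalyticAt.fun_inv (by fun_prop) (hden y)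
    rcases hO with rfl | rfl
    · exact ⟨fun z => (1 + Complex.exp (b * (z - μ)))⁻¹, hF, fun y _ => hFa y⟩
    · have hpos : ∀ y : ℝ, 0 < 1 - fermiDirac β μ y := fun y =>
        sub_pos.2 (fermiDirac_lt_one htop μ y)
      refine ⟨fun z => 2 / b * Complex.log (1 - (1 + Complex.exp (b * (z - μ)))⁻¹), fun y => ?_,
        fun y _ => ?_⟩
      · simp only [hF]
        rw [grandPotential, if_neg htop]
        push_cast
        rw [Complex.ofReal_log (hpos y).le]
        push_cast
        rfl
      · refine analyticAt_const.mul (AnalyticAt.clog (analyticAt_const.sub (hFa y)) ?_)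
        simp only [hF]
        have := Complex.ofReal_mem_slitPlane.2 (hpos y)
        exact_mod_cast this

/-- The local form of the analyticity of `Θ`: near regular moments, the nodes are simple zeros of the
residual and the weights are the values of the Christoffel function. -/
theorem exists_local_extension {n : ℕ} {x₀ : Fin (2 * n + 1) → ℝ} (hreg : RecursionRegular n x₀)
    {O : ℝ → ℝ} {Oc : ℂ → ℂ} (hO : ∀ y : ℝ, Oc y = O y)
    (hOc : ∀ s, AnalyticAt ℂ Oc ((jacobiMatrix_isHermitian n x₀).eigenvalues s : ℂ)) :
    ∃ f : (Fin (2 * n + 1) → ℂ) → ℂ, AnalyticAt ℂ f (toComplex x₀) ∧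
      ∀ᶠ x in 𝓝 x₀, f (toComplex x) = (bopTheta O n x : ℂ) := by
  set θ := (jacobiMatrix_isHermitian n x₀).eigenvalues
  have hreg' : ∀ k ≤ n, ∀ j, 1 ≤ j → j ≤ k → 0 < recB x₀ j := fun k hk j h1 h2 =>
    hreg j h1 (h2.trans hk)
  have hR := (polyAnalyticAt_recursion x₀ (hreg' n le_rfl)).2.2.2
  have hRx := (complexRecursionState_toComplex x₀ (hreg' n le_rfl)).2
  have hmap : ∀ (P : ℝ[X]) (y : ℝ), (P.map Complex.ofRealHom).eval (y : ℂ) = ((P.eval y : ℝ) : ℂ) :=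
    fun P y => by rw [eval_map, ← Complex.ofRealHom_eq_coe, eval₂_hom, Complex.ofRealHom_eq_coe]
  have hroots : ∀ s, ∃ r : (Fin (2 * n + 1) → ℂ) → ℂ, AnalyticAt ℂ r (toComplex x₀) ∧
      r (toComplex x₀) = θ s ∧
      ∀ᶠ z in 𝓝 (toComplex x₀), (complexResidualPoly z n).eval (r z) = 0 := by
    intro s
    refine hR.exists_root ?_ ?_
    · rw [hRx, hmap, eval_residualPoly_eigenvalues hreg s, Complex.ofReal_zero]
    · rw [hRx, derivative_map, hmap]
      exact_mod_cast eval_derivative_residualPoly_ne_zero hreg s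
  choose r hr hr0 hrz using hroots
  have hp : ∀ k : Fin (n + 1), PolyAnalyticAt (fun z => complexOrthoPoly z k) (toComplex x₀) :=
    fun k => (polyAnalyticAt_recursion x₀ (hreg' k (Nat.le_of_lt_succ k.2))).2.2.1
  have hpx : ∀ x : Fin (2 * n + 1) → ℝ, RecursionRegular n x → ∀ k : Fin (n + 1),
      complexOrthoPoly (toComplex x) k = (orthoPoly x k).map Complex.ofRealHom := by
    intro x hx k
    rw [complexOrthoPoly, (complexRecursionState_toComplex x fun j h1 h2 =>
      hx j h1 (h2.trans (Nat.le_of_lt_succ k.2))).1]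
  refine ⟨fun z => ∑ s, Oc (r s z) / ∑ k : Fin (n + 1), (complexOrthoPoly z k).eval (r s z) ^ 2,
    ?_, ?_⟩
  · refine Finset.analyticAt_fun_sum _ fun s _ => AnalyticAt.fun_div ?_ ?_ ?_
    · exact AnalyticAt.comp_of_eq (hOc s) (hr s) (hr0 s)
    · exact Finset.analyticAt_fun_sum _ fun k _ => ((hp k).eval (hr s)).pow 2
    · have h1 := sum_orthoPoly_sq_pos x₀ (θ s)
      simp only [hpx x₀ hreg, hr0, hmap]
      exact_mod_cast h1.ne'
  · have htends : Tendsto (toComplex (N := 2 * n + 1)) (𝓝 x₀) (𝓝 (toComplex x₀)) :=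
      continuous_toComplex.continuousAt
    have hdist : ∀ s t, s ≠ t → ∀ᶠ z in 𝓝 (toComplex x₀), r s z ≠ r t z := by
      intro s t hst
      refine ((hr s).continuousAt.prodMk (hr t).continuousAt).eventually
        ((isOpen_ne_fun continuous_fst continuous_snd).mem_nhds ?_)
      simp only [hr0, Set.mem_ofPred_eq, ne_eq, Complex.ofReal_inj]
      exact fun h => hst (eigenvalues_injective hreg h)
    have hinj : ∀ᶠ z in 𝓝 (toComplex x₀), ∀ s t, s ≠ t → r s z ≠ r t z :=
      eventually_all.2 fun s => eventually_all.2 fun t => by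
        by_cases hst : s = t
        · exact Eventually.of_forall fun z h => absurd hst h
        · exact (hdist s t hst).mono fun z hz _ => hz
    filter_upwards [eventually_regular x₀ (hreg' n le_rfl), htends.eventually hinj,
      htends.eventually (eventually_all.2 hrz)] with x hx hxi hxr
    have h1 := sum_roots_eq_bopTheta (x := x) (r := fun s => r s (toComplex x)) hx hO
      (fun s t h => by
        by_contra hne
        exact hxi s t hne h)
      (fun s => by
        rw [← (complexRecursionState_toComplex x hx).2]
        exact hxr s)
    rw [← h1]
    simp only [hpx x hx]

/-- Gluing of the local extensions of `Θ`. -/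
theorem bopTheta_analytic (β : ℝ≥0∞) (μ : ℝ) (O : ℝ → ℝ) (n : ℕ)
    (hO : O = fermiDirac β μ ∨ O = grandPotential β μ) :
    ∃ (U : Set (Fin (2 * n + 1) → ℂ)) (Θ : (Fin (2 * n + 1) → ℂ) → ℂ),
      IsOpen U ∧ AnalyticOnNhd ℂ Θ U ∧
      ∀ x : Fin (2 * n + 1) → ℝ, RecursionRegular n x →
        (β = ⊤ → μ ∉ spectrum ℝ (jacobiMatrix n x)) →
        (fun j => (x j : ℂ)) ∈ U ∧ Θ (fun j => (x j : ℂ)) = (bopTheta O n x : ℂ) := by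
  obtain ⟨Oc, hOc, hana⟩ := exists_complex_observable hO
  obtain ⟨U, F, hU, hF, hval⟩ := exists_analytic_extension
    {x : Fin (2 * n + 1) → ℝ | RecursionRegular n x ∧
      (β = ⊤ → μ ∉ spectrum ℝ (jacobiMatrix n x))} (fun x => (bopTheta O n x : ℂ)) (by
      rintro x₀ ⟨h1, h2⟩
      refine exists_local_extension h1 hOc fun s => hana _ fun htop h => h2 htop ?_
      rw [← h]
      exact (jacobiMatrix_isHermitian n x₀).eigenvalues_mem_spectrum_real s)
  exact ⟨U, F, hU, hF, fun x h1 h2 => hval x ⟨h1, h2⟩⟩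

end Analyticity

/-! ### Analyticity and exponential convergence of the nonlinear scheme -/

theorem mainTheorem2 :
    -- `Θ` extends to an analytic function on an open set
    (∀ (β : ℝ≥0∞) (μ : ℝ) (O : ℝ → ℝ) (n : ℕ), 0 < β →
      (O = fermiDirac β μ ∨ O = grandPotential β μ) →
      ∃ (U : Set (Fin (2 * n + 1) → ℂ)) (Θ : (Fin (2 * n + 1) → ℂ) → ℂ),
        IsOpen U ∧ AnalyticOnNhd ℂ Θ U ∧
        ∀ x : Fin (2 * n + 1) → ℝ, RecursionRegular n x →
          (β = ⊤ → μ ∉ spectrum ℝ (jacobiMatrix n x)) →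
          (fun j => (x j : ℂ)) ∈ U ∧ Θ (fun j => (x j : ℂ)) = (bopTheta O n x : ℂ)) ∧
    -- the error estimate, with rates depending on the bands and the temperature only
    ∃ (γN : Bands → ℝ≥0∞ → ℕ → ℝ) (γ : Bands → ℝ≥0∞ → ℝ),
      (∀ (B : Bands) (β : ℝ≥0∞), 0 < β → (β = ⊤ → B.Insulating) →
        0 < γ B β ∧ Tendsto (γN B β) atTop (𝓝 (γ B β))) ∧
      (∀ a b μ : ℝ, a < μ → μ < b →
        ∃ c₁ > 0, ∃ c₂ > 0, ∃ ε > 0, ∀ (B : Bands) (β : ℝ≥0∞),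
          B.minLower = a → B.maxUpper = b → B.μ = μ → B.Symmetric → 0 < β →
          0 < B.gap + β⁻¹.toReal → B.gap + β⁻¹.toReal < ε →
          c₁ * (B.gap + β⁻¹.toReal) ≤ γ B β ∧ γ B β ≤ c₂ * (B.gap + β⁻¹.toReal)) ∧
      (∀ (d Nb : ℕ) (Λ : Type uSite) (S : Type uSpecies) [Countable Λ]
        (M : TBFunctions d Nb S) (u : Configuration d Λ S),
        0 < Nb → u.Admissible → IsTightBinding M u →
        ∀ (B : Bands) (lam : Finset ℝ) (β : ℝ≥0∞) (O : ℝ → ℝ), 0 < β →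
          spectrum ℂ (hamiltonian M u) ⊆ (fun x : ℝ => (x : ℂ)) '' B.withDefects lam →
          (β = ⊤ → B.Insulating ∧ 0 < B.defectGap lam) →
          (O = fermiDirac β B.μ ∨ O = grandPotential β B.μ) →
          ∃ K > 0, ∀ (l : Λ) (n : ℕ),
            |localObservable M u O l
                - Nb * bopTheta O n (ldosMoments M u l (2 * n + 1))|
              ≤ K * Real.exp (-γN B β (2 * n + 1) * ((2 * n + 1 : ℕ) : ℝ))) := by
  refine ⟨fun β μ O n _ hO => bopTheta_analytic β μ O n hO,
    fun B β _ => decayRate B β, decayRate,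
    fun B β hβ h => ⟨decayRate_pos B hβ h, tendsto_const_nhds⟩,
    fun a b μ ha _ => decayRate_comparable b ha, ?_⟩
  intro d Nb Λ S _ M u hNb hu hM B lam β O hβ hσ hB hO
  exact localObservable_error M u hNb hu hM B lam β O hβ hσ hB hO
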